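/- Let $L^2(\mathcal G)=L^2(-\infty,0)\oplus L^2(0,\infty)$ (complex-valued functions) and, for $Z\in\mathbb R$, let $A_Z u=u'''+u'$ (componentwise) with domain $$D(A_Z)=\{u=(u_-,u_+)\in H^3(-\infty,0)\oplus H^3(0,\infty): u_-(0)=u_+(0),\ u_+'(0)-u_-'(0)=Zu_-(0),\ u_+''(0)-u_-''(0)=\tfrac{Z^2}{2}u_-(0)+Zu_-'(0)\}.$$ Then $A_Z$ is the infinitesimal generator of exactly one strongly continuous unitary group $\{W(t)\}_{t\in\mathbb R}$ on $L^2(\mathcal G)$, and it has the following representation. Let $\operatorname{Re}\lambda>0$. The roots $\gamma_1,\gamma_2,\gamma_3$ of $\lambda+\gamma+\gamma^3=0$ can be ordered so that $\operatorname{Re}\gamma_1<0<\operatorname{Re}\gamma_2,\operatorname{Re}\gamma_3$. Put $\Delta=(\gamma_1-\gamma_2)(\gamma_1-\gamma_3)(\gamma_2-\gamma_3)$, let $Y(x,\zeta)=1$ if $\zeta\le x$ and $0$ otherwise, and $$G_+(x,\zeta,\lambda)=\tfrac1\Delta\big[(\gamma_3-\gamma_1)e^{\gamma_1x-\gamma_2\zeta}+(\gamma_1-\gamma_2)e^{\gamma_1x-\gamma_3\zeta}+H\big],\qquad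 G_-(x,\zeta,\lambda)=\tfrac1\Delta\big[(\gamma_3-\gamma_1)e^{\gamma_2x-\gamma_1\zeta}+(\gamma_1-\gamma_2)e^{\gamma_3x-\gamma_1\zeta}+H\big],$$ $$H=Y(x,\zeta)(\gamma_2-\gamma_3)e^{\gamma_1(x-\zeta)}+(1-Y(x,\zeta))\big[(\gamma_1-\gamma_3)e^{\gamma_2(x-\zeta)}+(\gamma_2-\gamma_1)e^{\gamma_3(x-\zeta)}\big].$$ These are Green's functions of $\lambda v+v'+v'''$: $G_+$ on $(0,\infty)$ with $v(0)=0$, $v(+\infty)=v'(+\infty)=0$, and $G_-$ on $(-\infty,0)$ with $v(0)=v'(0)=0$, $v(-\infty)=0$. For $\omega=(p,q)\in L^2(\mathcal G)$ set $$v_-^\lambda(x)=\alpha_1e^{\gamma_2x}+\alpha_2e^{\gamma_3x}+\int_{-\infty}^0G_-(x,\zeta,\lambda)p(\zeta)\,d\zeta\ (x\le0),\qquad v_+^\lambda(x)=\alpha_3e^{\gamma_1x}+\int_0^\infty G_+(x,\zeta,\lambda)q(\zeta)\,d\zeta\ (x\ge0),$$ $$\tilde v_-^\lambda(x)=\tilde\alpha_3e^{-\gamma_1x}+\int_{-\infty}^0G_+(-x,-\zeta,\lambda)p(\zeta)\,d\zeta\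 (x\le0),\qquad \tilde v_+^\lambda(x)=\tilde\alpha_1e^{-\gamma_2x}+\tilde\alpha_2e^{-\gamma_3x}+\int_0^\infty G_-(-x,-\zeta,\lambda)q(\zeta)\,d\zeta\ (x\ge0).$$ There are unique $\alpha_1,\alpha_2,\alpha_3\in\mathbb C$ (depending on $\lambda,p,q$) with $(v_-^\lambda,v_+^\lambda)\in D(A_Z)$ and unique $\tilde\alpha_1,\tilde\alpha_2,\tilde\alpha_3\in\mathbb C$ with $(\tilde v_-^\lambda,\tilde v_+^\lambda)\in D(A_Z)$; with these constants, $$(v_-^\lambda,v_+^\lambda)=(\lambda+A_Z)^{-1}\omega,\qquad(\tilde v_-^\lambda,\tilde v_+^\lambda)=(\lambda-A_Z)^{-1}\omega.$$ For all $t>0$ and $r>0$ the two components of $W(-t)\omega$ and of $W(t)\omega$ are $$(W(-t)\omega)_\pm(x)=\frac1{2\pi i}\int_{r-i\infty}^{r+i\infty}e^{\lambda t}v_\pm^\lambda(x)\,d\lambda,\qquad (W(t)\omega)_\pm(x)=\frac1{2\pi i}\int_{r-i\infty}^{r+i\infty}e^{\lambda t}\tilde v_\pm^\lambda(x)\,d\lambda,$$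 where $\int_{r-i\infty}^{r+i\infty}=\lim_{N\to\infty}\int_{r-iN}^{r+iN}$, the integrands being integrable on each $[r-iN,r+iN]$ for every $x$ in the closed half-line, and the limit being taken in $L^2$ of each half-line. If $\omega\in D(A_Z)$, the limit also holds at every point $x\le0$, respectively $x\ge0$, for the continuous representatives of the components. -/

import Mathlib

open MeasureTheory Set Filter
open scoped Topology

noncomputable section

/-- The space `L²(-∞, 0) ⊕ L²(0, ∞)` of complex-valued functions on the star graph with two
half-lines, with its Hilbert space structure. -/
abbrev L2G : Type :=
  WithLp 2 (Lp ℂ 2 (volume.restrict (Iio (0 : ℝ))) × Lp ℂ 2 (volume.restrict (Ioi (0 : ℝ))))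

/-- `u 0` is the `C²` representative on the interval `S` of an element of `H³(S)`, and `u 1`, `u 2`,
`u 3` are its derivatives (`u 2` absolutely continuous, `u 3` its almost everywhere derivative):
all four are square integrable on `S` and each one is a primitive on `S` of the next. -/
structure IsH3 (S : Set ℝ) (u : Fin 4 → ℝ → ℂ) : Prop where
  memLp : ∀ i, MemLp (u i) 2 (volume.restrict S)
  primitive : ∀ i : Fin 3, ∀ x ∈ S, ∀ y ∈ S,
    u i.castSucc y - u i.castSucc x = ∫ t in x..y, u i.succ t

/-- The pair `(um 0, up 0)` is in `H³(-∞, 0) ⊕ H³(0, ∞)`, with derivatives `um i`, `up i`, and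
satisfies the vertex conditions of `δ`-type interaction of strength `Z`. -/
structure IsAiryPair (Z : ℝ) (um up : Fin 4 → ℝ → ℂ) : Prop where
  left : IsH3 (Iic 0) um
  right : IsH3 (Ici 0) up
  bc0 : um 0 0 = up 0 0
  bc1 : up 1 0 - um 1 0 = Z * um 0 0
  bc2 : (Z : ℂ) ^ 2 / 2 * um 0 0 + Z * um 1 0 = up 2 0 - um 2 0

/-- The graph `{(u, A_Z u) : u ∈ D(A_Z)}` of the operator `A_Z u = u''' + u'`. -/
def airyGraph (Z : ℝ) : Set (L2G × L2G) :=
  {w | ∃ um up : Fin 4 → ℝ → ℂ, IsAiryPair Z um up ∧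
    w.1.fst =ᵐ[volume.restrict (Iio 0)] um 0 ∧
    w.1.snd =ᵐ[volume.restrict (Ioi 0)] up 0 ∧
    w.2.fst =ᵐ[volume.restrict (Iio 0)] (fun x => um 3 x + um 1 x) ∧
    w.2.snd =ᵐ[volume.restrict (Ioi 0)] (fun x => up 3 x + up 1 x)}

/-- The domain `D(A_Z)`. -/
def airyDomain (Z : ℝ) : Set L2G := {u | ∃ f, (u, f) ∈ airyGraph Z}

/-- The pair of functions `vm` on `(-∞, 0]` and `vp` on `[0, ∞)` belongs to `D(A_Z)` (and the
functions are the continuous representatives). -/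
def InAiryDomain (Z : ℝ) (vm vp : ℝ → ℂ) : Prop :=
  ∃ um up : Fin 4 → ℝ → ℂ, IsAiryPair Z um up ∧
    (∀ x ≤ 0, vm x = um 0 x) ∧ (∀ x ≥ 0, vp x = up 0 x)

/-- `W` is a strongly continuous one-parameter group of unitary operators. -/
structure IsUnitaryGroup (W : ℝ → (L2G ≃ₗᵢ[ℂ] L2G)) : Prop where
  zero : ∀ u, W 0 u = u
  add : ∀ s t u, W (s + t) u = W s (W t u)
  continuous : ∀ u, Continuous fun t => W t u

/-- The graph of the infinitesimal generator of `W`. -/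
def generatorGraph (W : ℝ → (L2G ≃ₗᵢ[ℂ] L2G)) : Set (L2G × L2G) :=
  {w | HasDerivAt (fun t : ℝ => W t w.1) w.2 0}

/-- `γ 0, γ 1, γ 2` are the roots, with multiplicity, of `X ^ 3 + X + lam`, ordered so that
`Re (γ 0) < 0 < Re (γ 1), Re (γ 2)`. -/
structure IsOrderedRoots (lam : ℂ) (γ : Fin 3 → ℂ) : Prop where
  roots : ∀ X : ℂ, X ^ 3 + X + lam = (X - γ 0) * (X - γ 1) * (X - γ 2)
  neg : (γ 0).re < 0
  pos1 : 0 < (γ 1).re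
  pos2 : 0 < (γ 2).re

/-- The discriminant factor `Δ`. -/
def rootDelta (γ : Fin 3 → ℂ) : ℂ := (γ 0 - γ 1) * (γ 0 - γ 2) * (γ 1 - γ 2)

/-- The explicit Green's function on `(0, ∞)`. -/
def greenPlus (γ : Fin 3 → ℂ) (x ζ : ℝ) : ℂ :=
  (rootDelta γ)⁻¹ *
    ((γ 2 - γ 0) * Complex.exp (γ 0 * x - γ 1 * ζ) + (γ 0 - γ 1) * Complex.exp (γ 0 * x - γ 2 * ζ)
      + if ζ ≤ x then (γ 1 - γ 2) * Complex.exp (γ 0 * (x - ζ))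
        else (γ 0 - γ 2) * Complex.exp (γ 1 * (x - ζ)) + (γ 1 - γ 0) * Complex.exp (γ 2 * (x - ζ)))

/-- The explicit Green's function on `(-∞, 0)`. -/
def greenMinus (γ : Fin 3 → ℂ) (x ζ : ℝ) : ℂ :=
  (rootDelta γ)⁻¹ *
    ((γ 2 - γ 0) * Complex.exp (γ 1 * x - γ 0 * ζ) + (γ 0 - γ 1) * Complex.exp (γ 2 * x - γ 0 * ζ)
      + if ζ ≤ x then (γ 1 - γ 2) * Complex.exp (γ 0 * (x - ζ))
        else (γ 0 - γ 2) * Complex.exp (γ 1 * (x - ζ)) + (γ 1 - γ 0) * Complex.exp (γ 2 * (x - ζ)))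

/-- `lam g + g' + g''' = δ(x - ζ)` on the open interval `S`: here `g₁ = g'`, both `g` and `g'` are
continuous on `S`, the homogeneous equation holds classically off `ζ`, and `g''` has a unit jump
at `ζ`. -/
def IsFundamental (lam : ℂ) (S : Set ℝ) (ζ : ℝ) (g g₁ : ℝ → ℂ) : Prop :=
  (∀ x ∈ S, HasDerivAt g (g₁ x) x) ∧ ContinuousOn g₁ S ∧
  ∃ g₂ : ℝ → ℂ,
    (∀ x ∈ S, x ≠ ζ → HasDerivAt g₁ (g₂ x) x ∧ HasDerivAt g₂ (-(lam * g x + g₁ x)) x) ∧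
    ∃ l : ℂ, Tendsto g₂ (𝓝[<] ζ) (𝓝 l) ∧ Tendsto g₂ (𝓝[>] ζ) (𝓝 (l + 1))

/-- `G` is a Green's function on `(0, ∞)` for `lam v + v' + v'''` with `v(0) = 0`,
`v(+∞) = v'(+∞) = 0`. -/
def IsGreenPlus (lam : ℂ) (G : ℝ → ℝ → ℂ) : Prop :=
  ∀ ζ > 0, ∃ g₁ : ℝ → ℂ, IsFundamental lam (Ioi 0) ζ (fun x => G x ζ) g₁ ∧
    G 0 ζ = 0 ∧ Tendsto (fun x => G x ζ) (𝓝[>] 0) (𝓝 0) ∧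
    Tendsto (fun x => G x ζ) atTop (𝓝 0) ∧ Tendsto g₁ atTop (𝓝 0)

/-- `G` is a Green's function on `(-∞, 0)` for `lam v + v' + v'''` with `v(0) = v'(0) = 0`,
`v(-∞) = 0`. -/
def IsGreenMinus (lam : ℂ) (G : ℝ → ℝ → ℂ) : Prop :=
  ∀ ζ < 0, ∃ g₁ : ℝ → ℂ, IsFundamental lam (Iio 0) ζ (fun x => G x ζ) g₁ ∧
    G 0 ζ = 0 ∧ Tendsto (fun x => G x ζ) (𝓝[<] 0) (𝓝 0) ∧ Tendsto g₁ (𝓝[<] 0) (𝓝 0) ∧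
    Tendsto (fun x => G x ζ) atBot (𝓝 0)

/-- `a 0 * exp (γ 1 x) + a 1 * exp (γ 2 x) + ∫_{-∞}^0 G₋(x, ζ) p(ζ) dζ`. -/
def resMinus (γ a : Fin 3 → ℂ) (p : ℝ → ℂ) (x : ℝ) : ℂ :=
  a 0 * Complex.exp (γ 1 * x) + a 1 * Complex.exp (γ 2 * x) + ∫ ζ in Iio 0, greenMinus γ x ζ * p ζ

/-- `a 2 * exp (γ 0 x) + ∫_0^∞ G₊(x, ζ) q(ζ) dζ`. -/
def resPlus (γ a : Fin 3 → ℂ) (q : ℝ → ℂ) (x : ℝ) : ℂ :=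
  a 2 * Complex.exp (γ 0 * x) + ∫ ζ in Ioi 0, greenPlus γ x ζ * q ζ

/-- Component on `(-∞, 0]` obtained from `resPlus` by the reflection `x ↦ -x`:
`a 2 * exp (-γ 0 x) + ∫_{-∞}^0 G₊(-x, -ζ) p(ζ) dζ`. -/
def resReflMinus (γ a : Fin 3 → ℂ) (p : ℝ → ℂ) (x : ℝ) : ℂ :=
  a 2 * Complex.exp (-γ 0 * x) + ∫ ζ in Iio 0, greenPlus γ (-x) (-ζ) * p ζ

/-- Component on `[0, ∞)` obtained from `resMinus` by the reflection `x ↦ -x`: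
`a 0 * exp (-γ 1 x) + a 1 * exp (-γ 2 x) + ∫_0^∞ G₋(-x, -ζ) q(ζ) dζ`. -/
def resReflPlus (γ a : Fin 3 → ℂ) (q : ℝ → ℂ) (x : ℝ) : ℂ :=
  a 0 * Complex.exp (-γ 1 * x) + a 1 * Complex.exp (-γ 2 * x)
    + ∫ ζ in Ioi 0, greenMinus γ (-x) (-ζ) * q ζ

/-- `v` is the only element of `L²` with `v ∈ D(A_Z)` and `(lam + A_Z) v = ω`, that is,
`v = (lam + A_Z)⁻¹ ω`. -/
def IsResolventAdd (Z : ℝ) (lam : ℂ) (ω v : L2G) : Prop :=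
  ∀ v' : L2G, (v', ω - lam • v') ∈ airyGraph Z ↔ v' = v

/-- `v` is the only element of `L²` with `v ∈ D(A_Z)` and `(lam - A_Z) v = ω`, that is,
`v = (lam - A_Z)⁻¹ ω`. -/
def IsResolventSub (Z : ℝ) (lam : ℂ) (ω v : L2G) : Prop :=
  ∀ v' : L2G, (v', lam • v' - ω) ∈ airyGraph Z ↔ v' = v

/-- The element `v` of `L²` is represented by `vm` on `(-∞, 0)` and by `vp` on `(0, ∞)`. -/
def IsRepresentedBy (v : L2G) (vm vp : ℝ → ℂ) : Prop :=
  v.fst =ᵐ[volume.restrict (Iio 0)] vm ∧ v.snd =ᵐ[volume.restrict (Ioi 0)] vp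

/-- The truncated Bromwich integral `(2πi)⁻¹ ∫_{r - iN}^{r + iN} exp (lam t) F(lam) d lam`. -/
def bromwich (F : ℂ → ℂ) (t r N : ℝ) : ℂ :=
  (2 * Real.pi * Complex.I)⁻¹ * ∫ s in (-N)..N,
    Complex.exp ((r + s * Complex.I) * t) * F (r + s * Complex.I) * Complex.I

/-- On the interval `S`, `g(x) = (2πi)⁻¹ ∫_{r - i∞}^{r + i∞} exp (lam t) F(lam, x) d lam`, the
integral being the limit in `L²(S)` of the truncated ones, whose integrands are integrable. -/
def IsBromwichL2 (t r : ℝ) (S : Set ℝ) (F : ℂ → ℝ → ℂ) (g : ℝ → ℂ) : Prop :=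
  (∀ x ∈ S, ∀ N : ℝ, IntervalIntegrable (fun s : ℝ =>
    Complex.exp ((r + s * Complex.I) * t) * F (r + s * Complex.I) x) volume (-N) N) ∧
  Tendsto (fun N : ℝ => eLpNorm (fun x => bromwich (fun lam => F lam x) t r N - g x) 2
    (volume.restrict S)) atTop (𝓝 0)

/-- On the interval `S`, the continuous representative of `g` is given at every point by
`(2πi)⁻¹ ∫_{r - i∞}^{r + i∞} exp (lam t) F(lam, x) d lam`, as a limit of the truncated integrals. -/
def IsBromwichPointwise (t r : ℝ) (S : Set ℝ) (F : ℂ → ℝ → ℂ) (g : ℝ → ℂ) : Prop :=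
  ∃ f : ℝ → ℂ, ContinuousOn f S ∧ g =ᵐ[volume.restrict S] f ∧
    ∀ x ∈ S, Tendsto (fun N : ℝ => bromwich (fun lam => F lam x) t r N) atTop (𝓝 (f x))

/-- The element `U` of `L²` is given componentwise by the inversion integrals of
`Fm` on `(-∞, 0]` and of `Fp` on `[0, ∞)` along `Re lam = r`: in `L²`, and at every point if
`ω ∈ D(A_Z)`. -/
def IsInverseLaplace (Z : ℝ) (ω U : L2G) (t r : ℝ) (Fm Fp : ℂ → ℝ → ℂ) : Prop :=
  IsBromwichL2 t r (Iic 0) Fm U.fst ∧ IsBromwichL2 t r (Ici 0) Fp U.snd ∧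
  (ω ∈ airyDomain Z →
    IsBromwichPointwise t r (Iic 0) Fm U.fst ∧ IsBromwichPointwise t r (Ici 0) Fp U.snd)

end

noncomputable section

theorem IntervalIntegrable.absolutelyContinuousOnInterval_complex {w : ℝ → ℂ} {a b : ℝ}
    (h : IntervalIntegrable w volume a b) :
    AbsolutelyContinuousOnInterval (fun x => ∫ t in a..x, w t) a b := by
  have hN := (absolutelyContinuousOnInterval_iff _ _ _).1
    (h.norm.absolutelyContinuousOnInterval_intervalIntegral (c := a) left_mem_uIcc)
  rw [absolutelyContinuousOnInterval_iff]
  intro ε hε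
  obtain ⟨δ, hδ, H⟩ := hN ε hε
  refine ⟨δ, hδ, fun E hE hs => lt_of_le_of_lt (Finset.sum_le_sum fun i hi => ?_) (H E hE hs)⟩
  have hmem := hE.1 i (Finset.mem_range.1 hi |> Finset.mem_range.2)
  have i1 : IntervalIntegrable w volume a (E.2 i).1 :=
    h.mono_set (uIcc_subset_uIcc left_mem_uIcc hmem.1)
  have i2 : IntervalIntegrable w volume a (E.2 i).2 :=
    h.mono_set (uIcc_subset_uIcc left_mem_uIcc hmem.2)
  rw [dist_eq_norm, dist_eq_norm, intervalIntegral.integral_interval_sub_left i1 i2,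
    intervalIntegral.integral_interval_sub_left i1.norm i2.norm]
  exact intervalIntegral.norm_integral_le_abs_integral_norm

theorem integral_add_mul_of_primitive {u u' v v' : ℝ → ℂ} {a b : ℝ}
    (hu' : IntervalIntegrable u' volume a b) (hv' : IntervalIntegrable v' volume a b)
    (hu : ∀ x ∈ uIcc a b, u x - u a = ∫ t in a..x, u' t)
    (hv : ∀ x ∈ uIcc a b, v x - v a = ∫ t in a..x, v' t) :
    u b * v b - u a * v a = ∫ t in a..b, (u' t * v t + u t * v' t) := by
  have acc : ∀ {w w' : ℝ → ℂ}, IntervalIntegrable w' volume a b →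
      AbsolutelyContinuousOnInterval (fun x => w a + ∫ t in a..x, w' t) a b := by
    intro w w' h
    have h1 : LipschitzOnWith 0 (fun _ : ℝ => w a) (uIcc a b) :=
      (LipschitzWith.const (w a)).lipschitzOnWith
    have h2 := h.absolutelyContinuousOnInterval_complex
    exact h1.absolutelyContinuousOnInterval.fun_add h2
  set U : ℝ → ℂ := fun x => u a + ∫ t in a..x, u' t with hU
  set V : ℝ → ℂ := fun x => v a + ∫ t in a..x, v' t with hV
  have hUu : ∀ x ∈ uIcc a b, u x = U x := fun x hx => by simp [U, ← hu x hx]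
  have hVv : ∀ x ∈ uIcc a b, v x = V x := fun x hx => by simp [V, ← hv x hx]
  have aU : AbsolutelyContinuousOnInterval U a b := acc hu'
  have aV : AbsolutelyContinuousOnInterval V a b := acc hv'
  have hI : IntervalIntegrable (fun t => u' t * V t + U t * v' t) volume a b :=
    (hu'.mul_continuousOn aV.continuousOn).add (hv'.continuousOn_mul aU.continuousOn)
  have hconst := (((aU.smul aV).sub
    hI.absolutelyContinuousOnInterval_complex)).const_of_ae_hasDerivAt_zero (by
    filter_upwards [hu'.ae_hasDerivAt_integral, hv'.ae_hasDerivAt_integral,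
      hI.ae_hasDerivAt_integral] with x h1 h2 h3 hx
    have d1 : HasDerivAt U (u' x) x := (h1 hx a (by simp)).const_add _
    have d2 : HasDerivAt V (v' x) x := (h2 hx a (by simp)).const_add _
    have d3 := (d1.mul d2).sub (h3 hx a (by simp))
    rw [sub_self] at d3
    exact d3)
  obtain ⟨C, hC⟩ := hconst
  have e1 := hC a (by simp)
  have e2 := hC b (by simp)
  simp only [Pi.sub_apply, Pi.mul_apply, intervalIntegral.integral_same, smul_eq_mul,
    sub_zero] at e1 e2
  rw [hUu b (by simp), hVv b (by simp), hUu a (by simp), hVv a (by simp),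
    intervalIntegral.integral_congr (g := fun t => u' t * V t + U t * v' t)
      (fun t ht => by simp only [hUu t ht, hVv t ht])]
  linear_combination e2 - e1

theorem MeasureTheory.MemLp.intervalIntegrable_of_mem {S : Set ℝ} [S.OrdConnected] {f : ℝ → ℂ}
    (hf : MemLp f 2 (volume.restrict S)) {x y : ℝ} (hx : x ∈ S) (hy : y ∈ S) :
    IntervalIntegrable f volume x y := by
  rw [intervalIntegrable_iff]
  have h : MemLp f 2 (volume.restrict (uIoc x y)) :=
    hf.mono_measure (Measure.restrict_mono
      (uIoc_subset_uIcc.trans (Set.OrdConnected.uIcc_subset ‹_› hx hy)) le_rfl)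
  have : IsFiniteMeasure (volume.restrict (uIoc x y)) :=
    ⟨by rw [Measure.restrict_apply_univ, uIoc]; exact measure_Ioc_lt_top⟩
  exact h.integrable (by norm_num)

namespace IsH3

variable {S : Set ℝ} {u v : Fin 4 → ℝ → ℂ}

theorem mono {T : Set ℝ} (hu : IsH3 S u) (h : T ⊆ S) : IsH3 T u where
  memLp i := (hu.memLp i).mono_measure (Measure.restrict_mono h le_rfl)
  primitive i x hx y hy := hu.primitive i x (h hx) y (h hy)

theorem intervalIntegrable [S.OrdConnected] (hu : IsH3 S u) (i : Fin 4) {x y : ℝ} (hx : x ∈ S)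
    (hy : y ∈ S) : IntervalIntegrable (u i) volume x y :=
  (hu.memLp i).intervalIntegrable_of_mem hx hy

theorem add [S.OrdConnected] (hu : IsH3 S u) (hv : IsH3 S v) :
    IsH3 S (fun i x => u i x + v i x) where
  memLp i := (hu.memLp i).add (hv.memLp i)
  primitive i x hx y hy := by
    rw [intervalIntegral.integral_add (hu.intervalIntegrable _ hx hy)
      (hv.intervalIntegrable _ hx hy), ← hu.primitive i x hx y hy, ← hv.primitive i x hx y hy]
    ring

theorem const_mul (hu : IsH3 S u) (c : ℂ) : IsH3 S (fun i x => c * u i x) where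
  memLp i := (hu.memLp i).const_mul c
  primitive i x hx y hy := by
    rw [intervalIntegral.integral_const_mul, ← hu.primitive i x hx y hy]
    ring

theorem sub [S.OrdConnected] (hu : IsH3 S u) (hv : IsH3 S v) :
    IsH3 S (fun i x => u i x - v i x) := by
  simpa [sub_eq_add_neg] using hu.add (hv.const_mul (-1))

theorem continuousOn [S.OrdConnected] (hu : IsH3 S u) (i : Fin 3) :
    ContinuousOn (u i.castSucc) S := by
  have hS : MeasurableSet S := OrdConnected.measurableSet ‹_›
  have hf : MemLp (S.indicator (u i.succ)) 2 (volume.restrict univ) := by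
    rw [Measure.restrict_univ]
    exact (memLp_indicator_iff_restrict hS).2 (hu.memLp i.succ)
  intro x hx
  have hc : Continuous fun y => u i.castSucc x + ∫ t in x..y, S.indicator (u i.succ) t :=
    continuous_const.add (intervalIntegral.continuous_primitive
      (fun a b => hf.intervalIntegrable_of_mem (mem_univ a) (mem_univ b)) x)
  refine (hc.continuousWithinAt (s := S) (x := x)).congr_of_mem (fun y hy => ?_) hx
  rw [intervalIntegral.integral_congr (g := u i.succ)
    (fun t ht => indicator_of_mem (Set.OrdConnected.uIcc_subset ‹_› hx hy ht) _),
    ← hu.primitive i x hx y hy]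
  ring

theorem eqOn_zero_succ [S.OrdConnected] (hu : IsH3 S u) (hS : S ⊆ closure (interior S)) (i : Fin 2)
    (h0 : ∀ x ∈ S, u i.castSucc.castSucc x = 0) : ∀ x ∈ S, u i.castSucc.succ x = 0 := by
  have hc : ContinuousOn (u i.castSucc.succ) S := hu.continuousOn i.succ
  refine EqOn.of_subset_closure (s := interior S) (t := S) (g := fun _ => 0) (fun x hx => ?_) hc
    continuousOn_const interior_subset hS
  have hxS := interior_subset hx
  have hd : HasDerivAt (fun y => ∫ t in x..y, u i.castSucc.succ t) (u i.castSucc.succ x) x :=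
    intervalIntegral.integral_hasDerivAt_right (by simp)
      (hc.mono interior_subset |>.stronglyMeasurableAtFilter isOpen_interior x hx)
      (hc.continuousAt (mem_interior_iff_mem_nhds.1 hx))
  refine hd.unique ((hasDerivAt_const x (0 : ℂ)).congr_of_eventuallyEq ?_)
  filter_upwards [mem_interior_iff_mem_nhds.1 hx] with y hy
  rw [← hu.primitive i.castSucc x hxS y hy, h0 x hxS, h0 y hy, sub_zero]

/-- The representatives of the first two derivatives are determined by the function. -/
theorem eqOn_of_eqOn [S.OrdConnected] (hu : IsH3 S u) (hv : IsH3 S v)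
    (hS : S ⊆ closure (interior S)) (h0 : ∀ x ∈ S, u 0 x = v 0 x) :
    (∀ x ∈ S, u 1 x = v 1 x) ∧ ∀ x ∈ S, u 2 x = v 2 x := by
  have h1 := (hu.sub hv).eqOn_zero_succ hS 0 (fun x hx => sub_eq_zero.2 (h0 x hx))
  have h2 := (hu.sub hv).eqOn_zero_succ hS 1 h1
  exact ⟨fun x hx => sub_eq_zero.1 (h1 x hx), fun x hx => sub_eq_zero.1 (h2 x hx)⟩

theorem integral_mul_conj [S.OrdConnected] (hu : IsH3 S u) (hv : IsH3 S v) (i j : Fin 3)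
    {x y : ℝ} (hx : x ∈ S) (hy : y ∈ S) :
    starRingEnd ℂ (u i.castSucc y) * v j.castSucc y -
      starRingEnd ℂ (u i.castSucc x) * v j.castSucc x
      = ∫ t in x..y, (starRingEnd ℂ (u i.succ t) * v j.castSucc t
          + starRingEnd ℂ (u i.castSucc t) * v j.succ t) := by
  have hsub : uIcc x y ⊆ S := Set.OrdConnected.uIcc_subset ‹_› hx hy
  refine integral_add_mul_of_primitive (u := fun t => starRingEnd ℂ (u i.castSucc t))
    (u' := fun t => starRingEnd ℂ (u i.succ t)) ?_ (hv.intervalIntegrable _ hx hy) ?_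
    (fun z hz => hv.primitive j x hx z (hsub hz))
  · exact (hu.memLp i.succ).star.intervalIntegrable_of_mem hx hy
  · intro z hz
    rw [intervalIntegral.intervalIntegral_conj, ← hu.primitive i x hx z (hsub hz), map_sub]

/-- The boundary form of the operator `u ↦ u''' + u'`. -/
def boundaryForm (u v : Fin 4 → ℝ → ℂ) (x : ℝ) : ℂ :=
  starRingEnd ℂ (u 2 x) * v 0 x - starRingEnd ℂ (u 1 x) * v 1 x + starRingEnd ℂ (u 0 x) * v 2 x
    + starRingEnd ℂ (u 0 x) * v 0 x

/-- The derivative of the boundary form. -/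
def greenDensity (u v : Fin 4 → ℝ → ℂ) (x : ℝ) : ℂ :=
  starRingEnd ℂ (u 3 x + u 1 x) * v 0 x + starRingEnd ℂ (u 0 x) * (v 3 x + v 1 x)

theorem integrable_conj_mul (hu : IsH3 S u) (hv : IsH3 S v) (i j : Fin 4) :
    IntegrableOn (fun t => starRingEnd ℂ (u i t) * v j t) S volume :=
  (hu.memLp i).star.integrable_mul (hv.memLp j)

theorem integrableOn_boundaryForm (hu : IsH3 S u) (hv : IsH3 S v) :
    IntegrableOn (boundaryForm u v) S volume :=
  (((hu.integrable_conj_mul hv 2 0).sub (hu.integrable_conj_mul hv 1 1)).add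
    (hu.integrable_conj_mul hv 0 2)).add (hu.integrable_conj_mul hv 0 0)

theorem integrableOn_greenDensity (hu : IsH3 S u) (hv : IsH3 S v) :
    IntegrableOn (greenDensity u v) S volume := by
  refine (((hu.integrable_conj_mul hv 3 0).add (hu.integrable_conj_mul hv 1 0)).add
    ((hu.integrable_conj_mul hv 0 3).add (hu.integrable_conj_mul hv 0 1))).congr
    (.of_forall fun t => ?_)
  simp only [greenDensity, Pi.add_apply, map_add]
  ring

theorem boundaryForm_sub [S.OrdConnected] (hu : IsH3 S u) (hv : IsH3 S v) {x y : ℝ} (hx : x ∈ S)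
    (hy : y ∈ S) :
    boundaryForm u v y - boundaryForm u v x = ∫ t in x..y, greenDensity u v t := by
  have hi : ∀ i j : Fin 4, IntervalIntegrable (fun t => starRingEnd ℂ (u i t) * v j t) volume x y :=
    fun i j => intervalIntegrable_iff.2 ((hu.integrable_conj_mul hv i j).mono_set
      (uIoc_subset_uIcc.trans (Set.OrdConnected.uIcc_subset ‹_› hx hy)))
  have e1 := hu.integral_mul_conj hv 2 0 hx hy
  have e2 := hu.integral_mul_conj hv 1 1 hx hy
  have e3 := hu.integral_mul_conj hv 0 2 hx hy
  have e4 := hu.integral_mul_conj hv 0 0 hx hy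
  simp only [Fin.reduceCastSucc, Fin.reduceSucc] at e1 e2 e3 e4
  rw [intervalIntegral.integral_add (hi _ _) (hi _ _)] at e1 e2 e3 e4
  have e5 : ∫ t in x..y, greenDensity u v t =
      ∫ t in x..y, ((starRingEnd ℂ (u 3 t) * v 0 t + starRingEnd ℂ (u 1 t) * v 0 t) +
        (starRingEnd ℂ (u 0 t) * v 3 t + starRingEnd ℂ (u 0 t) * v 1 t)) :=
    intervalIntegral.integral_congr fun t _ => by simp only [greenDensity, map_add]; ring
  rw [intervalIntegral.integral_add ((hi _ _).add (hi _ _)) ((hi _ _).add (hi _ _)),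
    intervalIntegral.integral_add (hi _ _) (hi _ _),
    intervalIntegral.integral_add (hi _ _) (hi _ _)] at e5
  rw [e5]
  simp only [boundaryForm, Fin.isValue] at *
  linear_combination e1 - e2 + e3 + e4

theorem integral_greenDensity_Ioi (hu : IsH3 (Ici 0) u) (hv : IsH3 (Ici 0) v) :
    ∫ t in Ioi 0, greenDensity u v t = -boundaryForm u v 0 := by
  have hint := (hu.integrableOn_greenDensity hv).mono_set Ioi_subset_Ici_self
  have ht : Tendsto (boundaryForm u v) atTop
      (𝓝 (boundaryForm u v 0 + ∫ t in Ioi 0, greenDensity u v t)) := by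
    refine ((intervalIntegral_tendsto_integral_Ioi 0 hint tendsto_id).const_add _).congr' ?_
    filter_upwards [eventually_ge_atTop 0] with x hx
    rw [id, ← hu.boundaryForm_sub hv (mem_Ici.2 le_rfl) hx]
    ring
  have h0 := IntegrableAtFilter.eq_zero_of_tendsto (μ := volume)
    ⟨Ici 0, Ici_mem_atTop 0, hu.integrableOn_boundaryForm hv⟩ (fun s hs => by
      obtain ⟨b, hb⟩ := mem_atTop_sets.1 hs
      exact top_le_iff.1 (Real.volume_Ici (a := b) ▸ measure_mono hb)) ht
  linear_combination h0

theorem integral_greenDensity_Iio (hu : IsH3 (Iic 0) u) (hv : IsH3 (Iic 0) v) :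
    ∫ t in Iio 0, greenDensity u v t = boundaryForm u v 0 := by
  have hint := hu.integrableOn_greenDensity hv
  rw [← integral_Iic_eq_integral_Iio]
  have ht : Tendsto (boundaryForm u v) atBot
      (𝓝 (boundaryForm u v 0 - ∫ t in Iic 0, greenDensity u v t)) := by
    refine ((intervalIntegral_tendsto_integral_Iic 0 hint tendsto_id).const_sub _).congr' ?_
    filter_upwards [eventually_le_atBot 0] with x hx
    rw [id, ← hu.boundaryForm_sub hv hx (mem_Iic.2 le_rfl)]
    ring
  have h0 := IntegrableAtFilter.eq_zero_of_tendsto (μ := volume)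
    ⟨Iic 0, Iic_mem_atBot 0, hu.integrableOn_boundaryForm hv⟩ (fun s hs => by
      obtain ⟨b, hb⟩ := mem_atBot_sets.1 hs
      exact top_le_iff.1 (Real.volume_Iic (a := b) ▸ measure_mono hb)) ht
  linear_combination -h0

end IsH3

theorem IsAiryPair.boundaryForm_eq {Z : ℝ} {um up vm vp : Fin 4 → ℝ → ℂ} (hu : IsAiryPair Z um up)
    (hv : IsAiryPair Z vm vp) : IsH3.boundaryForm um vm 0 = IsH3.boundaryForm up vp 0 := by
  have a1 : up 1 0 = um 1 0 + Z * um 0 0 := by linear_combination hu.bc1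
  have a2 : up 2 0 = um 2 0 + (Z ^ 2 / 2 * um 0 0 + Z * um 1 0) := by linear_combination -hu.bc2
  have b1 : vp 1 0 = vm 1 0 + Z * vm 0 0 := by linear_combination hv.bc1
  have b2 : vp 2 0 = vm 2 0 + (Z ^ 2 / 2 * vm 0 0 + Z * vm 1 0) := by linear_combination -hv.bc2
  simp only [IsH3.boundaryForm, ← hu.bc0, ← hv.bc0, a1, a2, b1, b2, map_add, map_mul, map_div₀,
    map_pow, Complex.conj_ofReal, map_ofNat]
  ring

theorem IsAiryPair.add {Z : ℝ} {um up vm vp : Fin 4 → ℝ → ℂ} (hu : IsAiryPair Z um up)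
    (hv : IsAiryPair Z vm vp) :
    IsAiryPair Z (fun i x => um i x + vm i x) (fun i x => up i x + vp i x) where
  left := hu.left.add hv.left
  right := hu.right.add hv.right
  bc0 := by linear_combination hu.bc0 + hv.bc0
  bc1 := by linear_combination hu.bc1 + hv.bc1
  bc2 := by linear_combination hu.bc2 + hv.bc2

theorem IsAiryPair.const_mul {Z : ℝ} {um up : Fin 4 → ℝ → ℂ} (hu : IsAiryPair Z um up) (c : ℂ) :
    IsAiryPair Z (fun i x => c * um i x) (fun i x => c * up i x) where
  left := hu.left.const_mul c
  right := hu.right.const_mul c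
  bc0 := by linear_combination c * hu.bc0
  bc1 := by linear_combination c * hu.bc1
  bc2 := by linear_combination c * hu.bc2

theorem airyGraph_add {Z : ℝ} {u f v g : L2G} (hu : (u, f) ∈ airyGraph Z)
    (hv : (v, g) ∈ airyGraph Z) : (u + v, f + g) ∈ airyGraph Z := by
  obtain ⟨um, up, h, h1, h2, h3, h4⟩ := hu
  obtain ⟨vm, vp, k, k1, k2, k3, k4⟩ := hv
  refine ⟨_, _, h.add k, ?_, ?_, ?_, ?_⟩
  · filter_upwards [Lp.coeFn_add u.fst v.fst, h1, k1] with x e e1 e2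
    exact e.trans (by rw [Pi.add_apply, e1, e2])
  · filter_upwards [Lp.coeFn_add u.snd v.snd, h2, k2] with x e e1 e2
    exact e.trans (by rw [Pi.add_apply, e1, e2])
  · filter_upwards [Lp.coeFn_add f.fst g.fst, h3, k3] with x e e1 e2
    exact e.trans (by rw [Pi.add_apply, e1, e2]; ring)
  · filter_upwards [Lp.coeFn_add f.snd g.snd, h4, k4] with x e e1 e2
    exact e.trans (by rw [Pi.add_apply, e1, e2]; ring)

theorem airyGraph_smul {Z : ℝ} {u f : L2G} (hu : (u, f) ∈ airyGraph Z) (c : ℂ) :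
    (c • u, c • f) ∈ airyGraph Z := by
  obtain ⟨um, up, h, h1, h2, h3, h4⟩ := hu
  refine ⟨_, _, h.const_mul c, ?_, ?_, ?_, ?_⟩
  · filter_upwards [Lp.coeFn_smul c u.fst, h1] with x e e1
    exact e.trans (by rw [Pi.smul_apply, e1, smul_eq_mul])
  · filter_upwards [Lp.coeFn_smul c u.snd, h2] with x e e1
    exact e.trans (by rw [Pi.smul_apply, e1, smul_eq_mul])
  · filter_upwards [Lp.coeFn_smul c f.fst, h3] with x e e1
    exact e.trans (by rw [Pi.smul_apply, e1, smul_eq_mul]; ring)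
  · filter_upwards [Lp.coeFn_smul c f.snd, h4] with x e e1
    exact e.trans (by rw [Pi.smul_apply, e1, smul_eq_mul]; ring)

/-- The operator `A_Z` is skew-symmetric. -/
theorem airyGraph_skew {Z : ℝ} {u f v g : L2G} (hu : (u, f) ∈ airyGraph Z)
    (hv : (v, g) ∈ airyGraph Z) : inner ℂ f v + inner ℂ u g = 0 := by
  obtain ⟨um, up, h, h1, h2, h3, h4⟩ := hu
  obtain ⟨vm, vp, k, k1, k2, k3, k4⟩ := hv
  have em : inner ℂ f.fst v.fst + inner ℂ u.fst g.fst = IsH3.boundaryForm um vm 0 := by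
    rw [L2.inner_def, L2.inner_def, ← integral_add (L2.integrable_inner _ _)
      (L2.integrable_inner _ _), ← h.left.integral_greenDensity_Iio k.left]
    refine integral_congr_ae ?_
    filter_upwards [h1, h3, k1, k3] with x e1 e2 e3 e4
    simp only [e1, e2, e3, e4, RCLike.inner_apply, IsH3.greenDensity]
    ring
  have ep : inner ℂ f.snd v.snd + inner ℂ u.snd g.snd = -IsH3.boundaryForm up vp 0 := by
    rw [L2.inner_def, L2.inner_def, ← integral_add (L2.integrable_inner _ _)
      (L2.integrable_inner _ _), ← h.right.integral_greenDensity_Ioi k.right]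
    refine integral_congr_ae ?_
    filter_upwards [h2, h4, k2, k4] with x e1 e2 e3 e4
    simp only [e1, e2, e3, e4, RCLike.inner_apply, IsH3.greenDensity]
    ring
  rw [WithLp.prod_inner_apply, WithLp.prod_inner_apply]
  change inner ℂ f.fst v.fst + inner ℂ f.snd v.snd + (inner ℂ u.fst g.fst + inner ℂ u.snd g.snd) = 0
  have hb := h.boundaryForm_eq k
  linear_combination em + ep + hb


theorem re_eq_of_cubic_root {z : ℂ} {lam : ℂ} (hz : z ^ 3 + z + lam = 0) :
    lam.re = z.re * (3 * z.im ^ 2 - z.re ^ 2 - 1) := by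
  have h := congrArg Complex.re hz
  simp only [pow_succ, pow_zero, one_mul, Complex.add_re, Complex.mul_re, Complex.mul_im,
    Complex.zero_re] at h
  linear_combination h

theorem not_two_neg_roots {a b lam : ℂ} (hlam : 0 < lam.re) (ha : a ^ 3 + a + lam = 0)
    (hb : b ^ 3 + b + lam = 0) (hab : a ^ 2 + a * b + b ^ 2 = -1) (ha0 : a.re < 0) : 0 < b.re := by
  have h1 := re_eq_of_cubic_root ha
  have h2 := re_eq_of_cubic_root hb
  by_contra! hb0
  have hb0' : b.re < 0 := lt_of_le_of_ne hb0 fun h => by rw [h] at h2; linarith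
  have h3 := congrArg Complex.re hab
  simp only [sq, Complex.add_re, Complex.mul_re, Complex.neg_re, Complex.one_re] at h3
  have h4 : 3 * a.im ^ 2 - a.re ^ 2 - 1 < 0 := by
    by_contra! h
    nlinarith
  have h5 : 3 * b.im ^ 2 - b.re ^ 2 - 1 < 0 := by
    by_contra! h
    nlinarith
  nlinarith [mul_pos_of_neg_of_neg ha0 hb0', sq_nonneg (a.im - b.im), sq_nonneg a.re,
    sq_nonneg b.re]

theorem exists_isOrderedRoots {lam : ℂ} (hlam : 0 < lam.re) :
    ∃ γ : Fin 3 → ℂ, IsOrderedRoots lam γ := by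
  obtain ⟨a, ha⟩ : ∃ a : ℂ, a ^ 3 + a + lam = 0 := by
    have hd : (Polynomial.X ^ 3 + Polynomial.X + Polynomial.C lam : Polynomial ℂ).degree = 3 := by
      compute_degree!
    obtain ⟨a, ha⟩ := IsAlgClosed.exists_root _ (by rw [hd]; norm_num)
    exact ⟨a, by simpa using ha⟩
  obtain ⟨w, hw⟩ := IsAlgClosed.exists_pow_nat_eq (a ^ 2 - 4 * (a ^ 2 + 1)) (n := 2) (by norm_num)
  obtain ⟨b, hb⟩ : ∃ b : ℂ, b = (-a + w) / 2 := ⟨_, rfl⟩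
  obtain ⟨c, hc⟩ : ∃ c : ℂ, c = (-a - w) / 2 := ⟨_, rfl⟩
  have s1 : a + b + c = 0 := by rw [hb, hc]; ring
  have s2 : a * b + a * c + b * c = 1 := by rw [hb, hc]; linear_combination -hw / 4
  have s3 : a * b * c = -lam := by
    rw [hb, hc]; linear_combination ha - a * hw / 4
  have key : ∀ X : ℂ, X ^ 3 + X + lam = (X - a) * (X - b) * (X - c) := fun X => by
    linear_combination X ^ 2 * s1 - X * s2 + s3
  have hroot : ∀ x y z : ℂ, x + y + z = 0 → x * y + x * z + y * z = 1 →
      x ^ 2 + x * y + y ^ 2 = -1 := fun x y z h1 h2 => by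
    linear_combination -h2 + (x + y) * h1
  have hb' : b ^ 3 + b + lam = 0 := by rw [key]; ring
  have hc' : c ^ 3 + c + lam = 0 := by rw [key]; ring
  have r1 := congrArg Complex.re s1
  simp only [Complex.add_re, Complex.zero_re] at r1
  have nz : ∀ z : ℂ, z ^ 3 + z + lam = 0 → z.re ≠ 0 := fun z hz h => by
    have := re_eq_of_cubic_root hz
    rw [h] at this; linarith
  have ab := fun h => not_two_neg_roots hlam ha hb' (hroot a b c s1 s2) h
  have ac := fun h => not_two_neg_roots hlam ha hc'
    (hroot a c b (by linear_combination s1) (by linear_combination s2)) h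
  have bc := fun h => not_two_neg_roots hlam hb' hc'
    (hroot b c a (by linear_combination s1) (by linear_combination s2)) h
  rcases lt_or_gt_of_ne (nz a ha) with h | h
  · exact ⟨![a, b, c], key, h, ab h, ac h⟩
  rcases lt_or_gt_of_ne (nz b hb') with h' | h'
  · exact ⟨![b, a, c], fun X =>
      (key X).trans (by change _ = (X - b) * (X - a) * (X - c); ring), h', h, bc h'⟩
  · have hc0 : c.re < 0 := by linarith
    exact ⟨![c, a, b], fun X =>
      (key X).trans (by change _ = (X - c) * (X - a) * (X - b); ring), hc0, h, h'⟩

namespace IsOrderedRoots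

variable {lam : ℂ} {γ : Fin 3 → ℂ}

theorem cube (h : IsOrderedRoots lam γ) (i : Fin 3) : γ i ^ 3 = -γ i - lam := by
  have := h.roots (γ i)
  have h0 : (γ i - γ 0) * (γ i - γ 1) * (γ i - γ 2) = 0 := by fin_cases i <;> simp
  linear_combination this + h0

theorem sum_sq (h : IsOrderedRoots lam γ) : γ 1 ^ 2 + γ 1 * γ 2 + γ 2 ^ 2 = -1 := by
  have h0 := h.roots 0
  have h1 := h.roots 1
  have h2 := h.roots (-1)
  have s1 : γ 0 + γ 1 + γ 2 = 0 := by linear_combination (h1 + h2) / 2 - h0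
  have s2 : γ 0 * γ 1 + γ 0 * γ 2 + γ 1 * γ 2 = 1 := by linear_combination (h2 - h1) / 2
  linear_combination -s2 + (γ 1 + γ 2) * s1

theorem ne01 (h : IsOrderedRoots lam γ) : γ 0 ≠ γ 1 := fun e => by
  have := h.neg; rw [e] at this; exact absurd h.pos1 this.not_gt

theorem ne02 (h : IsOrderedRoots lam γ) : γ 0 ≠ γ 2 := fun e => by
  have := h.neg; rw [e] at this; exact absurd h.pos2 this.not_gt

theorem ne12 (h : IsOrderedRoots lam γ) : γ 1 ≠ γ 2 := fun e => by
  have hs := h.sum_sq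
  have hp := h.pos2
  rw [e] at hs
  have hr := congrArg Complex.re hs
  have hi := congrArg Complex.im hs
  simp only [sq, Complex.add_re, Complex.mul_re, Complex.neg_re, Complex.one_re, Complex.add_im,
    Complex.mul_im, Complex.neg_im, Complex.one_im] at hr hi
  have him : (γ 2).im = 0 := by
    have : (γ 2).re * (γ 2).im = 0 := by linarith
    exact (mul_eq_zero.1 this).resolve_left hp.ne'
  rw [him] at hr
  nlinarith

theorem delta_ne_zero (h : IsOrderedRoots lam γ) : rootDelta γ ≠ 0 :=
  mul_ne_zero (mul_ne_zero (sub_ne_zero.2 h.ne01) (sub_ne_zero.2 h.ne02)) (sub_ne_zero.2 h.ne12)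

end IsOrderedRoots

/-- The sum of exponentials `∑ c i * exp (γ i * x)`. -/
def expSum (γ c : Fin 3 → ℂ) (x : ℝ) : ℂ := ∑ i, c i * Complex.exp (γ i * x)

theorem hasDerivAt_exp_mul (a : ℂ) (x : ℝ) :
    HasDerivAt (fun x : ℝ => Complex.exp (a * x)) (a * Complex.exp (a * x)) x := by
  have h : HasDerivAt (fun x : ℝ => a * (x : ℂ)) (a * 1) x :=
    (Complex.ofRealCLM.hasDerivAt).const_mul a
  simpa [mul_comm] using h.cexp

theorem hasDerivAt_expSum (γ c : Fin 3 → ℂ) (x : ℝ) :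
    HasDerivAt (expSum γ c) (expSum γ (fun i => γ i * c i) x) x := by
  have h : HasDerivAt (expSum γ c) (∑ i, c i * (γ i * Complex.exp (γ i * x))) x :=
    HasDerivAt.fun_sum fun i _ => (hasDerivAt_exp_mul (γ i) x).const_mul (c i)
  convert! h using 1
  exact Finset.sum_congr rfl fun i _ => by ring

theorem continuous_expSum (γ c : Fin 3 → ℂ) : Continuous (expSum γ c) :=
  continuous_iff_continuousAt.2 fun x => (hasDerivAt_expSum γ c x).continuousAt

theorem tendsto_exp_mul_atTop {a : ℂ} (ha : a.re < 0) :
    Tendsto (fun x : ℝ => Complex.exp (a * x)) atTop (𝓝 0) := by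
  rw [tendsto_zero_iff_norm_tendsto_zero]
  simp only [Complex.norm_exp, Complex.mul_re, Complex.ofReal_re, Complex.ofReal_im, mul_zero,
    sub_zero]
  exact Real.tendsto_exp_atBot.comp (tendsto_id.const_mul_atTop_of_neg ha)

theorem tendsto_exp_mul_atBot {a : ℂ} (ha : 0 < a.re) :
    Tendsto (fun x : ℝ => Complex.exp (a * x)) atBot (𝓝 0) := by
  rw [tendsto_zero_iff_norm_tendsto_zero]
  simp only [Complex.norm_exp, Complex.mul_re, Complex.ofReal_re, Complex.ofReal_im, mul_zero,
    sub_zero]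
  exact Real.tendsto_exp_atBot.comp (tendsto_id.const_mul_atBot ha)

theorem hasDerivAt_ite_le {B C B' C' : ℝ → ℂ} {ζ : ℝ} (hB : ∀ x, HasDerivAt B (B' x) x)
    (hC : ∀ x, HasDerivAt C (C' x) x) (h0 : B ζ = C ζ) (h1 : B' ζ = C' ζ) (x : ℝ) :
    HasDerivAt (fun x => if ζ ≤ x then B x else C x) (if ζ ≤ x then B' x else C' x) x := by
  rcases lt_trichotomy x ζ with h | rfl | h
  · rw [if_neg h.not_ge]
    refine (hC x).congr_of_eventuallyEq ?_
    filter_upwards [Iio_mem_nhds h] with y hy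
    exact if_neg (not_le.2 hy)
  · rw [if_pos le_rfl, ← hasDerivWithinAt_univ, ← Iic_union_Ici (a := x)]
    refine HasDerivWithinAt.union ?_ ?_
    · rw [h1]
      refine (hC x).hasDerivWithinAt.congr_of_mem (fun y hy => ?_) self_mem_Iic
      rcases eq_or_lt_of_le (mem_Iic.1 hy) with rfl | h
      · simp [h0]
      · exact if_neg h.not_ge
    · exact (hB x).hasDerivWithinAt.congr_of_mem (fun y hy => if_pos hy) self_mem_Ici
  · rw [if_pos h.le]
    refine (hB x).congr_of_eventuallyEq ?_
    filter_upwards [Ioi_mem_nhds h] with y hy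
    exact if_pos (le_of_lt hy)

/-- The coefficients of the jump of the Green's functions. -/
def jumpCoeff (γ : Fin 3 → ℂ) : Fin 3 → ℂ :=
  ![(rootDelta γ)⁻¹ * (γ 1 - γ 2), (rootDelta γ)⁻¹ * (γ 2 - γ 0), (rootDelta γ)⁻¹ * (γ 0 - γ 1)]

theorem sum_jumpCoeff (γ : Fin 3 → ℂ) : ∑ i, jumpCoeff γ i = 0 := by
  simp [Fin.sum_univ_three, jumpCoeff]; ring

theorem sum_mul_jumpCoeff (γ : Fin 3 → ℂ) : ∑ i, γ i * jumpCoeff γ i = 0 := by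
  simp [Fin.sum_univ_three, jumpCoeff]; ring

theorem sum_sq_mul_jumpCoeff {γ : Fin 3 → ℂ} (h : rootDelta γ ≠ 0) :
    ∑ i, γ i * (γ i * jumpCoeff γ i) = 1 := by
  rw [← inv_mul_cancel₀ h]
  simp only [Fin.sum_univ_three, jumpCoeff, Matrix.cons_val_zero, Matrix.cons_val_one,
    Matrix.cons_val]
  generalize (rootDelta γ)⁻¹ = d
  simp only [rootDelta]
  ring

/-- A function which on both sides of `ζ` is a sum of the exponentials of a cubic, with the right
jump at `ζ`, is a fundamental solution. -/
theorem isFundamental_ite {lam : ℂ} {γ : Fin 3 → ℂ} (h : IsOrderedRoots lam γ) (S : Set ℝ)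
    {ζ : ℝ} {cR cL : Fin 3 → ℂ}
    (hj : ∀ i, cR i - cL i = jumpCoeff γ i * Complex.exp (-γ i * ζ)) :
    IsFundamental lam S ζ (fun x => if ζ ≤ x then expSum γ cR x else expSum γ cL x)
      (fun x => if ζ ≤ x then expSum γ (fun i => γ i * cR i) x
        else expSum γ (fun i => γ i * cL i) x) := by
  have hjump : ∀ m : Fin 3 → ℂ, expSum γ (fun i => m i * cR i) ζ - expSum γ (fun i => m i * cL i) ζ
      = ∑ i, m i * jumpCoeff γ i := fun m => by
    rw [expSum, expSum, ← Finset.sum_sub_distrib]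
    refine Finset.sum_congr rfl fun i _ => ?_
    have : Complex.exp (-γ i * ζ) * Complex.exp (γ i * ζ) = 1 := by
      rw [← Complex.exp_add]; simp
    linear_combination m i * Complex.exp (γ i * ζ) * hj i + m i * jumpCoeff γ i * this
  have j0 := hjump 1
  simp only [Pi.one_apply, one_mul, sum_jumpCoeff] at j0
  have j1 := hjump γ
  rw [sum_mul_jumpCoeff] at j1
  have j2 := hjump (fun i => γ i * γ i)
  simp only [mul_assoc] at j2
  rw [sum_sq_mul_jumpCoeff h.delta_ne_zero] at j2
  have ode : ∀ c x, expSum γ (fun i => γ i * (γ i * (γ i * c i))) x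
      = -(lam * expSum γ c x + expSum γ (fun i => γ i * c i) x) := fun c x => by
    simp only [expSum, Finset.mul_sum, ← Finset.sum_add_distrib, ← Finset.sum_neg_distrib]
    exact Finset.sum_congr rfl fun i _ => by
      linear_combination c i * Complex.exp (γ i * x) * h.cube i
  have d1 := hasDerivAt_ite_le (ζ := ζ) (hasDerivAt_expSum γ cR) (hasDerivAt_expSum γ cL)
    (sub_eq_zero.1 j0) (sub_eq_zero.1 j1)
  refine ⟨fun x _ => d1 x, ?_, fun x => if ζ ≤ x then expSum γ (fun i => γ i * (γ i * cR i)) x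
        else expSum γ (fun i => γ i * (γ i * cL i)) x, fun x _ hx => ?_,
        expSum γ (fun i => γ i * (γ i * cL i)) ζ, ?_, ?_⟩
  · refine (Continuous.if_le (continuous_expSum _ _) (continuous_expSum _ _) continuous_const
      continuous_id fun x hx => ?_).continuousOn
    rw [← show ζ = x from hx]
    exact sub_eq_zero.1 j1
  · rcases lt_or_gt_of_ne hx with hx | hx
    · have hev : ∀ (f g : ℝ → ℂ), (fun y => if ζ ≤ y then f y else g y) =ᶠ[𝓝 x] g := fun f g => by
        filter_upwards [Iio_mem_nhds hx] with y hy
        exact if_neg (not_le.2 hy)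
      simp only [if_neg hx.not_ge]
      refine ⟨(hasDerivAt_expSum γ _ x).congr_of_eventuallyEq (hev _ _), ?_⟩
      rw [← ode]
      exact (hasDerivAt_expSum γ _ x).congr_of_eventuallyEq (hev _ _)
    · have hev : ∀ (f g : ℝ → ℂ), (fun y => if ζ ≤ y then f y else g y) =ᶠ[𝓝 x] f := fun f g => by
        filter_upwards [Ioi_mem_nhds hx] with y hy
        exact if_pos (le_of_lt hy)
      simp only [if_pos hx.le]
      refine ⟨(hasDerivAt_expSum γ _ x).congr_of_eventuallyEq (hev _ _), ?_⟩
      rw [← ode]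
      exact (hasDerivAt_expSum γ _ x).congr_of_eventuallyEq (hev _ _)
  · refine ((continuous_expSum γ _).continuousAt.tendsto.mono_left nhdsWithin_le_nhds).congr' ?_
    filter_upwards [self_mem_nhdsWithin] with y hy
    exact (if_neg (not_le.2 hy)).symm
  · rw [show expSum γ (fun i => γ i * (γ i * cL i)) ζ + 1
      = expSum γ (fun i => γ i * (γ i * cR i)) ζ by linear_combination -j2]
    refine ((continuous_expSum γ _).continuousAt.tendsto.mono_left nhdsWithin_le_nhds).congr' ?_
    filter_upwards [self_mem_nhdsWithin] with y hy
    exact (if_pos (le_of_lt hy)).symm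

theorem isGreenPlus_greenPlus {lam : ℂ} {γ : Fin 3 → ℂ} (h : IsOrderedRoots lam γ) :
    IsGreenPlus lam (greenPlus γ) := by
  intro ζ hζ
  set d := (rootDelta γ)⁻¹ with hd
  set E : Fin 3 → ℂ := fun i => Complex.exp (-γ i * ζ) with hE
  set cR : Fin 3 → ℂ :=
    ![d * ((γ 2 - γ 0) * E 1 + (γ 0 - γ 1) * E 2 + (γ 1 - γ 2) * E 0), 0, 0] with hcR
  set cL : Fin 3 → ℂ := ![d * ((γ 2 - γ 0) * E 1 + (γ 0 - γ 1) * E 2),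
    d * ((γ 0 - γ 2) * E 1), d * ((γ 1 - γ 0) * E 2)] with hcL
  have hG : (fun x => greenPlus γ x ζ) =
      fun x => if ζ ≤ x then expSum γ cR x else expSum γ cL x := by
    funext x
    have e : ∀ i j, Complex.exp (γ i * x - γ j * ζ) = Complex.exp (γ i * x) * E j := fun i j => by
      rw [hE, ← Complex.exp_add]; congr 1; ring
    simp only [greenPlus, mul_sub (γ _) (x : ℂ) (ζ : ℂ), e, expSum, Fin.sum_univ_three, hcR, hcL,
      Matrix.cons_val_zero, Matrix.cons_val_one, Matrix.cons_val]
    split_ifs <;> ring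
  have hL0 : expSum γ cL 0 = 0 := by
    simp [expSum, Fin.sum_univ_three, hcL]; ring
  have hF := isFundamental_ite h (Ioi 0) (ζ := ζ) (cR := cR) (cL := cL) (fun i => by
    fin_cases i <;> simp [hcR, hcL, jumpCoeff, ← hd, hE] <;> ring)
  rw [← hG] at hF
  refine ⟨_, hF, ?_, ?_, ?_, ?_⟩
  · rw [congrFun hG 0, if_neg (not_le.2 hζ), hL0]
  · rw [hG, ← hL0]
    refine ((continuous_expSum γ cL).continuousAt.tendsto.mono_left nhdsWithin_le_nhds).congr' ?_
    filter_upwards [mem_nhdsWithin_of_mem_nhds (Iio_mem_nhds hζ)] with y hy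
    exact (if_neg (not_le.2 hy)).symm
  · rw [hG]
    have ht := (tendsto_exp_mul_atTop h.neg).const_mul (cR 0)
    rw [mul_zero] at ht
    refine ht.congr' ?_
    filter_upwards [eventually_ge_atTop ζ] with y hy
    rw [if_pos hy]
    simp [expSum, Fin.sum_univ_three, hcR]
  · have ht := (tendsto_exp_mul_atTop h.neg).const_mul (γ 0 * cR 0)
    rw [mul_zero] at ht
    refine ht.congr' ?_
    filter_upwards [eventually_ge_atTop ζ] with y hy
    rw [if_pos hy]
    simp [expSum, Fin.sum_univ_three, hcR]

theorem isGreenMinus_greenMinus {lam : ℂ} {γ : Fin 3 → ℂ} (h : IsOrderedRoots lam γ) :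
    IsGreenMinus lam (greenMinus γ) := by
  intro ζ hζ
  set d := (rootDelta γ)⁻¹ with hd
  set E : Fin 3 → ℂ := fun i => Complex.exp (-γ i * ζ) with hE
  set cR : Fin 3 → ℂ :=
    ![d * ((γ 1 - γ 2) * E 0), d * ((γ 2 - γ 0) * E 0), d * ((γ 0 - γ 1) * E 0)] with hcR
  set cL : Fin 3 → ℂ := ![0, d * ((γ 2 - γ 0) * E 0 + (γ 0 - γ 2) * E 1),
    d * ((γ 0 - γ 1) * E 0 + (γ 1 - γ 0) * E 2)] with hcL
  have hG : (fun x => greenMinus γ x ζ) =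
      fun x => if ζ ≤ x then expSum γ cR x else expSum γ cL x := by
    funext x
    have e : ∀ i j, Complex.exp (γ i * x - γ j * ζ) = Complex.exp (γ i * x) * E j := fun i j => by
      rw [hE, ← Complex.exp_add]; congr 1; ring
    simp only [greenMinus, mul_sub (γ _) (x : ℂ) (ζ : ℂ), e, expSum, Fin.sum_univ_three, hcR, hcL,
      Matrix.cons_val_zero, Matrix.cons_val_one, Matrix.cons_val]
    split_ifs <;> ring
  have hR0 : expSum γ cR 0 = 0 := by
    simp [expSum, Fin.sum_univ_three, hcR]; ring
  have hR1 : expSum γ (fun i => γ i * cR i) 0 = 0 := by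
    simp [expSum, Fin.sum_univ_three, hcR]; ring
  have hF := isFundamental_ite h (Iio 0) (ζ := ζ) (cR := cR) (cL := cL) (fun i => by
    fin_cases i <;> simp [hcR, hcL, jumpCoeff, ← hd, hE] <;> ring)
  rw [← hG] at hF
  refine ⟨_, hF, ?_, ?_, ?_, ?_⟩
  · rw [congrFun hG 0, if_pos hζ.le, hR0]
  · rw [hG, ← hR0]
    refine ((continuous_expSum γ cR).continuousAt.tendsto.mono_left nhdsWithin_le_nhds).congr' ?_
    filter_upwards [mem_nhdsWithin_of_mem_nhds (Ioi_mem_nhds hζ)] with y hy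
    exact (if_pos (le_of_lt hy)).symm
  · rw [← hR1]
    refine ((continuous_expSum γ _).continuousAt.tendsto.mono_left nhdsWithin_le_nhds).congr' ?_
    filter_upwards [mem_nhdsWithin_of_mem_nhds (Ioi_mem_nhds hζ)] with y hy
    exact (if_pos (le_of_lt hy)).symm
  · rw [hG]
    have ht := ((tendsto_exp_mul_atBot h.pos1).const_mul (cL 1)).add
      ((tendsto_exp_mul_atBot h.pos2).const_mul (cL 2))
    rw [mul_zero, mul_zero, add_zero] at ht
    refine ht.congr' ?_
    filter_upwards [eventually_lt_atBot ζ] with y hy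
    rw [if_neg (not_le.2 hy)]
    simp [expSum, Fin.sum_univ_three, hcL]


/-- A special case of Young's inequality: the convolution of a square integrable function with the
square of a square integrable function is square integrable. -/
theorem lintegral_convolution_sq_lt_top {κ F : ℝ → ENNReal} (hκ : Measurable κ)
    (hF : AEMeasurable F volume) (hκ2 : ∫⁻ s, κ s ^ (2 : ℝ) < ⊤) (hF2 : ∫⁻ s, F s ^ (2 : ℝ) < ⊤) :
    ∫⁻ x, (∫⁻ ζ, κ (x - ζ) ^ (2 : ℝ) * F ζ) ^ (2 : ℝ) < ⊤ := by
  set M := ∫⁻ s, κ s ^ (2 : ℝ) with hM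
  have hκm : ∀ x, Measurable fun ζ => κ (x - ζ) := fun x =>
    hκ.comp (measurable_const.sub measurable_id)
  have hb : ∀ x, (∫⁻ ζ, κ (x - ζ) ^ (2 : ℝ) * F ζ) ^ (2 : ℝ) ≤
      M * ∫⁻ ζ, κ (x - ζ) ^ (2 : ℝ) * F ζ ^ (2 : ℝ) := fun x => by
    have h := ENNReal.lintegral_mul_le_Lp_mul_Lq volume Real.HolderConjugate.two_two
      (f := fun ζ => κ (x - ζ)) (g := fun ζ => κ (x - ζ) * F ζ) (hκm x).aemeasurable
      ((hκm x).aemeasurable.mul hF)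
    have e1 : ∫⁻ ζ, κ (x - ζ) ^ (2 : ℝ) = M := lintegral_sub_left_eq_self (fun s => κ s ^ (2 : ℝ)) x
    rw [e1] at h
    have h2 := ENNReal.rpow_le_rpow h (z := 2) (by norm_num)
    rw [ENNReal.mul_rpow_of_nonneg _ _ (by norm_num), ← ENNReal.rpow_mul, ← ENNReal.rpow_mul] at h2
    norm_num at h2
    refine le_trans (le_of_eq ?_) (h2.trans (le_of_eq ?_))
    · simp only [← mul_assoc, ENNReal.rpow_two, sq]
    · simp only [ENNReal.rpow_two, mul_pow]
  refine lt_of_le_of_lt (lintegral_mono hb) ?_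
  have hprod : AEMeasurable (Function.uncurry fun x ζ => κ (x - ζ) ^ (2 : ℝ) * F ζ ^ (2 : ℝ))
      ((volume : Measure ℝ).prod volume) := by
    refine AEMeasurable.mul ?_ ?_
    · exact ((hκ.comp (measurable_fst.sub measurable_snd)).pow_const _).aemeasurable
    · exact (hF.comp_snd).pow_const _
  have hfin : ∫⁻ x, ∫⁻ ζ, κ (x - ζ) ^ (2 : ℝ) * F ζ ^ (2 : ℝ) < ⊤ := by
    rw [lintegral_lintegral_swap hprod]
    have : ∀ ζ, ∫⁻ x, κ (x - ζ) ^ (2 : ℝ) * F ζ ^ (2 : ℝ) = M * F ζ ^ (2 : ℝ) := fun ζ => by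
      have hm : Measurable fun x => κ (x - ζ) ^ (2 : ℝ) :=
        (hκ.comp (measurable_id.sub_const ζ)).pow_const _
      rw [lintegral_mul_const _ hm]
      rw [lintegral_sub_right_eq_self (fun s => κ s ^ (2 : ℝ)) ζ]
    simp only [this]
    rw [lintegral_const_mul' _ _ hκ2.ne]
    exact ENNReal.mul_lt_top hκ2 hF2
  rw [lintegral_const_mul' _ _ hκ2.ne]
  exact ENNReal.mul_lt_top hκ2 hfin

theorem lintegral_exp_neg_abs_lt_top {c : ℝ} (hc : 0 < c) :
    ∫⁻ s : ℝ, ENNReal.ofReal (Real.exp (-(c * |s|))) < ⊤ := by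
  have h : Integrable (fun s : ℝ => Real.exp (-(c * |s|))) volume := by
    rw [← integrableOn_univ, ← Iic_union_Ioi (a := (0 : ℝ))]
    refine IntegrableOn.union ?_ ?_
    · refine (integrableOn_exp_mul_Iic hc 0).congr_fun (fun x hx => ?_) measurableSet_Iic
      simp only [abs_of_nonpos (mem_Iic.1 hx)]
      congr 1; ring
    · refine (integrableOn_exp_mul_Ioi (neg_neg_of_pos hc) 0).congr_fun (fun x hx => ?_)
        measurableSet_Ioi
      simp only [abs_of_pos (mem_Ioi.1 hx)]
      congr 1; ring
  exact h.lintegral_lt_top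

theorem memLp_two_of_norm_le_exp_convolution {c : ℝ} (hc : 0 < c) {f P : ℝ → ℂ}
    (hf : MemLp f 2 volume) (hP : AEStronglyMeasurable P volume)
    (hb : ∀ x, ‖P x‖ₑ ≤ ∫⁻ ζ, ENNReal.ofReal (Real.exp (-(c * |x - ζ|))) * ‖f ζ‖ₑ) :
    MemLp P 2 volume := by
  refine ⟨hP, ?_⟩
  rw [eLpNorm_lt_top_iff_lintegral_rpow_enorm_lt_top (by norm_num) (by norm_num)]
  have hF2 := hf.2
  rw [eLpNorm_lt_top_iff_lintegral_rpow_enorm_lt_top (by norm_num) (by norm_num)] at hF2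
  simp only [ENNReal.toReal_ofNat] at hF2 ⊢
  have hκ2 : ∀ s : ℝ, ENNReal.ofReal (Real.exp (-(c / 2 * |s|))) ^ (2 : ℝ) =
      ENNReal.ofReal (Real.exp (-(c * |s|))) := fun s => by
    rw [ENNReal.rpow_two, sq, ← ENNReal.ofReal_mul (Real.exp_pos _).le, ← Real.exp_add]
    congr 2; ring
  have h := lintegral_convolution_sq_lt_top
    (κ := fun s => ENNReal.ofReal (Real.exp (-(c / 2 * |s|)))) (F := fun s => ‖f s‖ₑ)
    (by fun_prop) hf.1.enorm (by simp only [hκ2]; exact lintegral_exp_neg_abs_lt_top hc) hF2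
  simp only [hκ2] at h
  exact lt_of_le_of_lt (lintegral_mono fun x => ENNReal.rpow_le_rpow (hb x) (by norm_num)) h

theorem norm_exp_mul_ofReal (a : ℂ) (x : ℝ) : ‖Complex.exp (a * x)‖ = Real.exp (a.re * x) := by
  simp [Complex.norm_exp]

theorem memLp_exp_Iic {a : ℂ} (ha : 0 < a.re) (b : ℝ) :
    MemLp (fun x : ℝ => Complex.exp (a * x)) 2 (volume.restrict (Iic b)) := by
  rw [memLp_two_iff_integrable_sq_norm (by fun_prop)]
  refine (integrableOn_exp_mul_Iic (a := 2 * a.re) (by linarith) b).congr (.of_forall fun x => ?_)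
  simp only [norm_exp_mul_ofReal, ← Real.exp_nat_mul]
  congr 1; push_cast; ring

theorem memLp_exp_Ioi {a : ℂ} (ha : a.re < 0) (b : ℝ) :
    MemLp (fun x : ℝ => Complex.exp (a * x)) 2 (volume.restrict (Ioi b)) := by
  rw [memLp_two_iff_integrable_sq_norm (by fun_prop)]
  refine (integrableOn_exp_mul_Ioi (a := 2 * a.re) (by linarith) b).congr (.of_forall fun x => ?_)
  simp only [norm_exp_mul_ofReal, ← Real.exp_nat_mul]
  congr 1; push_cast; ring

theorem integrableOn_exp_mul_Iic_of_memLp {a : ℂ} (ha : 0 < a.re) {b : ℝ} {f : ℝ → ℂ}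
    (hf : MemLp f 2 (volume.restrict (Iic b))) :
    IntegrableOn (fun x : ℝ => Complex.exp (a * x) * f x) (Iic b) :=
  (memLp_exp_Iic ha b).integrable_mul hf

theorem integrableOn_exp_mul_Ioi_of_memLp {a : ℂ} (ha : a.re < 0) {b : ℝ} {f : ℝ → ℂ}
    (hf : MemLp f 2 (volume.restrict (Ioi b))) :
    IntegrableOn (fun x : ℝ => Complex.exp (a * x) * f x) (Ioi b) :=
  (memLp_exp_Ioi ha b).integrable_mul hf

theorem exp_mul_sub_eq (a : ℂ) (x ζ : ℝ) : Complex.exp (a * (x - ζ)) =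
    Complex.exp (a * x) * Complex.exp (-a * ζ) := by
  rw [← Complex.exp_add]; congr 1; ring

/-- The square integrable solution of `P' = a * P + f`. -/
def expPot (a : ℂ) (f : ℝ → ℂ) (x : ℝ) : ℂ :=
  if a.re < 0 then ∫ ζ in Iic x, Complex.exp (a * (x - ζ)) * f ζ
  else -∫ ζ in Ioi x, Complex.exp (a * (x - ζ)) * f ζ

section expPot

variable {a : ℂ} {f : ℝ → ℂ}

theorem expPot_of_neg (ha : a.re < 0) (f : ℝ → ℂ) (x : ℝ) :
    expPot a f x = ∫ ζ in Iic x, Complex.exp (a * (x - ζ)) * f ζ := if_pos ha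

theorem expPot_of_pos (ha : 0 < a.re) (f : ℝ → ℂ) (x : ℝ) :
    expPot a f x = -∫ ζ in Ioi x, Complex.exp (a * (x - ζ)) * f ζ := if_neg ha.not_gt

theorem integrableOn_expPot_Iic (ha : a.re < 0) (hf : MemLp f 2 volume) (x : ℝ) :
    IntegrableOn (fun ζ : ℝ => Complex.exp (a * (x - ζ)) * f ζ) (Iic x) := by
  simp only [exp_mul_sub_eq, mul_assoc]
  exact (integrableOn_exp_mul_Iic_of_memLp (a := -a) (by simpa using ha)
    (hf.restrict _)).const_mul _

theorem integrableOn_expPot_Ioi (ha : 0 < a.re) (hf : MemLp f 2 volume) (x : ℝ) :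
    IntegrableOn (fun ζ : ℝ => Complex.exp (a * (x - ζ)) * f ζ) (Ioi x) := by
  simp only [exp_mul_sub_eq, mul_assoc]
  exact (integrableOn_exp_mul_Ioi_of_memLp (a := -a) (by simpa using ha)
    (hf.restrict _)).const_mul _

theorem exists_expPot_eq (ha : a.re ≠ 0) (hf : MemLp f 2 volume) :
    ∃ C : ℂ, ∀ x, expPot a f x =
      Complex.exp (a * x) * (C + ∫ ζ in (0 : ℝ)..x, Complex.exp (-a * ζ) * f ζ) := by
  rcases lt_or_gt_of_ne ha with ha | ha
  · refine ⟨∫ ζ in Iic (0 : ℝ), Complex.exp (-a * ζ) * f ζ, fun x => ?_⟩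
    have hi : ∀ y, IntegrableOn (fun ζ : ℝ => Complex.exp (-a * ζ) * f ζ) (Iic y) := fun y =>
      integrableOn_exp_mul_Iic_of_memLp (a := -a) (by simpa using ha) (hf.restrict _)
    simp only [expPot_of_neg ha, exp_mul_sub_eq, mul_assoc]
    rw [integral_const_mul, ← intervalIntegral.integral_Iic_sub_Iic (hi 0) (hi x)]
    ring
  · refine ⟨-∫ ζ in Ioi (0 : ℝ), Complex.exp (-a * ζ) * f ζ, fun x => ?_⟩
    have hi : ∀ y, IntegrableOn (fun ζ : ℝ => Complex.exp (-a * ζ) * f ζ) (Ioi y) := fun y =>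
      integrableOn_exp_mul_Ioi_of_memLp (a := -a) (by simpa using ha) (hf.restrict _)
    simp only [expPot_of_pos ha, exp_mul_sub_eq, mul_assoc]
    rw [integral_const_mul, ← intervalIntegral.integral_Ioi_sub_Ioi' (hi 0) (hi x)]
    ring

theorem intervalIntegrable_exp_mul (hf : MemLp f 2 volume) (a : ℂ) (x y : ℝ) :
    IntervalIntegrable (fun ζ : ℝ => Complex.exp (a * ζ) * f ζ) volume x y :=
  (hf.restrict univ |>.intervalIntegrable_of_mem (mem_univ x) (mem_univ y)).continuousOn_mul
    (by fun_prop)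

theorem continuous_expPot (ha : a.re ≠ 0) (hf : MemLp f 2 volume) : Continuous (expPot a f) := by
  obtain ⟨C, hC⟩ := exists_expPot_eq ha hf
  rw [funext hC]
  exact (by fun_prop : Continuous fun x : ℝ => Complex.exp (a * x)).mul (continuous_const.add
    (intervalIntegral.continuous_primitive (fun x y => intervalIntegrable_exp_mul hf (-a) x y) 0))

theorem expPot_sub (ha : a.re ≠ 0) (hf : MemLp f 2 volume) (x y : ℝ) :
    expPot a f y - expPot a f x = ∫ t in x..y, (a * expPot a f t + f t) := by
  obtain ⟨C, hC⟩ := exists_expPot_eq ha hf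
  have hi := intervalIntegrable_exp_mul hf (-a)
  have h := integral_add_mul_of_primitive (a := x) (b := y)
    (u := fun x : ℝ => Complex.exp (a * x)) (u' := fun x : ℝ => a * Complex.exp (a * x))
    (v := fun x => C + ∫ ζ in (0 : ℝ)..x, Complex.exp (-a * ζ) * f ζ)
    (v' := fun ζ : ℝ => Complex.exp (-a * ζ) * f ζ)
    ((by fun_prop : Continuous fun x : ℝ => a * Complex.exp (a * x)).intervalIntegrable _ _)
    (hi x y)
    (fun z _ => (intervalIntegral.integral_eq_sub_of_hasDerivAt
      (fun t _ => hasDerivAt_exp_mul a t)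
      ((by fun_prop : Continuous fun x : ℝ =>
        a * Complex.exp (a * x)).intervalIntegrable _ _)).symm)
    (fun z _ => by
      rw [add_sub_add_left_eq_sub, intervalIntegral.integral_interval_sub_left (hi 0 z) (hi 0 x)])
  rw [hC, hC, h]
  refine intervalIntegral.integral_congr fun t _ => ?_
  have e : Complex.exp (a * t) * Complex.exp (-a * t) = 1 := by rw [← Complex.exp_add]; simp
  simp only [hC]
  linear_combination f t * e

theorem memLp_expPot (ha : a.re ≠ 0) (hf : MemLp f 2 volume) : MemLp (expPot a f) 2 volume := by
  refine memLp_two_of_norm_le_exp_convolution (c := |a.re|) (abs_pos.2 ha) hf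
    (continuous_expPot ha hf).aestronglyMeasurable fun x => ?_
  have hn : ∀ ζ : ℝ, 0 ≤ -(a.re * (x - ζ)) →
      ‖Complex.exp (a * (x - ζ)) * f ζ‖ₑ =
        ENNReal.ofReal (Real.exp (-(|a.re| * |x - ζ|))) * ‖f ζ‖ₑ := fun ζ h => by
    rw [enorm_mul, ← ofReal_norm (Complex.exp _), ← Complex.ofReal_sub,
      norm_exp_mul_ofReal, ← abs_mul, abs_of_nonpos (by linarith), neg_neg]
  rcases lt_or_gt_of_ne ha with h | h
  · rw [expPot_of_neg h]
    refine (enorm_integral_le_lintegral_enorm _).trans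
      (le_trans (le_of_eq ?_) (setLIntegral_le_lintegral (Iic x) _))
    exact setLIntegral_congr_fun measurableSet_Iic fun ζ hζ =>
      hn ζ (by nlinarith [mem_Iic.1 hζ])
  · rw [expPot_of_pos h, enorm_neg]
    refine (enorm_integral_le_lintegral_enorm _).trans
      (le_trans (le_of_eq ?_) (setLIntegral_le_lintegral (Ioi x) _))
    exact setLIntegral_congr_fun measurableSet_Ioi fun ζ hζ =>
      hn ζ (by nlinarith [mem_Ioi.1 hζ])

end expPot

theorem IsOrderedRoots.re_ne_zero {lam : ℂ} {γ : Fin 3 → ℂ} (h : IsOrderedRoots lam γ)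
    (i : Fin 3) : (γ i).re ≠ 0 := by
  fin_cases i
  exacts [h.neg.ne, h.pos1.ne', h.pos2.ne']

/-- The square integrable solution `U` of `lam * U + U' + U''' = f`, with its derivatives. -/
def greenPot (γ : Fin 3 → ℂ) (f : ℝ → ℂ) (i : Fin 4) (x : ℝ) : ℂ :=
  (∑ k, jumpCoeff γ k * γ k ^ (i : ℕ) * expPot (γ k) f x) + if i = 3 then f x else 0

theorem sum_jumpCoeff_pow {γ : Fin 3 → ℂ} (h : rootDelta γ ≠ 0) (i : Fin 3) :
    ∑ k, jumpCoeff γ k * γ k ^ (i : ℕ) = if i = 2 then 1 else 0 := by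
  fin_cases i
  · simpa using sum_jumpCoeff γ
  · simpa [mul_comm] using sum_mul_jumpCoeff γ
  · have := sum_sq_mul_jumpCoeff h
    simp only [← mul_assoc, ← sq] at this
    simpa [mul_comm] using this

theorem isH3_greenPot {lam : ℂ} {γ : Fin 3 → ℂ} (h : IsOrderedRoots lam γ) {f : ℝ → ℂ}
    (hf : MemLp f 2 volume) : IsH3 univ (greenPot γ f) where
  memLp i := by
    rw [Measure.restrict_univ]
    refine (memLp_finsetSum _ fun k _ => (memLp_expPot (h.re_ne_zero k) hf).const_mul _).add ?_
    split_ifs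
    · exact hf
    · exact MemLp.zero'
  primitive i x _ y _ := by
    have hfi : IntervalIntegrable f volume x y :=
      (hf.restrict univ).intervalIntegrable_of_mem (mem_univ x) (mem_univ y)
    have hc : ∀ k, IntervalIntegrable (fun t => γ k * expPot (γ k) f t + f t) volume x y :=
      fun k => ((continuous_const.mul
        (continuous_expPot (h.re_ne_zero k) hf)).intervalIntegrable _ _).add hfi
    have hi : i.castSucc ≠ 3 := by fin_cases i <;> decide
    simp only [greenPot, if_neg hi, add_zero, ← Finset.sum_sub_distrib, ← mul_sub,
      expPot_sub (h.re_ne_zero _) hf]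
    simp only [← intervalIntegral.integral_const_mul]
    rw [← intervalIntegral.integral_finsetSum fun k _ => (hc k).const_mul _]
    refine intervalIntegral.integral_congr fun t _ => ?_
    simp only [mul_add, Finset.sum_add_distrib, ← Finset.sum_mul, Fin.val_castSucc,
      sum_jumpCoeff_pow h.delta_ne_zero]
    congr 1
    · exact Finset.sum_congr rfl fun k _ => by rw [Fin.val_succ, pow_succ]; ring
    · fin_cases i <;> simp

theorem greenPot_ode {lam : ℂ} {γ : Fin 3 → ℂ} (h : IsOrderedRoots lam γ) (f : ℝ → ℂ) (x : ℝ) :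
    greenPot γ f 3 x + greenPot γ f 1 x = f x - lam * greenPot γ f 0 x := by
  have e : ∑ k, jumpCoeff γ k * γ k ^ 3 * expPot (γ k) f x
      + ∑ k, jumpCoeff γ k * γ k ^ 1 * expPot (γ k) f x
      + lam * ∑ k, jumpCoeff γ k * γ k ^ 0 * expPot (γ k) f x = 0 := by
    rw [Finset.mul_sum, ← Finset.sum_add_distrib, ← Finset.sum_add_distrib]
    refine Finset.sum_eq_zero fun k _ => ?_
    rw [h.cube k]; ring
  simp only [greenPot]
  simp only [Fin.isValue, Fin.val_zero, Fin.val_one, if_true, show ((3 : Fin 4) : ℕ) = 3 from rfl,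
    show (1 : Fin 4) ≠ 3 by decide, show (0 : Fin 4) ≠ 3 by decide, if_false]
  linear_combination e

/-- The part of the Green's functions which depends on `x - ζ`. -/
def jumpKernel (γ : Fin 3 → ℂ) (x ζ : ℝ) : ℂ :=
  if ζ ≤ x then jumpCoeff γ 0 * Complex.exp (γ 0 * (x - ζ))
  else -(jumpCoeff γ 1 * Complex.exp (γ 1 * (x - ζ)) + jumpCoeff γ 2 * Complex.exp (γ 2 * (x - ζ)))

theorem integral_jumpKernel {lam : ℂ} {γ : Fin 3 → ℂ} (h : IsOrderedRoots lam γ) {f : ℝ → ℂ}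
    (hf : MemLp f 2 volume) (x : ℝ) :
    Integrable (fun ζ => jumpKernel γ x ζ * f ζ) volume ∧
      ∫ ζ, jumpKernel γ x ζ * f ζ = greenPot γ f 0 x := by
  have i0 := (integrableOn_expPot_Iic h.neg hf x).const_mul (jumpCoeff γ 0)
  have i1 := (integrableOn_expPot_Ioi h.pos1 hf x).const_mul (jumpCoeff γ 1)
  have i2 := (integrableOn_expPot_Ioi h.pos2 hf x).const_mul (jumpCoeff γ 2)
  have e1 : EqOn (fun ζ : ℝ => jumpCoeff γ 0 * (Complex.exp (γ 0 * (x - ζ)) * f ζ))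
      (fun ζ => jumpKernel γ x ζ * f ζ) (Iic x) := fun ζ hζ => by
    simp only [jumpKernel, if_pos (mem_Iic.1 hζ)]; ring
  have e2 : EqOn (fun ζ : ℝ => -(jumpCoeff γ 1 * (Complex.exp (γ 1 * (x - ζ)) * f ζ) +
      jumpCoeff γ 2 * (Complex.exp (γ 2 * (x - ζ)) * f ζ)))
      (fun ζ => jumpKernel γ x ζ * f ζ) (Ioi x) := fun ζ hζ => by
    simp only [jumpKernel, if_neg (not_le.2 (mem_Ioi.1 hζ))]; ring
  have j1 : IntegrableOn (fun ζ => jumpKernel γ x ζ * f ζ) (Iic x) :=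
    IntegrableOn.congr_fun i0 e1 measurableSet_Iic
  have j2 : IntegrableOn (fun ζ => jumpKernel γ x ζ * f ζ) (Ioi x) :=
    IntegrableOn.congr_fun (i1.add i2).neg e2 measurableSet_Ioi
  have j : Integrable (fun ζ => jumpKernel γ x ζ * f ζ) volume := by
    rw [← integrableOn_univ, ← Iic_union_Ioi (a := x)]
    exact j1.union j2
  refine ⟨j, ?_⟩
  rw [← intervalIntegral.integral_Iic_add_Ioi j1 j2,
    ← setIntegral_congr_fun measurableSet_Iic e1, ← setIntegral_congr_fun measurableSet_Ioi e2,
    integral_neg, integral_add i1 i2, integral_const_mul, integral_const_mul, integral_const_mul]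
  simp [greenPot, Fin.sum_univ_three, expPot_of_neg h.neg, expPot_of_pos h.pos1,
    expPot_of_pos h.pos2]
  ring

theorem memLp_indicator_restrict {S : Set ℝ} (hS : MeasurableSet S) {q : ℝ → ℂ}
    (hq : MemLp q 2 (volume.restrict S)) : MemLp (S.indicator q) 2 volume :=
  (memLp_indicator_iff_restrict hS).2 hq

theorem integral_jumpKernel_indicator {lam : ℂ} {γ : Fin 3 → ℂ} (h : IsOrderedRoots lam γ)
    {S : Set ℝ} (hS : MeasurableSet S) {q : ℝ → ℂ} (hq : MemLp q 2 (volume.restrict S)) (x : ℝ) :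
    IntegrableOn (fun ζ => jumpKernel γ x ζ * q ζ) S ∧
      ∫ ζ in S, jumpKernel γ x ζ * q ζ = greenPot γ (S.indicator q) 0 x := by
  obtain ⟨h1, h2⟩ := integral_jumpKernel h (memLp_indicator_restrict hS hq) x
  have e : (fun ζ => jumpKernel γ x ζ * S.indicator q ζ) =
      S.indicator fun ζ => jumpKernel γ x ζ * q ζ := by
    funext ζ
    by_cases hζ : ζ ∈ S <;> simp [hζ]
  rw [e] at h1 h2
  exact ⟨(integrable_indicator_iff hS).1 h1, by rw [← h2, integral_indicator hS]⟩

/-- The function `c * exp (a * x)` with its derivatives. -/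
def expFam (a : ℂ) (i : Fin 4) (x : ℝ) : ℂ := a ^ (i : ℕ) * Complex.exp (a * x)

theorem expFam_sub (a : ℂ) (i : Fin 3) (x y : ℝ) :
    expFam a i.castSucc y - expFam a i.castSucc x = ∫ t in x..y, expFam a i.succ t := by
  rw [← intervalIntegral.integral_eq_sub_of_hasDerivAt (f := expFam a i.castSucc)
    (f' := expFam a i.succ) (fun t _ => ?_)
    ((by unfold expFam; fun_prop : Continuous (expFam a i.succ)).intervalIntegrable _ _)]
  convert! (hasDerivAt_exp_mul a t).const_mul (a ^ (i : ℕ)) using 1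
  rw [expFam, Fin.val_succ, pow_succ]; ring

theorem isH3_expFam_Ici {a : ℂ} (ha : a.re < 0) : IsH3 (Ici 0) (expFam a) where
  memLp i := by
    rw [← restrict_Ioi_eq_restrict_Ici]
    exact (memLp_exp_Ioi ha 0).const_mul _
  primitive _ x _ y _ := expFam_sub a _ x y

theorem isH3_expFam_Iic {a : ℂ} (ha : 0 < a.re) : IsH3 (Iic 0) (expFam a) where
  memLp _ := (memLp_exp_Iic ha 0).const_mul _
  primitive _ x _ y _ := expFam_sub a _ x y

theorem expFam_ode {lam : ℂ} {γ : Fin 3 → ℂ} (h : IsOrderedRoots lam γ) (k : Fin 3) (x : ℝ) :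
    expFam (γ k) 3 x + expFam (γ k) 1 x = -(lam * expFam (γ k) 0 x) := by
  simp only [expFam, show ((3 : Fin 4) : ℕ) = 3 from rfl, show ((1 : Fin 4) : ℕ) = 1 from rfl,
    show ((0 : Fin 4) : ℕ) = 0 from rfl]
  linear_combination Complex.exp (γ k * x) * h.cube k


/-- The candidate for the resolvent on `[0, ∞)`, with its derivatives. -/
def plusFam (γ c : Fin 3 → ℂ) (q : ℝ → ℂ) (i : Fin 4) (x : ℝ) : ℂ :=
  c 2 * expFam (γ 0) i x + greenPot γ ((Ioi 0).indicator q) i x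

/-- The candidate for the resolvent on `(-∞, 0]`, with its derivatives. -/
def minusFam (γ c : Fin 3 → ℂ) (p : ℝ → ℂ) (i : Fin 4) (x : ℝ) : ℂ :=
  c 0 * expFam (γ 1) i x + c 1 * expFam (γ 2) i x + greenPot γ ((Iio 0).indicator p) i x

section

variable {lam : ℂ} {γ : Fin 3 → ℂ} {p q : ℝ → ℂ}

theorem isH3_plusFam (h : IsOrderedRoots lam γ) (hq : MemLp q 2 (volume.restrict (Ioi 0)))
    (c : Fin 3 → ℂ) : IsH3 (Ici 0) (plusFam γ c q) :=
  ((isH3_expFam_Ici h.neg).const_mul (c 2)).add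
    ((isH3_greenPot h (memLp_indicator_restrict measurableSet_Ioi hq)).mono (subset_univ _))

theorem isH3_minusFam (h : IsOrderedRoots lam γ) (hp : MemLp p 2 (volume.restrict (Iio 0)))
    (c : Fin 3 → ℂ) : IsH3 (Iic 0) (minusFam γ c p) :=
  (((isH3_expFam_Iic h.pos1).const_mul (c 0)).add ((isH3_expFam_Iic h.pos2).const_mul (c 1))).add
    ((isH3_greenPot h (memLp_indicator_restrict measurableSet_Iio hp)).mono (subset_univ _))

theorem plusFam_ode (h : IsOrderedRoots lam γ) (c : Fin 3 → ℂ) {x : ℝ} (hx : 0 < x) :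
    plusFam γ c q 3 x + plusFam γ c q 1 x = q x - lam * plusFam γ c q 0 x := by
  have h1 := greenPot_ode h ((Ioi 0).indicator q) x
  rw [indicator_of_mem (mem_Ioi.2 hx)] at h1
  simp only [plusFam]
  linear_combination h1 + c 2 * expFam_ode h 0 x

theorem minusFam_ode (h : IsOrderedRoots lam γ) (c : Fin 3 → ℂ) {x : ℝ} (hx : x < 0) :
    minusFam γ c p 3 x + minusFam γ c p 1 x = p x - lam * minusFam γ c p 0 x := by
  have h1 := greenPot_ode h ((Iio 0).indicator p) x
  rw [indicator_of_mem (mem_Iio.2 hx)] at h1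
  simp only [minusFam]
  linear_combination h1 + c 0 * expFam_ode h 1 x + c 1 * expFam_ode h 2 x

theorem exists_resPlus_eq (h : IsOrderedRoots lam γ) (hq : MemLp q 2 (volume.restrict (Ioi 0))) :
    ∃ κ : ℂ, ∀ (a b : Fin 3 → ℂ), b 2 = a 2 + κ → ∀ x, resPlus γ a q x = plusFam γ b q 0 x := by
  have i1 := integrableOn_exp_mul_Ioi_of_memLp (a := -γ 1) (by simpa using h.pos1) hq
  have i2 := integrableOn_exp_mul_Ioi_of_memLp (a := -γ 2) (by simpa using h.pos2) hq
  refine ⟨(rootDelta γ)⁻¹ * ((γ 2 - γ 0) * ∫ ζ in Ioi (0 : ℝ), Complex.exp (-γ 1 * ζ) * q ζ)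
    + (rootDelta γ)⁻¹ * ((γ 0 - γ 1) * ∫ ζ in Ioi (0 : ℝ), Complex.exp (-γ 2 * ζ) * q ζ),
    fun a b hb x => ?_⟩
  obtain ⟨j1, j2⟩ := integral_jumpKernel_indicator h measurableSet_Ioi hq x
  have e : ∀ ζ : ℝ, greenPlus γ x ζ * q ζ =
      Complex.exp (γ 0 * x) * (rootDelta γ)⁻¹ * (γ 2 - γ 0) * (Complex.exp (-γ 1 * ζ) * q ζ)
      + Complex.exp (γ 0 * x) * (rootDelta γ)⁻¹ * (γ 0 - γ 1) * (Complex.exp (-γ 2 * ζ) * q ζ)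
      + jumpKernel γ x ζ * q ζ := fun ζ => by
    have e1 : ∀ i j, Complex.exp (γ i * x - γ j * ζ) =
        Complex.exp (γ i * x) * Complex.exp (-γ j * ζ) := fun i j => by
      rw [← Complex.exp_add]; congr 1; ring
    simp only [greenPlus, jumpKernel, e1, jumpCoeff, Matrix.cons_val_zero, Matrix.cons_val_one,
      Matrix.cons_val]
    split_ifs <;> ring
  have k : IntegrableOn (fun ζ : ℝ =>
      Complex.exp (γ 0 * x) * (rootDelta γ)⁻¹ * (γ 2 - γ 0) * (Complex.exp (-γ 1 * ζ) * q ζ)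
      + Complex.exp (γ 0 * x) * (rootDelta γ)⁻¹ * (γ 0 - γ 1) * (Complex.exp (-γ 2 * ζ) * q ζ))
      (Ioi 0) := (i1.const_mul _).add (i2.const_mul _)
  rw [resPlus, integral_congr_ae (.of_forall e),
    integral_add k j1,
    integral_add (i1.const_mul _) (i2.const_mul _), integral_const_mul, integral_const_mul, j2,
    plusFam, hb, expFam, Fin.val_zero, pow_zero]
  ring

theorem exists_resMinus_eq (h : IsOrderedRoots lam γ) (hp : MemLp p 2 (volume.restrict (Iio 0))) :
    ∃ κ₀ κ₁ : ℂ, ∀ (a b : Fin 3 → ℂ), b 0 = a 0 + κ₀ → b 1 = a 1 + κ₁ →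
      ∀ x, resMinus γ a p x = minusFam γ b p 0 x := by
  have i0 : IntegrableOn (fun ζ : ℝ => Complex.exp (-γ 0 * ζ) * p ζ) (Iio 0) := by
    rw [← integrableOn_Iic_iff_integrableOn_Iio]
    exact integrableOn_exp_mul_Iic_of_memLp (a := -γ 0) (by simpa using h.neg)
      (by rwa [← restrict_Iio_eq_restrict_Iic])
  refine ⟨(rootDelta γ)⁻¹ * ((γ 2 - γ 0) * ∫ ζ in Iio (0 : ℝ), Complex.exp (-γ 0 * ζ) * p ζ),
    (rootDelta γ)⁻¹ * ((γ 0 - γ 1) * ∫ ζ in Iio (0 : ℝ), Complex.exp (-γ 0 * ζ) * p ζ),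
    fun a b hb0 hb1 x => ?_⟩
  obtain ⟨j1, j2⟩ := integral_jumpKernel_indicator h measurableSet_Iio hp x
  have e : ∀ ζ : ℝ, greenMinus γ x ζ * p ζ =
      (rootDelta γ)⁻¹ * ((γ 2 - γ 0) * Complex.exp (γ 1 * x) + (γ 0 - γ 1) * Complex.exp (γ 2 * x))
        * (Complex.exp (-γ 0 * ζ) * p ζ)
      + jumpKernel γ x ζ * p ζ := fun ζ => by
    have e1 : ∀ i j, Complex.exp (γ i * x - γ j * ζ) =
        Complex.exp (γ i * x) * Complex.exp (-γ j * ζ) := fun i j => by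
      rw [← Complex.exp_add]; congr 1; ring
    simp only [greenMinus, jumpKernel, e1, jumpCoeff, Matrix.cons_val_zero, Matrix.cons_val_one,
      Matrix.cons_val]
    split_ifs <;> ring
  rw [resMinus, integral_congr_ae (.of_forall e), integral_add (i0.const_mul _) j1,
    integral_const_mul, j2, minusFam, hb0, hb1, expFam, expFam, Fin.val_zero, pow_zero]
  ring

end

theorem exists_isRepresentedBy {vm vp : ℝ → ℂ} (hm : MemLp vm 2 (volume.restrict (Iio 0)))
    (hp : MemLp vp 2 (volume.restrict (Ioi 0))) : ∃ v : L2G, IsRepresentedBy v vm vp :=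
  ⟨WithLp.toLp 2 (hm.toLp vm, hp.toLp vp), hm.coeFn_toLp, hp.coeFn_toLp⟩

theorem IsRepresentedBy.eq {v w : L2G} {vm vp : ℝ → ℂ} (hv : IsRepresentedBy v vm vp)
    (hw : IsRepresentedBy w vm vp) : v = w := by
  have h1 : v.fst = w.fst := Lp.ext (hv.1.trans hw.1.symm)
  have h2 : v.snd = w.snd := Lp.ext (hv.2.trans hw.2.symm)
  rw [WithLp.ext_iff]
  exact Prod.ext h1 h2

theorem eqOn_Iic_of_ae_eq {f g : ℝ → ℂ} (hf : ContinuousOn f (Iic 0)) (hg : ContinuousOn g (Iic 0))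
    (h : f =ᵐ[volume.restrict (Iio 0)] g) : EqOn f g (Iic 0) := by
  rw [restrict_Iio_eq_restrict_Iic] at h
  exact Measure.eqOn_of_ae_eq h hf hg (by simp)

theorem eqOn_Ici_of_ae_eq {f g : ℝ → ℂ} (hf : ContinuousOn f (Ici 0)) (hg : ContinuousOn g (Ici 0))
    (h : f =ᵐ[volume.restrict (Ioi 0)] g) : EqOn f g (Ici 0) := by
  rw [restrict_Ioi_eq_restrict_Ici] at h
  exact Measure.eqOn_of_ae_eq h hf hg (by simp)

/-- `lam + A_Z` is injective. -/
theorem eq_of_mem_airyGraph {Z : ℝ} {lam : ℂ} (hlam : 0 < lam.re) {ω v w : L2G}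
    (hv : (v, ω - lam • v) ∈ airyGraph Z) (hw : (w, ω - lam • w) ∈ airyGraph Z) : v = w := by
  have h := airyGraph_add hv (airyGraph_smul hw (-1))
  have e : ω - lam • v + (-1 : ℂ) • (ω - lam • w) = -(lam • (v + (-1 : ℂ) • w)) := by module
  rw [e] at h
  set d := v + (-1 : ℂ) • w with hd
  have hs := airyGraph_skew h h
  rw [inner_neg_left, inner_neg_right, inner_smul_left, inner_smul_right, ← neg_add, neg_eq_zero,
    ← add_mul, add_comm, Complex.add_conj, mul_eq_zero] at hs
  have hd0 : d = 0 := by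
    rcases hs with hs | hs
    · norm_cast at hs; linarith
    · exact inner_self_eq_zero.1 hs
  rw [hd, neg_one_smul, ← sub_eq_add_neg] at hd0
  exact sub_eq_zero.1 hd0

theorem isResolventAdd_of_mem_airyGraph {Z : ℝ} {lam : ℂ} (hlam : 0 < lam.re) {ω v : L2G}
    (hv : (v, ω - lam • v) ∈ airyGraph Z) : IsResolventAdd Z lam ω v := fun _ =>
  ⟨fun hw => eq_of_mem_airyGraph hlam hw hv, fun h => h ▸ hv⟩

section

variable {Z : ℝ} {lam : ℂ} {γ : Fin 3 → ℂ} {p q : ℝ → ℂ} {ω : L2G}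

theorem exists_mem_airyGraph (h : IsOrderedRoots lam γ) (hω : IsRepresentedBy ω p q)
    {c : Fin 3 → ℂ} (hA : IsAiryPair Z (minusFam γ c p) (plusFam γ c q)) :
    ∃ v, IsRepresentedBy v (minusFam γ c p 0) (plusFam γ c q 0) ∧
      (v, ω - lam • v) ∈ airyGraph Z := by
  obtain ⟨v, hv⟩ := exists_isRepresentedBy
    ((hA.left.memLp 0).mono_measure (Measure.restrict_mono Iio_subset_Iic_self le_rfl))
    ((hA.right.memLp 0).mono_measure (Measure.restrict_mono Ioi_subset_Ici_self le_rfl))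
  refine ⟨v, hv, _, _, hA, hv.1, hv.2, ?_, ?_⟩
  · filter_upwards [Lp.coeFn_sub ω.fst (lam • v.fst), Lp.coeFn_smul lam v.fst, hω.1, hv.1,
      ae_restrict_mem measurableSet_Iio] with x e1 e2 e3 e4 hx
    refine e1.trans ?_
    rw [Pi.sub_apply, e2, Pi.smul_apply, e3, e4, minusFam_ode h c hx, smul_eq_mul]
  · filter_upwards [Lp.coeFn_sub ω.snd (lam • v.snd), Lp.coeFn_smul lam v.snd, hω.2, hv.2,
      ae_restrict_mem measurableSet_Ioi] with x e1 e2 e3 e4 hx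
    refine e1.trans ?_
    rw [Pi.sub_apply, e2, Pi.smul_apply, e3, e4, plusFam_ode h c hx, smul_eq_mul]

theorem coeff_eq_of_isAiryPair (hlam : 0 < lam.re) (h : IsOrderedRoots lam γ)
    (hω : IsRepresentedBy ω p q) {c d : Fin 3 → ℂ}
    (hc : IsAiryPair Z (minusFam γ c p) (plusFam γ c q))
    (hd : IsAiryPair Z (minusFam γ d p) (plusFam γ d q)) : c = d := by
  obtain ⟨v, hv, hvg⟩ := exists_mem_airyGraph h hω hc
  obtain ⟨w, hw, hwg⟩ := exists_mem_airyGraph h hω hd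
  obtain rfl := eq_of_mem_airyGraph hlam hvg hwg
  have em := eqOn_Iic_of_ae_eq (hc.left.continuousOn 0) (hd.left.continuousOn 0)
    (hv.1.symm.trans hw.1)
  have ep := eqOn_Ici_of_ae_eq (hc.right.continuousOn 0) (hd.right.continuousOn 0)
    (hv.2.symm.trans hw.2)
  have e0 := em (mem_Iic.2 (le_refl (0 : ℝ)))
  have e1 := (hc.left.eqOn_of_eqOn hd.left (by simp) em).1 0 (mem_Iic.2 le_rfl)
  have e2 := ep (mem_Ici.2 (le_refl (0 : ℝ)))
  simp [minusFam, expFam] at e0 e1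
  simp [plusFam, expFam] at e2
  have hne := sub_ne_zero.2 h.ne12
  have h0 : c 0 = d 0 := by
    have : (γ 1 - γ 2) * (c 0 - d 0) = 0 := by linear_combination e1 - γ 2 * e0
    exact sub_eq_zero.1 ((mul_eq_zero.1 this).resolve_left hne)
  have h1 : c 1 = d 1 := by rw [h0] at e0; exact add_left_cancel e0
  funext i
  fin_cases i
  exacts [h0, h1, e2]

/-- The defect in the vertex conditions. -/
def vertexDefect (Z : ℝ) (um up : Fin 4 → ℝ → ℂ) : Fin 3 → ℂ :=
  ![um 0 0 - up 0 0, up 1 0 - um 1 0 - Z * um 0 0,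
    (Z : ℂ) ^ 2 / 2 * um 0 0 + Z * um 1 0 - (up 2 0 - um 2 0)]

theorem isAiryPair_of_vertexDefect_eq_zero {um up : Fin 4 → ℝ → ℂ} (hm : IsH3 (Iic 0) um)
    (hp : IsH3 (Ici 0) up) (h : vertexDefect Z um up = 0) : IsAiryPair Z um up :=
  ⟨hm, hp, sub_eq_zero.1 (congrFun h 0), sub_eq_zero.1 (congrFun h 1),
    sub_eq_zero.1 (congrFun h 2)⟩

/-- The defect in the vertex conditions of a combination of exponentials. -/
def expDefect (Z : ℝ) (γ : Fin 3 → ℂ) : (Fin 3 → ℂ) →ₗ[ℂ] (Fin 3 → ℂ) where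
  toFun c := vertexDefect Z (fun i x => c 0 * expFam (γ 1) i x + c 1 * expFam (γ 2) i x)
    (fun i x => c 2 * expFam (γ 0) i x)
  map_add' c d := by
    funext i
    fin_cases i <;> simp [vertexDefect] <;> ring
  map_smul' c d := by
    funext i
    fin_cases i <;> simp [vertexDefect] <;> ring

theorem vertexDefect_fam (c : Fin 3 → ℂ) : vertexDefect Z (minusFam γ c p) (plusFam γ c q) =
    expDefect Z γ c + vertexDefect Z (greenPot γ ((Iio 0).indicator p))
      (greenPot γ ((Ioi 0).indicator q)) := by
  funext i
  fin_cases i <;> simp [vertexDefect, expDefect, minusFam, plusFam] <;> ring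

theorem expDefect_surjective (hlam : 0 < lam.re) (h : IsOrderedRoots lam γ) :
    Function.Surjective (expDefect Z γ) := by
  rw [← LinearMap.injective_iff_surjective, ← LinearMap.ker_eq_bot, LinearMap.ker_eq_bot']
  intro c hc
  have h0 : MemLp (fun _ : ℝ => (0 : ℂ)) 2 volume := MemLp.zero'
  have hr : IsRepresentedBy (0 : L2G) (fun _ => 0) (fun _ => 0) :=
    ⟨Lp.coeFn_zero _ _ _, Lp.coeFn_zero _ _ _⟩
  have hg : greenPot γ (fun _ => 0) = 0 := by
    funext i x
    simp [greenPot, expPot]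
  have hd : ∀ c, expDefect Z γ c = 0 →
      IsAiryPair Z (minusFam γ c fun _ => 0) (plusFam γ c fun _ => 0) := fun c hc => by
    refine isAiryPair_of_vertexDefect_eq_zero (isH3_minusFam h (h0.restrict _) c)
      (isH3_plusFam h (h0.restrict _) c) ?_
    rw [vertexDefect_fam, hc, indicator_zero, indicator_zero, hg]
    funext i
    fin_cases i <;> simp [vertexDefect]
  exact coeff_eq_of_isAiryPair hlam h hr (hd c hc) (hd 0 (map_zero _))

theorem exists_isAiryPair (hlam : 0 < lam.re) (h : IsOrderedRoots lam γ)
    (hp : MemLp p 2 (volume.restrict (Iio 0))) (hq : MemLp q 2 (volume.restrict (Ioi 0))) :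
    ∃ c, IsAiryPair Z (minusFam γ c p) (plusFam γ c q) := by
  obtain ⟨c, hc⟩ := expDefect_surjective (Z := Z) hlam h
    (-vertexDefect Z (greenPot γ ((Iio 0).indicator p)) (greenPot γ ((Ioi 0).indicator q)))
  exact ⟨c, isAiryPair_of_vertexDefect_eq_zero (isH3_minusFam h hp c) (isH3_plusFam h hq c)
    (by rw [vertexDefect_fam, hc, neg_add_cancel])⟩

theorem exists_shift (h : IsOrderedRoots lam γ) (ω : L2G) :
    ∃ κ : Fin 3 → ℂ, ∀ a x, resMinus γ a ω.fst x = minusFam γ (a + κ) ω.fst 0 x ∧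
      resPlus γ a ω.snd x = plusFam γ (a + κ) ω.snd 0 x := by
  obtain ⟨κ₂, h2⟩ := exists_resPlus_eq h (Lp.memLp ω.snd)
  obtain ⟨κ₀, κ₁, h1⟩ := exists_resMinus_eq h (Lp.memLp ω.fst)
  exact ⟨![κ₀, κ₁, κ₂], fun a x => ⟨h1 _ _ rfl rfl x, h2 _ _ rfl x⟩⟩

theorem inAiryDomain_iff_isAiryPair (h : IsOrderedRoots lam γ) {κ : Fin 3 → ℂ}
    (hκ : ∀ a x, resMinus γ a ω.fst x = minusFam γ (a + κ) ω.fst 0 x ∧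
      resPlus γ a ω.snd x = plusFam γ (a + κ) ω.snd 0 x) (a : Fin 3 → ℂ) :
    InAiryDomain Z (resMinus γ a ω.fst) (resPlus γ a ω.snd) ↔
      IsAiryPair Z (minusFam γ (a + κ) ω.fst) (plusFam γ (a + κ) ω.snd) := by
  refine ⟨fun ⟨um, up, hu, hm, hp⟩ => ?_, fun hA =>
    ⟨_, _, hA, fun x _ => (hκ a x).1, fun x _ => (hκ a x).2⟩⟩
  have m0 : ∀ x ∈ Iic 0, um 0 x = minusFam γ (a + κ) ω.fst 0 x := fun x hx =>
    (hm x hx).symm.trans (hκ a x).1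
  have p0 : ∀ x ∈ Ici 0, up 0 x = plusFam γ (a + κ) ω.snd 0 x := fun x hx =>
    (hp x hx).symm.trans (hκ a x).2
  have hM := isH3_minusFam h (Lp.memLp ω.fst) (a + κ)
  have hP := isH3_plusFam h (Lp.memLp ω.snd) (a + κ)
  obtain ⟨m1, m2⟩ := hu.left.eqOn_of_eqOn hM (by simp) m0
  obtain ⟨p1, p2⟩ := hu.right.eqOn_of_eqOn hP (by simp) p0
  have z1 := mem_Iic.2 (le_refl (0 : ℝ))
  have z2 := mem_Ici.2 (le_refl (0 : ℝ))
  refine ⟨hM, hP, ?_, ?_, ?_⟩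
  · rw [← m0 0 z1, ← p0 0 z2, hu.bc0]
  · rw [← m0 0 z1, ← p1 0 z2, ← m1 0 z1, hu.bc1]
  · rw [← m0 0 z1, ← p2 0 z2, ← m1 0 z1, ← m2 0 z1, hu.bc2]

theorem existsUnique_inAiryDomain (Z : ℝ) (hlam : 0 < lam.re) (h : IsOrderedRoots lam γ)
    (ω : L2G) : ∃! a : Fin 3 → ℂ, InAiryDomain Z (resMinus γ a ω.fst) (resPlus γ a ω.snd) := by
  obtain ⟨κ, hκ⟩ := exists_shift h ω
  obtain ⟨c, hc⟩ := exists_isAiryPair (Z := Z) hlam h (Lp.memLp ω.fst) (Lp.memLp ω.snd)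
  refine ⟨c - κ, (inAiryDomain_iff_isAiryPair h hκ _).2 (by rwa [sub_add_cancel]), fun a ha => ?_⟩
  rw [eq_sub_iff_add_eq]
  exact coeff_eq_of_isAiryPair hlam h ⟨.rfl, .rfl⟩ ((inAiryDomain_iff_isAiryPair h hκ a).1 ha) hc

theorem exists_isRepresentedBy_mem_airyGraph (h : IsOrderedRoots lam γ) {a : Fin 3 → ℂ}
    (ha : InAiryDomain Z (resMinus γ a ω.fst) (resPlus γ a ω.snd)) :
    ∃ v, IsRepresentedBy v (resMinus γ a ω.fst) (resPlus γ a ω.snd) ∧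
      (v, ω - lam • v) ∈ airyGraph Z := by
  obtain ⟨κ, hκ⟩ := exists_shift h ω
  rw [funext fun x => (hκ a x).1, funext fun x => (hκ a x).2]
  exact exists_mem_airyGraph h ⟨.rfl, .rfl⟩ ((inAiryDomain_iff_isAiryPair h hκ a).1 ha)

/-- `lam + A_Z` is surjective. -/
theorem exists_add_airy (Z : ℝ) (hlam : 0 < lam.re) (ω : L2G) :
    ∃ v, (v, ω - lam • v) ∈ airyGraph Z := by
  obtain ⟨γ, h⟩ := exists_isOrderedRoots hlam
  obtain ⟨c, hc⟩ := exists_isAiryPair (Z := Z) hlam h (Lp.memLp ω.fst) (Lp.memLp ω.snd)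
  obtain ⟨v, -, hv⟩ := exists_mem_airyGraph h (ω := ω) ⟨.rfl, .rfl⟩ hc
  exact ⟨v, hv⟩

end


theorem measurePreserving_neg_Iio :
    MeasurePreserving (fun x : ℝ => -x) (volume.restrict (Iio 0)) (volume.restrict (Ioi 0)) := by
  have h := (Measure.measurePreserving_neg (volume : Measure ℝ)).restrict_preimage
    (measurableSet_Ioi (a := (0 : ℝ)))
  simpa using h

theorem measurePreserving_neg_Ioi :
    MeasurePreserving (fun x : ℝ => -x) (volume.restrict (Ioi 0)) (volume.restrict (Iio 0)) := by
  have h := (Measure.measurePreserving_neg (volume : Measure ℝ)).restrict_preimage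
    (measurableSet_Iio (a := (0 : ℝ)))
  simpa using h

/-- The reflection `x ↦ -x` of the star graph, as a linear map on `L²`. -/
def reflectₗ : L2G →ₗ[ℂ] L2G where
  toFun v := WithLp.toLp 2
    (Lp.compMeasurePreservingₗᵢ ℂ (fun x : ℝ => -x) measurePreserving_neg_Iio v.snd,
      Lp.compMeasurePreservingₗᵢ ℂ (fun x : ℝ => -x) measurePreserving_neg_Ioi v.fst)
  map_add' v w := by
    rw [WithLp.ext_iff]
    exact Prod.ext (map_add _ v.snd w.snd) (map_add _ v.fst w.fst)
  map_smul' c v := by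
    rw [WithLp.ext_iff]
    exact Prod.ext (map_smul _ c v.snd) (map_smul _ c v.fst)

theorem IsRepresentedBy.reflectₗ {v : L2G} {vm vp : ℝ → ℂ} (h : IsRepresentedBy v vm vp) :
    IsRepresentedBy (reflectₗ v) (fun x => vp (-x)) (fun x => vm (-x)) :=
  ⟨(Lp.coeFn_compMeasurePreserving v.snd measurePreserving_neg_Iio).trans
      (measurePreserving_neg_Iio.quasiMeasurePreserving.ae_eq_comp h.2),
    (Lp.coeFn_compMeasurePreserving v.fst measurePreserving_neg_Ioi).trans
      (measurePreserving_neg_Ioi.quasiMeasurePreserving.ae_eq_comp h.1)⟩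

theorem isRepresentedBy_self (v : L2G) : IsRepresentedBy v v.fst v.snd := ⟨.rfl, .rfl⟩

theorem reflectₗ_involutive : Function.Involutive reflectₗ := fun v => by
  have h := (isRepresentedBy_self v).reflectₗ.reflectₗ
  simp only [neg_neg] at h
  exact h.eq (isRepresentedBy_self v)

/-- The reflection `x ↦ -x` of the star graph, as a unitary operator. -/
def reflect : L2G ≃ₗᵢ[ℂ] L2G where
  toLinearEquiv := LinearEquiv.ofInvolutive reflectₗ reflectₗ_involutive
  norm_map' v := by
    change ‖WithLp.toLp 2
      (Lp.compMeasurePreservingₗᵢ ℂ (fun x : ℝ => -x) measurePreserving_neg_Iio v.snd,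
        Lp.compMeasurePreservingₗᵢ ℂ (fun x : ℝ => -x) measurePreserving_neg_Ioi v.fst)‖ = ‖v‖
    rw [WithLp.prod_norm_eq_of_L2, WithLp.prod_norm_eq_of_L2]
    have h1 := (Lp.compMeasurePreservingₗᵢ (E := ℂ) (p := 2) ℂ (fun x : ℝ => -x)
      measurePreserving_neg_Iio).norm_map v.snd
    have h2 := (Lp.compMeasurePreservingₗᵢ (E := ℂ) (p := 2) ℂ (fun x : ℝ => -x)
      measurePreserving_neg_Ioi).norm_map v.fst
    change √(‖Lp.compMeasurePreservingₗᵢ ℂ (fun x : ℝ => -x) measurePreserving_neg_Iio v.snd‖ ^ 2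
      + ‖Lp.compMeasurePreservingₗᵢ ℂ (fun x : ℝ => -x) measurePreserving_neg_Ioi v.fst‖ ^ 2) = _
    rw [h1, h2, add_comm]

theorem reflect_reflect (v : L2G) : reflect (reflect v) = v := reflectₗ_involutive v

theorem IsRepresentedBy.reflect {v : L2G} {vm vp : ℝ → ℂ} (h : IsRepresentedBy v vm vp) :
    IsRepresentedBy (reflect v) (fun x => vp (-x)) (fun x => vm (-x)) := h.reflectₗ

/-- The reflection of a family of successive derivatives. -/
def reflFam (u : Fin 4 → ℝ → ℂ) (i : Fin 4) (x : ℝ) : ℂ := (-1) ^ (i : ℕ) * u i (-x)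

theorem reflFam_zero (u : Fin 4 → ℝ → ℂ) : reflFam u 0 = fun x => u 0 (-x) := by
  funext x
  simp [reflFam]

theorem IsH3.reflFam {S T : Set ℝ} {u : Fin 4 → ℝ → ℂ} (hu : IsH3 S u) (hS : MeasurableSet S)
    (hT : (fun x => -x) ⁻¹' S = T) : IsH3 T (reflFam u) where
  memLp i := by
    have h := (Measure.measurePreserving_neg (volume : Measure ℝ)).restrict_preimage hS
    rw [show Neg.neg ⁻¹' S = T from hT] at h
    exact ((hu.memLp i).comp_measurePreserving h).const_mul _
  primitive i x hx y hy := by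
    subst hT
    have h := hu.primitive i (-y) hy (-x) hx
    simp only [_root_.reflFam]
    rw [intervalIntegral.integral_const_mul, intervalIntegral.integral_comp_neg, ← h, Fin.val_succ,
      pow_succ, Fin.val_castSucc]
    ring

theorem IsAiryPair.reflFam {Z : ℝ} {um up : Fin 4 → ℝ → ℂ} (h : IsAiryPair Z um up) :
    IsAiryPair Z (reflFam up) (reflFam um) where
  left := h.right.reflFam measurableSet_Ici (by ext; simp)
  right := h.left.reflFam measurableSet_Iic (by ext; simp)
  bc0 := by simp [_root_.reflFam, h.bc0]
  bc1 := by
    have h0 := h.bc0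
    have h1 := h.bc1
    simp [_root_.reflFam]
    linear_combination h1 + Z * h0
  bc2 := by
    have h0 := h.bc0
    have h1 := h.bc1
    have h2 := h.bc2
    simp [_root_.reflFam]
    linear_combination -h2 - Z * h1 - (Z : ℂ) ^ 2 / 2 * h0

theorem reflect_mem_airyGraph {Z : ℝ} {u f : L2G} (h : (u, f) ∈ airyGraph Z) :
    (reflect u, -reflect f) ∈ airyGraph Z := by
  obtain ⟨um, up, hA, h1, h2, h3, h4⟩ := h
  have hu := IsRepresentedBy.reflect (v := u) ⟨h1, h2⟩
  have hf := IsRepresentedBy.reflect (v := f) ⟨h3, h4⟩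
  refine ⟨_, _, hA.reflFam, ?_, ?_, ?_, ?_⟩
  · rw [reflFam_zero]; exact hu.1
  · rw [reflFam_zero]; exact hu.2
  · filter_upwards [Lp.coeFn_neg (reflect f).fst, hf.1] with x e1 e2
    refine e1.trans ?_
    rw [Pi.neg_apply, e2]
    simp only [reflFam, show ((3 : Fin 4) : ℕ) = 3 from rfl, show ((1 : Fin 4) : ℕ) = 1 from rfl]
    ring
  · filter_upwards [Lp.coeFn_neg (reflect f).snd, hf.2] with x e1 e2
    refine e1.trans ?_
    rw [Pi.neg_apply, e2]
    simp only [reflFam, show ((3 : Fin 4) : ℕ) = 3 from rfl, show ((1 : Fin 4) : ℕ) = 1 from rfl]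
    ring

theorem reflect_mem_airyDomain {Z : ℝ} {u : L2G} (h : u ∈ airyDomain Z) :
    reflect u ∈ airyDomain Z :=
  h.imp' (fun f => -reflect f) fun _ hf => reflect_mem_airyGraph hf

theorem inAiryDomain_reflect {Z : ℝ} {vm vp : ℝ → ℂ} (h : InAiryDomain Z vm vp) :
    InAiryDomain Z (fun x => vp (-x)) (fun x => vm (-x)) := by
  obtain ⟨um, up, hA, hm, hp⟩ := h
  refine ⟨_, _, hA.reflFam, fun x hx => ?_, fun x hx => ?_⟩
  · rw [reflFam_zero]; exact hp (-x) (by linarith)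
  · rw [reflFam_zero]; exact hm (-x) (by linarith)

theorem resReflMinus_eq (γ a : Fin 3 → ℂ) (ω : L2G) (x : ℝ) :
    resReflMinus γ a ω.fst x = resPlus γ a (reflect ω).snd (-x) := by
  have h : (reflect ω).snd =ᵐ[volume.restrict (Ioi 0)] fun x => ω.fst (-x) :=
    (isRepresentedBy_self ω).reflect.2
  have e : ∫ ζ in Ioi 0, greenPlus γ (-x) ζ * (reflect ω).snd ζ =
      ∫ ζ in Ioi 0, greenPlus γ (-x) ζ * ω.fst (-ζ) :=
    integral_congr_ae (h.mono fun ζ hζ => by simp only [hζ])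
  rw [resReflMinus, resPlus, e, ← measurePreserving_neg_Iio.integral_comp
    (Homeomorph.neg ℝ).measurableEmbedding]
  simp

theorem resReflPlus_eq (γ a : Fin 3 → ℂ) (ω : L2G) (x : ℝ) :
    resReflPlus γ a ω.snd x = resMinus γ a (reflect ω).fst (-x) := by
  have h : (reflect ω).fst =ᵐ[volume.restrict (Iio 0)] fun x => ω.snd (-x) :=
    (isRepresentedBy_self ω).reflect.1
  have e : ∫ ζ in Iio 0, greenMinus γ (-x) ζ * (reflect ω).fst ζ =
      ∫ ζ in Iio 0, greenMinus γ (-x) ζ * ω.snd (-ζ) :=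
    integral_congr_ae (h.mono fun ζ hζ => by simp only [hζ])
  rw [resReflPlus, resMinus, e, ← measurePreserving_neg_Ioi.integral_comp
    (Homeomorph.neg ℝ).measurableEmbedding]
  simp

theorem inAiryDomain_resRefl_iff {Z : ℝ} (γ a : Fin 3 → ℂ) (ω : L2G) :
    InAiryDomain Z (resReflMinus γ a ω.fst) (resReflPlus γ a ω.snd) ↔
      InAiryDomain Z (resMinus γ a (reflect ω).fst) (resPlus γ a (reflect ω).snd) := by
  rw [funext (resReflMinus_eq γ a ω), funext (resReflPlus_eq γ a ω)]
  exact ⟨fun h => by simpa using inAiryDomain_reflect h, fun h => inAiryDomain_reflect h⟩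

theorem IsResolventAdd.reflect {Z : ℝ} {lam : ℂ} {ω v : L2G}
    (h : IsResolventAdd Z lam (reflect ω) (reflect v)) : IsResolventSub Z lam ω v := fun w => by
  rw [← _root_.reflect.injective.eq_iff, ← h]
  refine ⟨fun hw => ?_, fun hw => ?_⟩
  · have := reflect_mem_airyGraph hw
    rwa [map_sub, map_smul, neg_sub] at this
  · have := reflect_mem_airyGraph hw
    rwa [map_sub, map_smul, neg_sub, reflect_reflect, reflect_reflect] at this

theorem airyGraph_sub {Z : ℝ} {u f v g : L2G} (hu : (u, f) ∈ airyGraph Z)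
    (hv : (v, g) ∈ airyGraph Z) : (u - v, f - g) ∈ airyGraph Z := by
  simpa [sub_eq_add_neg] using airyGraph_add hu (airyGraph_smul hv (-1))

theorem IsH3.ae_eq_zero_of_eqOn_zero {S : Set ℝ} [S.OrdConnected] {u : Fin 4 → ℝ → ℂ}
    (hu : IsH3 S u) (h : ∀ x ∈ S, u 2 x = 0) : u 3 =ᵐ[volume.restrict (interior S)] 0 := by
  have hS : MeasurableSet S := OrdConnected.measurableSet ‹_›
  have hL : LocallyIntegrable (S.indicator (u 3)) volume :=
    ((memLp_indicator_iff_restrict hS).2 (hu.memLp 3)).locallyIntegrable (by norm_num)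
  rw [EventuallyEq, ae_restrict_iff' isOpen_interior.measurableSet]
  filter_upwards [LocallyIntegrable.ae_hasDerivAt_integral hL] with x hx hxS
  have hx' := interior_subset hxS
  have h0 : HasDerivAt (fun y => ∫ t in x..y, S.indicator (u 3) t) 0 x := by
    refine (hasDerivAt_const x (0 : ℂ)).congr_of_eventuallyEq ?_
    filter_upwards [mem_interior_iff_mem_nhds.1 hxS] with y hy
    rw [intervalIntegral.integral_congr (g := u 3)
      (fun t ht => indicator_of_mem (Set.OrdConnected.uIcc_subset ‹_› hx' hy ht) _)]
    have := hu.primitive 2 x hx' y hy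
    simp only [Fin.reduceCastSucc, Fin.reduceSucc] at this
    rw [← this, h y hy, h x hx', sub_zero]
  have := (hx x).unique h0
  rwa [indicator_of_mem hx'] at this

/-- The graph of `A_Z` is the graph of a function. -/
theorem airyGraph_zero {Z : ℝ} {f : L2G} (h : ((0 : L2G), f) ∈ airyGraph Z) : f = 0 := by
  obtain ⟨um, up, hA, h1, h2, h3, h4⟩ := h
  have hm : ∀ x ∈ Iic 0, um 0 x = 0 := eqOn_Iic_of_ae_eq (hA.left.continuousOn 0)
    continuousOn_const (h1.symm.trans (Lp.coeFn_zero _ _ _))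
  have hp : ∀ x ∈ Ici 0, up 0 x = 0 := eqOn_Ici_of_ae_eq (hA.right.continuousOn 0)
    continuousOn_const (h2.symm.trans (Lp.coeFn_zero _ _ _))
  have hm1 := hA.left.eqOn_zero_succ (by simp) 0 hm
  have hp1 := hA.right.eqOn_zero_succ (by simp) 0 hp
  have hm3 := hA.left.ae_eq_zero_of_eqOn_zero (hA.left.eqOn_zero_succ (by simp) 1 hm1)
  have hp3 := hA.right.ae_eq_zero_of_eqOn_zero (hA.right.eqOn_zero_succ (by simp) 1 hp1)
  rw [interior_Iic] at hm3
  rw [interior_Ici] at hp3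
  have hf : IsRepresentedBy f (fun _ => 0) (fun _ => 0) := by
    constructor
    · filter_upwards [h3, hm3, ae_restrict_mem measurableSet_Iio] with x e1 e2 hx
      rw [e1, e2, show um 1 x = 0 from hm1 x (mem_Iic.2 (le_of_lt hx))]; simp
    · filter_upwards [h4, hp3, ae_restrict_mem measurableSet_Ioi] with x e1 e2 hx
      rw [e1, e2, show up 1 x = 0 from hp1 x (mem_Ici.2 (le_of_lt hx))]; simp
  exact hf.eq ⟨Lp.coeFn_zero _ _ _, Lp.coeFn_zero _ _ _⟩

theorem exists_one_add_airy (Z : ℝ) (ω : L2G) : ∃ v, (v, ω - v) ∈ airyGraph Z := by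
  simpa using exists_add_airy Z (lam := 1) (by simp) ω

theorem eq_of_one_add_airy {Z : ℝ} {ω v w : L2G} (hv : (v, ω - v) ∈ airyGraph Z)
    (hw : (w, ω - w) ∈ airyGraph Z) : v = w :=
  eq_of_mem_airyGraph (lam := 1) (by simp) (by simpa using hv) (by simpa using hw)

theorem norm_le_of_one_add_airy {Z : ℝ} {ω v : L2G} (hv : (v, ω - v) ∈ airyGraph Z) :
    ‖v‖ ≤ ‖ω‖ := by
  have hs := congrArg Complex.re (airyGraph_skew hv hv)
  rw [← inner_conj_symm v (ω - v), Complex.add_conj, Complex.ofReal_re, Complex.zero_re,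
    inner_sub_left, Complex.sub_re, inner_self_eq_norm_sq_to_K] at hs
  have h1 : ‖v‖ ^ 2 = (inner ℂ ω v).re := by
    have : (((‖v‖ : ℂ)) ^ 2).re = ‖v‖ ^ 2 := by rw [← Complex.ofReal_pow, Complex.ofReal_re]
    simp only [Complex.coe_algebraMap] at hs
    linarith
  have h2 : (inner ℂ ω v).re ≤ ‖ω‖ * ‖v‖ :=
    (Complex.re_le_norm _).trans (norm_inner_le_norm _ _)
  rcases (norm_nonneg v).eq_or_lt with h | h
  · rw [← h]; exact norm_nonneg _
  · nlinarith

/-- The resolvent `(1 + A_Z)⁻¹`. -/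
def airyRes (Z : ℝ) : L2G →L[ℂ] L2G :=
  LinearMap.mkContinuous
    { toFun := fun ω => (exists_one_add_airy Z ω).choose
      map_add' := fun ω η => by
        refine eq_of_one_add_airy (exists_one_add_airy Z (ω + η)).choose_spec ?_
        rw [add_sub_add_comm]
        exact airyGraph_add (exists_one_add_airy Z ω).choose_spec
          (exists_one_add_airy Z η).choose_spec
      map_smul' := fun c ω => by
        refine eq_of_one_add_airy (exists_one_add_airy Z (c • ω)).choose_spec ?_
        rw [RingHom.id_apply, ← smul_sub]
        exact airyGraph_smul (exists_one_add_airy Z ω).choose_spec c } 1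
    fun ω => by
      rw [one_mul]
      exact norm_le_of_one_add_airy (exists_one_add_airy Z ω).choose_spec

theorem airyRes_mem (Z : ℝ) (ω : L2G) : (airyRes Z ω, ω - airyRes Z ω) ∈ airyGraph Z :=
  (exists_one_add_airy Z ω).choose_spec

theorem mem_airyGraph_iff {Z : ℝ} {v f : L2G} : (v, f) ∈ airyGraph Z ↔ v = airyRes Z (v + f) := by
  refine ⟨fun h => eq_of_one_add_airy (ω := v + f) (by rwa [add_sub_cancel_left])
    (airyRes_mem Z _), fun h => ?_⟩
  have := airyRes_mem Z (v + f)
  rwa [← h, add_sub_cancel_left] at this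

theorem mem_airyDomain_iff {Z : ℝ} {v : L2G} : v ∈ airyDomain Z ↔ ∃ ψ, v = airyRes Z ψ := by
  refine ⟨fun ⟨f, hf⟩ => ⟨v + f, mem_airyGraph_iff.1 hf⟩, ?_⟩
  rintro ⟨ψ, rfl⟩
  exact ⟨_, airyRes_mem Z ψ⟩

theorem airyRes_injective (Z : ℝ) : Function.Injective (airyRes Z) := by
  rw [injective_iff_map_eq_zero]
  intro ω h
  have := airyRes_mem Z ω
  rw [h, sub_zero] at this
  exact airyGraph_zero this

theorem reflect_airyRes_reflect_mem (Z : ℝ) (ω : L2G) :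
    (reflect (airyRes Z (reflect ω)), reflect (airyRes Z (reflect ω)) - ω) ∈ airyGraph Z := by
  have := reflect_mem_airyGraph (airyRes_mem Z (reflect ω))
  rwa [map_sub, neg_sub, reflect_reflect] at this

theorem eq_reflect_airyRes_reflect {Z : ℝ} {v f : L2G} (h : (v, f) ∈ airyGraph Z) :
    v = reflect (airyRes Z (reflect (v - f))) := by
  have := mem_airyGraph_iff.1 (reflect_mem_airyGraph h)
  rw [← sub_eq_add_neg, ← map_sub] at this
  rw [← this, reflect_reflect]

theorem star_airyRes_apply (Z : ℝ) (ω : L2G) :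
    star (airyRes Z) ω = reflect (airyRes Z (reflect ω)) := by
  rw [ContinuousLinearMap.star_eq_adjoint]
  refine ext_inner_left ℂ fun η => ?_
  rw [ContinuousLinearMap.adjoint_inner_right]
  have := airyGraph_skew (airyRes_mem Z η) (reflect_airyRes_reflect_mem Z ω)
  rw [inner_sub_left, inner_sub_right] at this
  linear_combination -this

/-- The algebraic properties of the resolvent `(1 + A)⁻¹` of a skew-adjoint operator `A`. -/
structure IsSkewResolvent {H : Type*} [NormedAddCommGroup H] [InnerProductSpace ℂ H]
    [CompleteSpace H] (R : H →L[ℂ] H) : Prop where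
  injective : Function.Injective R
  add_star : R + star R = (2 : ℂ) • (star R * R)
  add_star' : R + star R = (2 : ℂ) • (R * star R)

theorem isSkewResolvent_airyRes (Z : ℝ) : IsSkewResolvent (airyRes Z) where
  injective := airyRes_injective Z
  add_star := by
    ext1 ω
    have h := eq_reflect_airyRes_reflect (airyRes_mem Z ω)
    rw [← star_airyRes_apply, show airyRes Z ω - (ω - airyRes Z ω) = (2 : ℂ) • airyRes Z ω - ω by
      module, map_sub, map_smul] at h
    change airyRes Z ω + star (airyRes Z) ω = (2 : ℂ) • star (airyRes Z) (airyRes Z ω)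
    exact eq_sub_iff_add_eq.1 h
  add_star' := by
    ext1 ω
    have h := mem_airyGraph_iff.1 (reflect_airyRes_reflect_mem Z ω)
    rw [← star_airyRes_apply, show star (airyRes Z) ω + (star (airyRes Z) ω - ω) =
      (2 : ℂ) • star (airyRes Z) ω - ω by module, map_sub, map_smul] at h
    change airyRes Z ω + star (airyRes Z) ω = (2 : ℂ) • airyRes Z (star (airyRes Z) ω)
    rw [add_comm]
    exact eq_sub_iff_add_eq.1 h


theorem mul_exp_neg_le {r : ℝ} (hr : 0 < r) (τ : ℝ) :
    τ * Real.exp (-(r * τ)) ≤ 2 / r * Real.exp (-(r / 2 * τ)) := by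
  have h := Real.add_one_le_exp (r / 2 * τ)
  have e : Real.exp (-(r * τ)) = Real.exp (-(r / 2 * τ)) * Real.exp (-(r / 2 * τ)) := by
    rw [← Real.exp_add]; congr 1; ring
  have e2 : Real.exp (r / 2 * τ) * Real.exp (-(r / 2 * τ)) = 1 := by
    rw [← Real.exp_add]; simp
  have hp := Real.exp_pos (-(r / 2 * τ))
  have h3 : τ ≤ 2 / r * Real.exp (r / 2 * τ) := by
    rw [div_mul_eq_mul_div, le_div_iff₀ hr]; linarith
  rw [e, ← mul_assoc]
  refine mul_le_mul_of_nonneg_right ?_ hp.le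
  calc τ * Real.exp (-(r / 2 * τ)) ≤ 2 / r * Real.exp (r / 2 * τ) * Real.exp (-(r / 2 * τ)) :=
        mul_le_mul_of_nonneg_right h3 hp.le
    _ = 2 / r := by rw [mul_assoc, e2, mul_one]

/-- The function `τ * exp (-r * τ)` on `(0, ∞)`, extended by zero. -/
def rampExp (r τ : ℝ) : ℂ := ((max τ 0 : ℝ) : ℂ) * Complex.exp (-(r * τ))

theorem continuous_rampExp (r : ℝ) : Continuous (rampExp r) := by
  unfold rampExp; fun_prop

theorem rampExp_eq_indicator (r : ℝ) :
    rampExp r = (Ioi 0).indicator fun τ : ℝ => (τ : ℂ) * Complex.exp (-(r * τ)) := by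
  funext τ
  by_cases h : 0 < τ
  · rw [indicator_of_mem (mem_Ioi.2 h), rampExp, max_eq_left h.le]
  · rw [indicator_of_notMem (by simpa using h), rampExp, max_eq_right (not_lt.1 h)]; simp

theorem norm_mul_exp_neg {c : ℂ} {τ : ℝ} (hτ : 0 < τ) :
    ‖(τ : ℂ) * Complex.exp (-(c * τ))‖ = τ * Real.exp (-(c.re * τ)) := by
  rw [norm_mul, Complex.norm_real, Real.norm_of_nonneg hτ.le, Complex.norm_exp]
  simp

theorem integrableOn_mul_exp_neg {c : ℂ} (hc : 0 < c.re) :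
    IntegrableOn (fun τ : ℝ => (τ : ℂ) * Complex.exp (-(c * τ))) (Ioi 0) := by
  have h := (integrableOn_exp_mul_Ioi (a := -(c.re / 2)) (by linarith) 0).const_mul (2 / c.re)
  refine Integrable.mono' h (by fun_prop) ?_
  filter_upwards [ae_restrict_mem measurableSet_Ioi] with τ hτ
  rw [norm_mul_exp_neg hτ]
  refine (mul_exp_neg_le hc τ).trans (le_of_eq ?_)
  rw [neg_mul]

theorem integral_mul_exp_neg {c : ℂ} (hc : 0 < c.re) :
    ∫ τ in Ioi (0 : ℝ), (τ : ℂ) * Complex.exp (-(c * τ)) = (c ^ 2)⁻¹ := by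
  have hc0 : c ≠ 0 := fun h => by simp [h] at hc
  have hd : ∀ τ : ℝ, HasDerivAt (fun τ : ℝ => -((τ / c + (c ^ 2)⁻¹) * Complex.exp (-c * τ)))
      ((τ : ℂ) * Complex.exp (-(c * τ))) τ := fun τ => by
    have h1 : HasDerivAt (fun τ : ℝ => (τ : ℂ) / c + (c ^ 2)⁻¹) (1 / c) τ :=
      ((Complex.ofRealCLM.hasDerivAt (x := τ)).div_const c).add_const _
    convert! (h1.mul (hasDerivAt_exp_mul (-c) τ)).neg using 1
    rw [neg_mul]
    field_simp
    ring
  have ht : Tendsto (fun τ : ℝ => -((τ / c + (c ^ 2)⁻¹) * Complex.exp (-c * τ))) atTop (𝓝 0) := by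
    have t1 : Tendsto (fun τ : ℝ => (τ : ℂ) * Complex.exp (-(c * τ))) atTop (𝓝 0) := by
      have h2 : Tendsto (fun τ : ℝ => 2 / c.re * Real.exp (-(c.re / 2 * τ))) atTop (𝓝 0) := by
        have := (Real.tendsto_exp_atBot.comp (tendsto_neg_atTop_atBot.comp
          (tendsto_id.const_mul_atTop (half_pos hc)))).const_mul (2 / c.re)
        rwa [mul_zero] at this
      refine squeeze_zero_norm' ?_ h2
      filter_upwards [eventually_gt_atTop 0] with τ hτ
      rw [norm_mul_exp_neg hτ]
      exact mul_exp_neg_le hc τ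
    have t2 := tendsto_exp_mul_atTop (a := -c) (by simpa using hc)
    have := ((t1.const_mul c⁻¹).add (t2.const_mul (c ^ 2)⁻¹)).neg
    simp only [mul_zero, add_zero, neg_zero] at this
    refine this.congr fun τ => ?_
    rw [neg_mul]; ring
  have h := integral_Ioi_of_hasDerivAt_of_tendsto (a := 0) (hd 0).continuousAt.continuousWithinAt
    (fun τ _ => hd τ) (integrableOn_mul_exp_neg hc) ht
  rw [h]; simp

theorem integrable_rampExp {r : ℝ} (hr : 0 < r) : Integrable (rampExp r) volume := by
  rw [rampExp_eq_indicator, integrable_indicator_iff measurableSet_Ioi]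
  exact integrableOn_mul_exp_neg (c := r) (by simpa using hr)

open FourierTransform in
theorem fourier_rampExp {r : ℝ} (hr : 0 < r) (ξ : ℝ) :
    𝓕 (rampExp r) ξ = (((r : ℂ) + (2 * Real.pi * ξ : ℝ) * Complex.I) ^ 2)⁻¹ := by
  rw [← integral_mul_exp_neg (by simpa using hr), Real.fourier_real_eq_integral_exp_smul,
    ← integral_indicator measurableSet_Ioi]
  refine integral_congr_ae (.of_forall fun τ => ?_)
  simp only [rampExp_eq_indicator, smul_eq_mul]
  by_cases h : 0 < τ
  · rw [indicator_of_mem (mem_Ioi.2 h), indicator_of_mem (mem_Ioi.2 h), mul_left_comm,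
      ← Complex.exp_add]
    congr 2
    push_cast
    ring
  · rw [indicator_of_notMem (by simpa using h), indicator_of_notMem (by simpa using h), mul_zero]

theorem normSq_line (r s : ℝ) : ‖(r : ℂ) + s * Complex.I‖ ^ 2 = r ^ 2 + s ^ 2 := by
  rw [Complex.sq_norm, Complex.normSq_add_mul_I]

theorem line_ne_zero {r : ℝ} (hr : 0 < r) (s : ℝ) : (r : ℂ) + s * Complex.I ≠ 0 := fun h => by
  have := congrArg Complex.re h
  simp at this
  linarith

theorem integrable_inv_line_sq {r : ℝ} (hr : 0 < r) :
    Integrable (fun s : ℝ => (((r : ℂ) + s * Complex.I) ^ 2)⁻¹) volume := by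
  have hc : Continuous fun s : ℝ => (((r : ℂ) + s * Complex.I) ^ 2)⁻¹ :=
    Continuous.inv₀ (by fun_prop) fun s => pow_ne_zero 2 (line_ne_zero hr s)
  refine Integrable.mono' (integrable_inv_one_add_sq.const_mul (1 + 1 / r ^ 2))
    hc.aestronglyMeasurable (.of_forall fun s => ?_)
  rw [norm_inv, norm_pow, normSq_line, ← div_eq_mul_inv, ← one_div,
    div_le_div_iff₀ (by positivity) (by positivity)]
  have : (1 + 1 / r ^ 2) * (r ^ 2 + s ^ 2) = 1 + s ^ 2 + r ^ 2 + s ^ 2 / r ^ 2 := by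
    field_simp; ring
  rw [this]
  have := div_nonneg (sq_nonneg s) (sq_nonneg r)
  nlinarith [sq_nonneg r]

theorem norm_exp_line (r s t : ℝ) :
    ‖Complex.exp (((r : ℂ) + s * Complex.I) * t)‖ = Real.exp (r * t) := by
  rw [norm_exp_mul_ofReal]; simp

theorem integrable_exp_div_line_sq {r : ℝ} (hr : 0 < r) (t : ℝ) :
    Integrable (fun s : ℝ => Complex.exp (((r : ℂ) + s * Complex.I) * t)
      * (((r : ℂ) + s * Complex.I) ^ 2)⁻¹) volume := by
  refine (integrable_inv_line_sq hr).bdd_mul (c := Real.exp (r * t)) ?_ ?_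
  · exact (by fun_prop : Continuous fun s : ℝ =>
      Complex.exp (((r : ℂ) + s * Complex.I) * t)).aestronglyMeasurable
  · exact .of_forall fun s => (norm_exp_line r s t).le

open FourierTransform in
/-- The inverse Laplace transform of `λ ^ (-2)` is `t`. -/
theorem integral_exp_div_line_sq {r t : ℝ} (hr : 0 < r) (ht : 0 < t) :
    ∫ s : ℝ, Complex.exp (((r : ℂ) + s * Complex.I) * t) * (((r : ℂ) + s * Complex.I) ^ 2)⁻¹
      = 2 * Real.pi * t := by
  have hF : 𝓕 (rampExp r) = fun ξ : ℝ => (((r : ℂ) + (2 * Real.pi * ξ : ℝ) * Complex.I) ^ 2)⁻¹ :=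
    funext (fourier_rampExp hr)
  have hi : Integrable (𝓕 (rampExp r)) volume := by
    rw [hF]
    exact (integrable_inv_line_sq hr).comp_mul_left' (R := 2 * Real.pi) (by positivity)
  have h := congrFun ((continuous_rampExp r).fourierInv_fourier_eq (integrable_rampExp hr) hi) t
  rw [Real.fourierInv_eq', hF] at h
  have e : ∀ ξ : ℝ, Complex.exp (((2 * Real.pi * inner ℝ ξ t : ℝ) : ℂ) * Complex.I)
      • (((r : ℂ) + (2 * Real.pi * ξ : ℝ) * Complex.I) ^ 2)⁻¹ =
      Complex.exp (-(r * t)) * (fun s : ℝ => Complex.exp (((r : ℂ) + s * Complex.I) * t)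
        * (((r : ℂ) + s * Complex.I) ^ 2)⁻¹) (2 * Real.pi * ξ) := fun ξ => by
    simp only [smul_eq_mul]
    rw [← mul_assoc, ← Complex.exp_add]
    congr 2
    simp only [RCLike.inner_apply, conj_trivial]
    push_cast
    ring
  simp only [e] at h
  rw [integral_const_mul, Measure.integral_comp_mul_left (fun s : ℝ =>
    Complex.exp (((r : ℂ) + s * Complex.I) * t) * (((r : ℂ) + s * Complex.I) ^ 2)⁻¹),
    rampExp, max_eq_left ht.le, abs_of_pos (by positivity), Complex.real_smul] at h
  have hpi : (Real.pi : ℂ) ≠ 0 := by exact_mod_cast Real.pi_ne_zero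
  have hE := Complex.exp_ne_zero (-(r * t : ℂ))
  generalize (∫ s : ℝ, Complex.exp (((r : ℂ) + s * Complex.I) * t)
    * (((r : ℂ) + s * Complex.I) ^ 2)⁻¹) = X at h ⊢
  have h2 : (((2 * Real.pi)⁻¹ : ℝ) : ℂ) * X = t := by
    apply mul_left_cancel₀ hE
    rw [h]; ring
  rw [← h2]
  push_cast
  field_simp

theorem integral_exp_div_line {r t : ℝ} (hr : 0 < r) (ht : 0 < t) (a b : ℝ) :
    ∫ s in a..b, Complex.exp (((r : ℂ) + s * Complex.I) * t) * ((r : ℂ) + s * Complex.I)⁻¹ =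
      (Complex.I * t)⁻¹ * (Complex.exp (((r : ℂ) + b * Complex.I) * t) * ((r : ℂ) + b * Complex.I)⁻¹
        - Complex.exp (((r : ℂ) + a * Complex.I) * t) * ((r : ℂ) + a * Complex.I)⁻¹)
      + (t : ℂ)⁻¹ * ∫ s in a..b, Complex.exp (((r : ℂ) + s * Complex.I) * t)
        * (((r : ℂ) + s * Complex.I) ^ 2)⁻¹ := by
  have htc : (t : ℂ) ≠ 0 := by exact_mod_cast ht.ne'
  have hc1 : Continuous fun s : ℝ => Complex.exp (((r : ℂ) + s * Complex.I) * t)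
      * ((r : ℂ) + s * Complex.I)⁻¹ :=
    (by fun_prop : Continuous fun s : ℝ => Complex.exp (((r : ℂ) + s * Complex.I) * t)).mul
      (Continuous.inv₀ (by fun_prop) (line_ne_zero hr))
  have hc2 : Continuous fun s : ℝ => (t : ℂ)⁻¹ * (Complex.exp (((r : ℂ) + s * Complex.I) * t)
      * (((r : ℂ) + s * Complex.I) ^ 2)⁻¹) :=
    continuous_const.mul
      ((by fun_prop : Continuous fun s : ℝ => Complex.exp (((r : ℂ) + s * Complex.I) * t)).mul
      (Continuous.inv₀ (by fun_prop) fun s => pow_ne_zero 2 (line_ne_zero hr s)))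
  have hd : ∀ s : ℝ, HasDerivAt (fun s : ℝ => (Complex.I * t)⁻¹ *
      (Complex.exp (((r : ℂ) + s * Complex.I) * t) * ((r : ℂ) + s * Complex.I)⁻¹))
      (Complex.exp (((r : ℂ) + s * Complex.I) * t) * ((r : ℂ) + s * Complex.I)⁻¹
        - (t : ℂ)⁻¹ * (Complex.exp (((r : ℂ) + s * Complex.I) * t)
          * (((r : ℂ) + s * Complex.I) ^ 2)⁻¹)) s := fun s => by
    have hl := line_ne_zero hr s
    have h1 : HasDerivAt (fun s : ℝ => (r : ℂ) + s * Complex.I) (1 * Complex.I) s :=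
      ((Complex.ofRealCLM.hasDerivAt (x := s)).mul_const Complex.I).const_add _
    convert! (((h1.mul_const (t : ℂ)).cexp).mul (h1.inv hl)).const_mul (Complex.I * t)⁻¹ using 1
    have hI := Complex.I_ne_zero
    simp only [Pi.inv_apply]
    field_simp
    ring
  have h := intervalIntegral.integral_eq_sub_of_hasDerivAt (a := a) (b := b) (fun s _ => hd s)
    ((hc1.sub hc2).intervalIntegrable _ _)
  rw [intervalIntegral.integral_sub (hc1.intervalIntegrable _ _) (hc2.intervalIntegrable _ _),
    intervalIntegral.integral_const_mul] at h
  linear_combination h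

theorem norm_inv_line_le {r : ℝ} (hr : 0 < r) (s : ℝ) : ‖((r : ℂ) + s * Complex.I)⁻¹‖ ≤ r⁻¹ := by
  rw [norm_inv]
  refine inv_anti₀ hr ?_
  have := Complex.re_le_norm ((r : ℂ) + s * Complex.I)
  simpa using this

theorem norm_inv_line_le' {r : ℝ} {s : ℝ} (hs : s ≠ 0) :
    ‖((r : ℂ) + s * Complex.I)⁻¹‖ ≤ |s|⁻¹ := by
  rw [norm_inv]
  refine inv_anti₀ (abs_pos.2 hs) ?_
  have := Complex.abs_im_le_norm ((r : ℂ) + s * Complex.I)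
  simpa using this

theorem exists_bound_integral_exp_div_line {r t : ℝ} (hr : 0 < r) (ht : 0 < t) :
    ∃ C, 0 < C ∧ ∀ a b : ℝ, ‖∫ s in a..b, Complex.exp (((r : ℂ) + s * Complex.I) * t)
      * ((r : ℂ) + s * Complex.I)⁻¹‖ ≤ C := by
  have hi := integrable_exp_div_line_sq hr t
  refine ⟨t⁻¹ * (2 * (Real.exp (r * t) * r⁻¹)) + t⁻¹ * ∫ s : ℝ, ‖Complex.exp
    (((r : ℂ) + s * Complex.I) * t) * (((r : ℂ) + s * Complex.I) ^ 2)⁻¹‖, ?_, fun a b => ?_⟩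
  · have : 0 ≤ ∫ s : ℝ, ‖Complex.exp
      (((r : ℂ) + s * Complex.I) * t) * (((r : ℂ) + s * Complex.I) ^ 2)⁻¹‖ := by positivity
    positivity
  rw [integral_exp_div_line hr ht]
  have hb : ∀ s : ℝ, ‖Complex.exp (((r : ℂ) + s * Complex.I) * t) * ((r : ℂ) + s * Complex.I)⁻¹‖
      ≤ Real.exp (r * t) * r⁻¹ := fun s => by
    rw [norm_mul, norm_exp_line]
    exact mul_le_mul_of_nonneg_left (norm_inv_line_le hr s) (Real.exp_pos _).le
  have n1 : ‖(Complex.I * t)⁻¹‖ = t⁻¹ := by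
    rw [norm_inv, norm_mul, Complex.norm_I, Complex.norm_real, Real.norm_of_nonneg ht.le, one_mul]
  have n2 : ‖(t : ℂ)⁻¹‖ = t⁻¹ := by
    rw [norm_inv, Complex.norm_real, Real.norm_of_nonneg ht.le]
  refine (norm_add_le _ _).trans (add_le_add ?_ ?_)
  · rw [norm_mul, n1]
    refine mul_le_mul_of_nonneg_left ((norm_sub_le _ _).trans ?_) (by positivity)
    linarith [hb a, hb b]
  · rw [norm_mul, n2]
    refine mul_le_mul_of_nonneg_left ?_ (by positivity)
    refine intervalIntegral.norm_integral_le_integral_norm_uIoc.trans ?_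
    exact setIntegral_le_integral hi.norm (.of_forall fun s => norm_nonneg _)

theorem norm_integral_Ioi_exp_div_line_sq_le {r t b : ℝ} (hb : 0 < b) (σ : ℝ) (hσ : |σ| = 1) :
    ‖∫ s in Ioi b, Complex.exp (((r : ℂ) + (σ * s : ℝ) * Complex.I) * t)
      * (((r : ℂ) + (σ * s : ℝ) * Complex.I) ^ 2)⁻¹‖ ≤ Real.exp (r * t) * b⁻¹ := by
  have hi := (integrableOn_Ioi_rpow_of_lt (a := -2) (by norm_num) hb).const_mul (Real.exp (r * t))
  have e : ∫ s in Ioi b, Real.exp (r * t) * s ^ (-2 : ℝ) = Real.exp (r * t) * b⁻¹ := by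
    rw [integral_const_mul, integral_Ioi_rpow_of_lt (by norm_num) hb]
    norm_num
    rw [Real.rpow_neg_one]
  rw [← e]
  refine norm_integral_le_of_norm_le hi ?_
  filter_upwards [ae_restrict_mem measurableSet_Ioi] with s hs
  have hs0 : 0 < s := hb.trans hs
  have hσ0 : σ ≠ 0 := fun h => by simp [h] at hσ
  rw [norm_mul, norm_exp_line]
  refine mul_le_mul_of_nonneg_left ?_ (Real.exp_pos _).le
  rw [← inv_pow, norm_pow, Real.rpow_neg hs0.le, Real.rpow_two, ← inv_pow]
  refine pow_le_pow_left₀ (norm_nonneg _) ?_ 2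
  refine (norm_inv_line_le' (mul_ne_zero hσ0 hs0.ne')).trans (le_of_eq ?_)
  rw [abs_mul, hσ, one_mul, abs_of_pos hs0]

theorem norm_integral_exp_div_line_sub_le {r t a b : ℝ} (hr : 0 < r) (ht : 0 < t) (ha : 0 < a)
    (hb : 0 < b) :
    ‖(∫ s in (-a)..b, Complex.exp (((r : ℂ) + s * Complex.I) * t) * ((r : ℂ) + s * Complex.I)⁻¹)
      - 2 * Real.pi‖ ≤ 2 * (t⁻¹ * Real.exp (r * t)) * (a⁻¹ + b⁻¹) := by
  set Q : ℝ → ℂ := fun s => Complex.exp (((r : ℂ) + s * Complex.I) * t)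
    * (((r : ℂ) + s * Complex.I) ^ 2)⁻¹ with hQ
  have hi : Integrable Q volume := integrable_exp_div_line_sq hr t
  have htc : (t : ℂ) ≠ 0 := by exact_mod_cast ht.ne'
  have hfull : ∫ s, Q s = 2 * Real.pi * t := integral_exp_div_line_sq hr ht
  have hsplit : (∫ s in Iic (-a), Q s) + (∫ s in (-a)..b, Q s) + ∫ s in Ioi b, Q s = ∫ s, Q s := by
    rw [add_assoc, intervalIntegral.integral_interval_add_Ioi hi.integrableOn hi.integrableOn,
      intervalIntegral.integral_Iic_add_Ioi hi.integrableOn hi.integrableOn]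
  have n1 : ‖∫ s in Ioi b, Q s‖ ≤ Real.exp (r * t) * b⁻¹ := by
    have := norm_integral_Ioi_exp_div_line_sq_le (r := r) (t := t) hb 1 (by simp)
    simpa only [one_mul] using this
  have n2 : ‖∫ s in Iic (-a), Q s‖ ≤ Real.exp (r * t) * a⁻¹ := by
    have := norm_integral_Ioi_exp_div_line_sq_le (r := r) (t := t) ha (-1) (by simp)
    rw [← integral_comp_neg_Ioi]
    simpa only [neg_one_mul] using this
  have hK := integral_exp_div_line hr ht (-a) b
  have bd : ∀ s : ℝ, s ≠ 0 → ‖Complex.exp (((r : ℂ) + s * Complex.I) * t)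
      * ((r : ℂ) + s * Complex.I)⁻¹‖ ≤ Real.exp (r * t) * |s|⁻¹ := fun s hs => by
    rw [norm_mul, norm_exp_line]
    exact mul_le_mul_of_nonneg_left (norm_inv_line_le' hs) (Real.exp_pos _).le
  have b1 := bd b hb.ne'
  have b2 := bd (-a) (neg_ne_zero.2 ha.ne')
  rw [abs_of_pos hb] at b1
  rw [abs_neg, abs_of_pos ha] at b2
  have e : (∫ s in (-a)..b, Complex.exp (((r : ℂ) + s * Complex.I) * t)
      * ((r : ℂ) + s * Complex.I)⁻¹) - 2 * Real.pi =
      (Complex.I * t)⁻¹ * (Complex.exp (((r : ℂ) + b * Complex.I) * t) * ((r : ℂ) + b * Complex.I)⁻¹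
        - Complex.exp (((r : ℂ) + (-a : ℝ) * Complex.I) * t) * ((r : ℂ) + (-a : ℝ) * Complex.I)⁻¹)
      - (t : ℂ)⁻¹ * ((∫ s in Iic (-a), Q s) + ∫ s in Ioi b, Q s) := by
    rw [hK]
    have : (2 : ℂ) * Real.pi = (t : ℂ)⁻¹ * ∫ s, Q s := by rw [hfull]; field_simp
    rw [this, ← hsplit]
    ring
  have m1 : ‖(Complex.I * t)⁻¹‖ = t⁻¹ := by
    rw [norm_inv, norm_mul, Complex.norm_I, Complex.norm_real, Real.norm_of_nonneg ht.le, one_mul]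
  have m2 : ‖(t : ℂ)⁻¹‖ = t⁻¹ := by
    rw [norm_inv, Complex.norm_real, Real.norm_of_nonneg ht.le]
  rw [e]
  have ht' : 0 ≤ t⁻¹ := by positivity
  refine (norm_sub_le _ _).trans ?_
  rw [norm_mul, norm_mul, m1, m2]
  have k1 := mul_le_mul_of_nonneg_left ((norm_sub_le _ _).trans (add_le_add b1 b2)) ht'
  have k2 := mul_le_mul_of_nonneg_left ((norm_add_le _ _).trans (add_le_add n2 n1)) ht'
  linarith


/-- A uniformly bounded family of operators which converges to zero on a dense range converges
strongly to zero. -/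
theorem tendsto_apply_of_denseRange {ι H : Type*} [NormedAddCommGroup H] [InnerProductSpace ℂ H]
    {R : H →L[ℂ] H} (hR : DenseRange R) {l : Filter ι} {L : ι → H →L[ℂ] H} {C : ℝ}
    (hC : ∀ᶠ i in l, ‖L i‖ ≤ C) (h : ∀ u, Tendsto (fun i => L i (R u)) l (𝓝 0)) (u : H) :
    Tendsto (fun i => L i u) l (𝓝 0) := by
  rw [Metric.tendsto_nhds]
  intro ε hε
  have hC0 : 0 < |C| + 1 := by positivity
  obtain ⟨w, hw⟩ := hR.exists_dist_lt u (show 0 < ε / 2 / (|C| + 1) by positivity)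
  filter_upwards [hC, (Metric.tendsto_nhds.1 (h w)) (ε / 2) (by positivity)] with i h1 h2
  rw [dist_zero_right] at h2 ⊢
  rw [dist_eq_norm] at hw
  have e : L i u = L i (u - R w) + L i (R w) := by rw [← map_add, sub_add_cancel]
  have h3 : ‖L i (u - R w)‖ ≤ (|C| + 1) * ‖u - R w‖ :=
    ((L i).le_opNorm _).trans (mul_le_mul_of_nonneg_right
      (h1.trans ((le_abs_self C).trans (by linarith))) (norm_nonneg _))
  have h4 : (|C| + 1) * ‖u - R w‖ < ε / 2 := by
    rw [lt_div_iff₀ hC0] at hw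
    linarith
  rw [e]
  refine (norm_add_le _ _).trans_lt ?_
  linarith

theorem continuousOn_of_norm_le_mul_norm {K : Set ℂ} {f : ℂ → ℂ} {C : ℝ}
    (h : ∀ z ∈ K, z ≠ 0 → ContinuousAt f z) (hC : ∀ z ∈ K, ‖f z‖ ≤ C * ‖z‖) : ContinuousOn f K := by
  intro z hz
  by_cases h0 : z = 0
  · subst h0
    have hf0 : f 0 = 0 := by simpa using hC 0 hz
    rw [ContinuousWithinAt, hf0]
    have ht : Tendsto (fun z : ℂ => C * ‖z‖) (𝓝[K] 0) (𝓝 0) := by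
      have : ContinuousWithinAt (fun z : ℂ => C * ‖z‖) K 0 := by fun_prop
      simpa [ContinuousWithinAt] using this
    exact squeeze_zero_norm' (by filter_upwards [self_mem_nhdsWithin] with y hy using hC y hy) ht
  · exact (h z hz h0).continuousWithinAt

/-- The symbol of `exp (t A) (1 + A)⁻¹`, as a function of the value of `(1 + A)⁻¹`. -/
def groupSymbol (t : ℝ) (z : ℂ) : ℂ := z * Complex.exp (t * (z⁻¹ - 1))

/-- The symbol of `(lam + A)⁻¹`, as a function of the value of `(1 + A)⁻¹`. -/
def resSymbol (lam z : ℂ) : ℂ := z / (1 + (lam - 1) * z)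

theorem groupSymbol_mul (s t : ℝ) (z : ℂ) :
    groupSymbol s z * groupSymbol t z = groupSymbol (s + t) z * z := by
  rw [groupSymbol, groupSymbol, groupSymbol, Complex.ofReal_add, add_mul, Complex.exp_add]
  ring

theorem groupSymbol_zero (z : ℂ) : groupSymbol 0 z = z := by simp [groupSymbol]

/-- The circle in which the spectrum of `(1 + A)⁻¹` lies. -/
def resCircle : Set ℂ := {z | z.re = z.re ^ 2 + z.im ^ 2}

theorem resCircle_norm_sq {z : ℂ} (hz : z ∈ resCircle) : ‖z‖ ^ 2 = z.re := by
  rw [Complex.sq_norm, Complex.normSq_apply]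
  have : z.re = z.re ^ 2 + z.im ^ 2 := hz
  linarith

theorem resCircle_norm_le {z : ℂ} (hz : z ∈ resCircle) : ‖z‖ ≤ 1 := by
  have h := resCircle_norm_sq hz
  have h2 := Complex.re_le_norm z
  by_contra! h3
  nlinarith

theorem resCircle_inv {z : ℂ} (hz : z ∈ resCircle) (h0 : z ≠ 0) :
    z⁻¹ = 1 + (z⁻¹.im : ℂ) * Complex.I := by
  have h : z⁻¹.re = 1 := by
    rw [Complex.inv_re, ← resCircle_norm_sq hz, Complex.sq_norm, div_self]
    exact (Complex.normSq_pos.2 h0).ne'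
  conv_lhs => rw [← Complex.re_add_im z⁻¹, h]
  simp

theorem norm_mul_inv_im_le {z : ℂ} (h0 : z ≠ 0) : ‖z‖ * |z⁻¹.im| ≤ 1 := by
  have h1 := Complex.abs_im_le_norm z⁻¹
  rw [norm_inv] at h1
  have h2 := norm_pos_iff.2 h0
  calc ‖z‖ * |z⁻¹.im| ≤ ‖z‖ * ‖z‖⁻¹ := mul_le_mul_of_nonneg_left h1 h2.le
    _ = 1 := mul_inv_cancel₀ h2.ne'

theorem norm_groupSymbol {z : ℂ} (hz : z ∈ resCircle) (t : ℝ) : ‖groupSymbol t z‖ = ‖z‖ := by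
  by_cases h0 : z = 0
  · simp [h0, groupSymbol]
  · rw [groupSymbol, norm_mul, resCircle_inv hz h0, Complex.norm_exp]
    simp

theorem resSymbol_denom_ne_zero {z : ℂ} (hz : z ∈ resCircle) {lam : ℂ} (hlam : 0 < lam.re) :
    1 + (lam - 1) * z ≠ 0 := by
  intro h
  have h0 : z ≠ 0 := fun h0 => by simp [h0] at h
  have h1 : z⁻¹ = 1 - lam := by
    field_simp
    linear_combination h
  have h2 := congrArg Complex.re (h1.symm.trans (resCircle_inv hz h0))
  simp at h2
  linarith

theorem resSymbol_eq {z : ℂ} (hz : z ∈ resCircle) (h0 : z ≠ 0) {lam : ℂ} (hlam : 0 < lam.re) :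
    resSymbol lam z = (lam + (z⁻¹.im : ℂ) * Complex.I)⁻¹ := by
  have hd := resSymbol_denom_ne_zero hz hlam
  have e : lam + (z⁻¹.im : ℂ) * Complex.I = (1 + (lam - 1) * z) / z := by
    rw [← sub_eq_iff_eq_add'.2 (resCircle_inv hz h0)]
    field_simp
    ring
  rw [e, inv_div, resSymbol]

theorem norm_resSymbol_le {z : ℂ} (hz : z ∈ resCircle) {lam : ℂ} (hlam : 0 < lam.re) :
    ‖resSymbol lam z‖ ≤ lam.re⁻¹ := by
  by_cases h0 : z = 0
  · simp [h0, resSymbol, hlam.le]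
  · rw [resSymbol_eq hz h0 hlam, norm_inv]
    refine inv_anti₀ hlam ?_
    have := Complex.re_le_norm (lam + (z⁻¹.im : ℂ) * Complex.I)
    simpa using this

theorem continuousOn_groupSymbol {K : Set ℂ} (hK : K ⊆ resCircle) (t : ℝ) :
    ContinuousOn (groupSymbol t) K := by
  refine continuousOn_of_norm_le_mul_norm (C := 1) (fun z _ h0 => ?_)
    (fun z hz => by rw [norm_groupSymbol (hK hz), one_mul])
  unfold groupSymbol
  fun_prop (disch := assumption)

theorem continuousOn_resSymbol {K : Set ℂ} (hK : K ⊆ resCircle) {lam : ℂ} (hlam : 0 < lam.re) :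
    ContinuousOn (resSymbol lam) K :=
  ContinuousOn.div continuousOn_id (by fun_prop) fun _ hz => resSymbol_denom_ne_zero (hK hz) hlam

theorem norm_exp_mul_I_sub_one_le (y : ℝ) : ‖Complex.exp (y * Complex.I) - 1‖ ≤ |y| := by
  have := Real.norm_exp_I_mul_ofReal_sub_one_le (x := y)
  rwa [mul_comm Complex.I, Real.norm_eq_abs] at this

theorem norm_exp_mul_I_sub_one_sub_le (y : ℝ) :
    ‖Complex.exp (y * Complex.I) - 1 - y * Complex.I‖ ≤ 2 * y ^ 2 := by
  have hy : ‖(y : ℂ) * Complex.I‖ = |y| := by simp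
  by_cases h : |y| ≤ 1
  · have := Complex.norm_exp_sub_one_sub_id_le (x := y * Complex.I) (by rwa [hy])
    rw [hy, sq_abs] at this
    nlinarith [sq_nonneg y]
  · have h1 := norm_sub_le (Complex.exp (y * Complex.I) - 1) (y * Complex.I)
    rw [hy] at h1
    have h2 := norm_exp_mul_I_sub_one_le y
    rw [← sq_abs y]
    nlinarith

/-- The symbol of the difference quotient of `exp (t A) (1 + A)⁻¹` at `t = 0`, minus its limit. -/
def quotSymbol (t : ℝ) (z : ℂ) : ℂ := (t : ℂ)⁻¹ * (groupSymbol t z - z) - (1 - z)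

theorem quotSymbol_eq {z : ℂ} (hz : z ∈ resCircle) (h0 : z ≠ 0) {t : ℝ} (ht : t ≠ 0) :
    quotSymbol t z = z * (t : ℂ)⁻¹ * (Complex.exp ((t * z⁻¹.im : ℝ) * Complex.I) - 1
      - (t * z⁻¹.im : ℝ) * Complex.I) := by
  have htc : (t : ℂ) ≠ 0 := by exact_mod_cast ht
  have hi := resCircle_inv hz h0
  have e1 : (t : ℂ) * (z⁻¹ - 1) = (t * z⁻¹.im : ℝ) * Complex.I := by
    push_cast; linear_combination (t : ℂ) * hi
  have e2 : 1 - z = z * ((z⁻¹.im : ℂ) * Complex.I) := by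
    rw [← sub_eq_iff_eq_add'.2 hi]; field_simp
  rw [quotSymbol, groupSymbol, e1, e2]
  push_cast
  field_simp

theorem norm_quotSymbol_le {z : ℂ} (hz : z ∈ resCircle) {t : ℝ} (ht : t ≠ 0) :
    ‖quotSymbol t z‖ ≤ 2 := by
  by_cases h0 : z = 0
  · simp [h0, quotSymbol, groupSymbol]
  · rw [quotSymbol_eq hz h0 ht, norm_mul, norm_mul, norm_inv, Complex.norm_real, Real.norm_eq_abs]
    have h1 : ‖Complex.exp ((t * z⁻¹.im : ℝ) * Complex.I) - 1 - (t * z⁻¹.im : ℝ) * Complex.I‖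
        ≤ 2 * (|t| * |z⁻¹.im|) := by
      refine (norm_sub_le _ _).trans ?_
      have := norm_exp_mul_I_sub_one_le (t * z⁻¹.im)
      rw [norm_mul, Complex.norm_I, Complex.norm_real, Real.norm_eq_abs, ← abs_mul]
      linarith
    have h2 := norm_mul_inv_im_le h0
    have ht' : 0 < |t| := abs_pos.2 ht
    calc ‖z‖ * |t|⁻¹ * _ ≤ ‖z‖ * |t|⁻¹ * (2 * (|t| * |z⁻¹.im|)) := by gcongr
      _ = 2 * (‖z‖ * |z⁻¹.im|) := by field_simp
      _ ≤ 2 := by linarith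

theorem norm_quotSymbol_mul_le {z : ℂ} (hz : z ∈ resCircle) {t : ℝ} (ht : t ≠ 0) :
    ‖quotSymbol t z * z‖ ≤ 2 * |t| := by
  by_cases h0 : z = 0
  · simp [h0]
  · rw [quotSymbol_eq hz h0 ht, norm_mul, norm_mul, norm_mul, norm_inv, Complex.norm_real,
      Real.norm_eq_abs]
    have h1 := norm_exp_mul_I_sub_one_sub_le (t * z⁻¹.im)
    have h2 := norm_mul_inv_im_le h0
    have ht' : 0 < |t| := abs_pos.2 ht
    have h3 : (‖z‖ * |z⁻¹.im|) ^ 2 ≤ 1 := pow_le_one₀ (by positivity) h2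
    calc ‖z‖ * |t|⁻¹ * _ * ‖z‖ ≤ ‖z‖ * |t|⁻¹ * (2 * (t * z⁻¹.im) ^ 2) * ‖z‖ := by gcongr
      _ = 2 * |t| * (‖z‖ * |z⁻¹.im|) ^ 2 := by
          rw [mul_pow, mul_pow, ← sq_abs t, ← sq_abs z⁻¹.im]; field_simp
      _ ≤ 2 * |t| := by nlinarith

/-- The symbol of the truncated Bromwich integral. -/
def bromSymbol (t r N : ℝ) (z : ℂ) : ℂ :=
  ∫ s in (-N)..N, Complex.exp (((r : ℂ) + s * Complex.I) * t) * resSymbol (r + s * Complex.I) z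

theorem bromSymbol_eq {z : ℂ} (hz : z ∈ resCircle) (h0 : z ≠ 0) {t r : ℝ} (hr : 0 < r) (N : ℝ) :
    bromSymbol t r N z = Complex.exp (-((t * z⁻¹.im : ℝ) * Complex.I)) *
      ∫ s in (-(N - z⁻¹.im))..(N + z⁻¹.im), Complex.exp (((r : ℂ) + s * Complex.I) * t)
        * ((r : ℂ) + s * Complex.I)⁻¹ := by
  rw [neg_sub, ← neg_add_eq_sub, ← intervalIntegral.integral_comp_add_right
    (fun s : ℝ => Complex.exp (((r : ℂ) + s * Complex.I) * t) * ((r : ℂ) + s * Complex.I)⁻¹),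
    ← intervalIntegral.integral_const_mul, bromSymbol]
  refine intervalIntegral.integral_congr fun s _ => ?_
  rw [resSymbol_eq hz h0 (by simpa using hr), ← mul_assoc, ← Complex.exp_add]
  congr 2 <;> (push_cast; ring)

theorem norm_exp_neg_mul_I (y : ℝ) : ‖Complex.exp (-(y * Complex.I))‖ = 1 := by
  rw [Complex.norm_exp]; simp

theorem exists_norm_bromSymbol_le {t r : ℝ} (hr : 0 < r) (ht : 0 < t) :
    ∃ C, 0 < C ∧ ∀ N, ∀ z ∈ resCircle, ‖bromSymbol t r N z‖ ≤ C := by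
  obtain ⟨C, hC, h⟩ := exists_bound_integral_exp_div_line hr ht
  refine ⟨C, hC, fun N z hz => ?_⟩
  by_cases h0 : z = 0
  · simp [h0, bromSymbol, resSymbol, hC.le]
  · rw [bromSymbol_eq hz h0 hr, norm_mul, norm_exp_neg_mul_I, one_mul]
    exact h _ _

theorem groupSymbol_neg_eq {z : ℂ} (hz : z ∈ resCircle) (h0 : z ≠ 0) (t : ℝ) :
    groupSymbol (-t) z = Complex.exp (-((t * z⁻¹.im : ℝ) * Complex.I)) * z := by
  rw [groupSymbol, mul_comm]
  congr 2
  push_cast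
  linear_combination -(t : ℂ) * resCircle_inv hz h0

theorem exists_norm_bromSymbol_sub_le {t r : ℝ} (hr : 0 < r) (ht : 0 < t) :
    ∃ C, ∀ N > 0, ∀ z ∈ resCircle,
      ‖bromSymbol t r N z * z - 2 * Real.pi * groupSymbol (-t) z‖ ≤ C * N⁻¹ := by
  obtain ⟨C, hC, hb⟩ := exists_norm_bromSymbol_le hr ht
  refine ⟨2 * (C + 2 * Real.pi) + 8 * (t⁻¹ * Real.exp (r * t)), fun N hN z hz => ?_⟩
  have hpi := Real.pi_pos
  have hE : 0 < t⁻¹ * Real.exp (r * t) := by positivity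
  have hN' : 0 < N⁻¹ := by positivity
  by_cases h0 : z = 0
  · simp only [h0, mul_zero, groupSymbol, zero_mul, sub_zero, norm_zero]
    positivity
  have hz0 := norm_pos_iff.2 h0
  by_cases hbN : |z⁻¹.im| ≤ N / 2
  · have h1 := abs_le.1 hbN
    have hk := norm_integral_exp_div_line_sub_le hr ht (a := N - z⁻¹.im) (b := N + z⁻¹.im)
      (by linarith) (by linarith)
    have i1 : (N - z⁻¹.im)⁻¹ ≤ 2 * N⁻¹ := by
      rw [show 2 * N⁻¹ = (N / 2)⁻¹ by rw [inv_div]; ring]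
      exact inv_anti₀ (by positivity) (by linarith)
    have i2 : (N + z⁻¹.im)⁻¹ ≤ 2 * N⁻¹ := by
      rw [show 2 * N⁻¹ = (N / 2)⁻¹ by rw [inv_div]; ring]
      exact inv_anti₀ (by positivity) (by linarith)
    rw [bromSymbol_eq hz h0 hr, groupSymbol_neg_eq hz h0]
    set X := ∫ s in (-(N - z⁻¹.im))..(N + z⁻¹.im), Complex.exp (((r : ℂ) + s * Complex.I) * t)
        * ((r : ℂ) + s * Complex.I)⁻¹
    set F := Complex.exp (-((t * z⁻¹.im : ℝ) * Complex.I)) with hF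
    have e : F * X * z - 2 * Real.pi * (F * z) = F * ((X - 2 * Real.pi) * z) := by ring
    rw [e, norm_mul, hF, norm_exp_neg_mul_I, one_mul, norm_mul]
    calc ‖X - 2 * Real.pi‖ * ‖z‖ ≤ ‖X - 2 * Real.pi‖ * 1 :=
          mul_le_mul_of_nonneg_left (resCircle_norm_le hz) (norm_nonneg _)
      _ ≤ 2 * (t⁻¹ * Real.exp (r * t)) * ((N - z⁻¹.im)⁻¹ + (N + z⁻¹.im)⁻¹) := by
          rw [mul_one]; exact hk
      _ ≤ 2 * (t⁻¹ * Real.exp (r * t)) * (2 * N⁻¹ + 2 * N⁻¹) := by gcongr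
      _ ≤ _ := by nlinarith
  · rw [not_le] at hbN
    have h1 := norm_mul_inv_im_le h0
    have h2 : ‖z‖ ≤ 2 * N⁻¹ := by
      rw [show 2 * N⁻¹ = (N / 2)⁻¹ by rw [inv_div]; ring, ← one_div, le_div_iff₀ (by positivity)]
      nlinarith
    refine (norm_sub_le _ _).trans ?_
    rw [norm_mul, norm_mul, norm_groupSymbol hz]
    have e : ‖(2 * Real.pi : ℂ)‖ = 2 * Real.pi := by
      rw [norm_mul, Complex.norm_real, Real.norm_of_nonneg hpi.le]; simp
    rw [e, ← add_mul]
    have h3 := hb N z hz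
    calc (‖bromSymbol t r N z‖ + 2 * Real.pi) * ‖z‖ ≤ (C + 2 * Real.pi) * (2 * N⁻¹) := by gcongr
      _ ≤ _ := by nlinarith


namespace IsSkewResolvent

variable {H : Type*} [NormedAddCommGroup H] [InnerProductSpace ℂ H] [CompleteSpace H]
  {R : H →L[ℂ] H}

theorem isStarNormal (hR : IsSkewResolvent R) : IsStarNormal R := by
  refine ⟨?_⟩
  have h := hR.add_star.symm.trans hR.add_star'
  exact smul_right_injective _ (two_ne_zero (α := ℂ)) h

theorem spectrum_subset (hR : IsSkewResolvent R) : spectrum ℂ R ⊆ resCircle := by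
  have hn := hR.isStarNormal
  intro z hz
  have e : cfc (fun z : ℂ => z + star z - (2 : ℂ) • (star z * z)) R = 0 := by
    rw [cfc_sub (fun z : ℂ => z + star z) (fun z : ℂ => (2 : ℂ) • (star z * z)) R,
      cfc_add R (fun z : ℂ => z) (fun z : ℂ => star z),
      cfc_smul (2 : ℂ) (fun z : ℂ => star z * z) R,
      cfc_mul (fun z : ℂ => star z) (fun z : ℂ => z) R, cfc_id' ℂ R, cfc_star_id (R := ℂ) (a := R),
      hR.add_star, sub_self]
  have h := norm_apply_le_norm_cfc (fun z : ℂ => z + star z - (2 : ℂ) • (star z * z)) R hz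
    (by fun_prop)
  rw [e, norm_zero, norm_le_zero_iff] at h
  have h2 := congrArg Complex.re h
  simp at h2
  change z.re = z.re ^ 2 + z.im ^ 2
  linarith

theorem denseRange (hR : IsSkewResolvent R) : DenseRange R := by
  have h : R.rangeᗮ = ⊥ := by
    rw [ContinuousLinearMap.IsStarNormal.orthogonal_range hR.isStarNormal, LinearMap.ker_eq_bot]
    exact hR.injective
  have h2 := (Submodule.topologicalClosure_eq_top_iff (K := R.range)).2 h
  exact (Submodule.dense_iff_topologicalClosure_eq_top (s := R.range)).2 h2

/-- The operator `exp (t A) (1 + A)⁻¹`. -/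
def _root_.groupRes (R : H →L[ℂ] H) (t : ℝ) : H →L[ℂ] H := cfc (groupSymbol t) R

theorem continuousOn_groupSymbol (hR : IsSkewResolvent R) (t : ℝ) :
    ContinuousOn (groupSymbol t) (spectrum ℂ R) :=
  _root_.continuousOn_groupSymbol hR.spectrum_subset t

theorem cfc_mul_self (hR : IsSkewResolvent R) {f : ℂ → ℂ} (hf : ContinuousOn f (spectrum ℂ R)) :
    cfc (fun z => f z * z) R = cfc f R * R := by
  have hn := hR.isStarNormal
  rw [cfc_mul f (fun z => z) R, cfc_id' ℂ R]

theorem cfc_mul_comm_self (hR : IsSkewResolvent R) {f : ℂ → ℂ}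
    (hf : ContinuousOn f (spectrum ℂ R)) : cfc f R * R = R * cfc f R := by
  have hn := hR.isStarNormal
  rw [← hR.cfc_mul_self hf]
  simp only [mul_comm (f _)]
  rw [cfc_mul (fun z => z) f R, cfc_id' ℂ R]

theorem norm_groupRes_apply (hR : IsSkewResolvent R) (t : ℝ) (u : H) :
    ‖groupRes R t u‖ = ‖R u‖ := by
  have hn := hR.isStarNormal
  have hc := hR.continuousOn_groupSymbol t
  have e : star (groupRes R t) * groupRes R t = star R * R := by
    rw [groupRes, ← cfc_star, ← cfc_mul (fun z => star (groupSymbol t z)) (groupSymbol t) R]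
    conv_rhs => rw [← cfc_id' ℂ R, ← cfc_star, ← cfc_mul (fun z : ℂ => star z) (fun z => z) R]
    refine cfc_congr fun z hz => ?_
    simp only [RCLike.star_def, ← Complex.normSq_eq_conj_mul_self, Complex.normSq_eq_norm_sq,
      norm_groupSymbol (hR.spectrum_subset hz)]
  have h : ∀ T : H →L[ℂ] H, (inner ℂ u ((star T * T) u)).re = ‖T u‖ ^ 2 := fun T => by
    rw [ContinuousLinearMap.star_eq_adjoint]
    change (inner ℂ u (ContinuousLinearMap.adjoint T (T u))).re = _
    rw [ContinuousLinearMap.adjoint_inner_right, inner_self_eq_norm_sq_to_K]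
    change ((‖T u‖ : ℂ) ^ 2).re = _
    rw [← Complex.ofReal_pow, Complex.ofReal_re]
  have := h (groupRes R t)
  rw [e, h R] at this
  exact ((pow_left_inj₀ (norm_nonneg _) (norm_nonneg _) two_ne_zero).1 this).symm

/-- The operator `exp (t A)`. -/
def _root_.groupOp (R : H →L[ℂ] H) (t : ℝ) : H →L[ℂ] H :=
  (groupRes R t : H →ₗ[ℂ] H).extendOfNorm (R : H →ₗ[ℂ] H)

theorem groupOp_apply (hR : IsSkewResolvent R) (t : ℝ) (u : H) :
    groupOp R t (R u) = groupRes R t u :=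
  LinearMap.extendOfNorm_eq (f := (groupRes R t : H →ₗ[ℂ] H)) (e := (R : H →ₗ[ℂ] H)) hR.denseRange
    ⟨1, fun x => by rw [one_mul]; exact (hR.norm_groupRes_apply t x).le⟩ u

theorem eq_of_comp_eq (hR : IsSkewResolvent R) {S T : H →L[ℂ] H} (h : ∀ u, S (R u) = T (R u))
    (u : H) : S u = T u :=
  congrFun (hR.denseRange.equalizer S.continuous T.continuous (funext h)) u

theorem norm_groupOp_apply (hR : IsSkewResolvent R) (t : ℝ) (u : H) : ‖groupOp R t u‖ = ‖u‖ := by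
  have := hR.denseRange.equalizer (groupOp R t).continuous.norm continuous_norm
    (funext fun u => by simp only [Function.comp_apply, hR.groupOp_apply, hR.norm_groupRes_apply])
  exact congrFun this u

theorem groupRes_comm (hR : IsSkewResolvent R) (t : ℝ) (u : H) :
    groupRes R t (R u) = R (groupRes R t u) :=
  congrArg (fun T : H →L[ℂ] H => T u) (hR.cfc_mul_comm_self (hR.continuousOn_groupSymbol t))

theorem groupRes_groupRes (hR : IsSkewResolvent R) (s t : ℝ) (u : H) :
    groupRes R s (groupRes R t u) = groupRes R (s + t) (R u) := by
  have hn := hR.isStarNormal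
  have hs := hR.continuousOn_groupSymbol s
  have ht := hR.continuousOn_groupSymbol t
  have e : groupRes R s * groupRes R t = groupRes R (s + t) * R := by
    rw [groupRes, groupRes, groupRes, ← hR.cfc_mul_self (hR.continuousOn_groupSymbol _),
      ← cfc_mul (groupSymbol s) (groupSymbol t) R]
    simp only [groupSymbol_mul]
  exact congrArg (fun T : H →L[ℂ] H => T u) e

theorem groupOp_comm (hR : IsSkewResolvent R) (t : ℝ) (u : H) :
    groupOp R t (R u) = R (groupOp R t u) :=
  hR.eq_of_comp_eq (S := groupOp R t * R) (T := R * groupOp R t) (fun u => by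
    change groupOp R t (R (R u)) = R (groupOp R t (R u))
    rw [hR.groupOp_apply, hR.groupOp_apply, hR.groupRes_comm]) u

theorem groupOp_add (hR : IsSkewResolvent R) (s t : ℝ) (u : H) :
    groupOp R (s + t) u = groupOp R s (groupOp R t u) :=
  hR.eq_of_comp_eq (S := groupOp R (s + t)) (T := groupOp R s * groupOp R t) (fun u =>
    hR.eq_of_comp_eq (S := groupOp R (s + t) * R) (T := groupOp R s * groupOp R t * R) (fun u => by
      change groupOp R (s + t) (R (R u)) = groupOp R s (groupOp R t (R (R u)))
      rw [hR.groupOp_apply, hR.groupOp_apply, hR.groupRes_comm t, hR.groupOp_apply,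
        hR.groupRes_groupRes]) u) u

theorem groupOp_zero (hR : IsSkewResolvent R) (u : H) : groupOp R 0 u = u :=
  hR.eq_of_comp_eq (T := 1) (fun u => by
    have hn := hR.isStarNormal
    rw [hR.groupOp_apply, groupRes, funext groupSymbol_zero, cfc_id' ℂ R]
    rfl) u

/-- The unitary operator `exp (t A)`. -/
def unitary (hR : IsSkewResolvent R) (t : ℝ) : H ≃ₗᵢ[ℂ] H where
  toLinearEquiv := LinearEquiv.ofLinearMap (groupOp R t : H →ₗ[ℂ] H) (groupOp R (-t) : H →ₗ[ℂ] H)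
    (LinearMap.ext fun u => by
      change groupOp R t (groupOp R (-t) u) = u
      rw [← hR.groupOp_add, add_neg_cancel, hR.groupOp_zero])
    (LinearMap.ext fun u => by
      change groupOp R (-t) (groupOp R t u) = u
      rw [← hR.groupOp_add, neg_add_cancel, hR.groupOp_zero])
  norm_map' := hR.norm_groupOp_apply t

/-- The operator `(exp (t A) (1 + A)⁻¹ - (1 + A)⁻¹) / t - A (1 + A)⁻¹`. -/
def _root_.quotOp (R : H →L[ℂ] H) (t : ℝ) : H →L[ℂ] H := cfc (quotSymbol t) R

theorem continuousOn_quotSymbol (hR : IsSkewResolvent R) (t : ℝ) :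
    ContinuousOn (quotSymbol t) (spectrum ℂ R) := by
  have := hR.continuousOn_groupSymbol t
  unfold quotSymbol
  fun_prop

theorem quotOp_apply (hR : IsSkewResolvent R) (t : ℝ) (u : H) :
    quotOp R t u = t⁻¹ • (groupOp R t (R u) - R u) - (u - R u) := by
  have hn := hR.isStarNormal
  have hc := hR.continuousOn_groupSymbol t
  have e : quotOp R t = (t : ℂ)⁻¹ • (groupRes R t - R) - (1 - R) := by
    rw [quotOp, show quotSymbol t = fun z => (t : ℂ)⁻¹ • (groupSymbol t z - z) - (1 - z) from rfl,
      cfc_sub (fun z => (t : ℂ)⁻¹ • (groupSymbol t z - z)) (fun z => 1 - z) R,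
      cfc_smul (t : ℂ)⁻¹ (fun z => groupSymbol t z - z) R,
      cfc_sub (groupSymbol t) (fun z => z) R, cfc_sub (fun _ => 1) (fun z => z) R, cfc_id' ℂ R,
      cfc_const_one ℂ R, groupRes]
  rw [e, hR.groupOp_apply, ← Complex.ofReal_inv]
  change ((t⁻¹ : ℝ) : ℂ) • (groupRes R t u - R u) - (u - R u) = _
  rw [Complex.coe_smul]

theorem hasDerivAt_groupOp_zero (hR : IsSkewResolvent R) (u : H) :
    HasDerivAt (fun t => groupOp R t (R u)) (u - R u) 0 := by
  have hmem : ∀ᶠ t : ℝ in 𝓝[≠] 0, t ≠ 0 := self_mem_nhdsWithin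
  rw [hasDerivAt_iff_tendsto_slope_zero]
  have h := tendsto_apply_of_denseRange hR.denseRange (l := 𝓝[≠] 0) (L := quotOp R) (C := 2) (by
    filter_upwards [hmem] with t ht
    exact norm_cfc_le (by norm_num) fun z hz => norm_quotSymbol_le (hR.spectrum_subset hz) ht)
    (fun u => by
      have hb : ∀ᶠ t : ℝ in 𝓝[≠] 0, ‖quotOp R t (R u)‖ ≤ 2 * |t| * ‖u‖ := by
        filter_upwards [hmem] with t ht
        have e : quotOp R t * R = cfc (fun z => quotSymbol t z * z) R :=
          (hR.cfc_mul_self (hR.continuousOn_quotSymbol t)).symm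
        change ‖(quotOp R t * R) u‖ ≤ _
        rw [e]
        exact ContinuousLinearMap.le_of_opNorm_le _ (norm_cfc_le (by positivity) fun z hz =>
          norm_quotSymbol_mul_le (hR.spectrum_subset hz) ht) u
      refine squeeze_zero_norm' hb ?_
      have : Continuous fun t : ℝ => 2 * |t| * ‖u‖ := by fun_prop
      have h0 := (this.tendsto 0).mono_left (nhdsWithin_le_nhds (s := {0}ᶜ))
      simpa using h0) u
  simp only [hR.quotOp_apply] at h
  have h2 := h.add_const (u - R u)
  simpa only [sub_add_cancel, zero_add, hR.groupOp_zero] using h2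

theorem continuous_groupOp (hR : IsSkewResolvent R) (u : H) :
    Continuous fun t => groupOp R t u := by
  have h0 : Tendsto (fun t => (groupOp R t - 1) u) (𝓝 0) (𝓝 0) := by
    refine tendsto_apply_of_denseRange hR.denseRange (C := 2) (.of_forall fun t => ?_)
      (fun u => ?_) u
    · refine ContinuousLinearMap.opNorm_le_bound _ (by norm_num) fun u => ?_
      refine (norm_sub_le _ _).trans ?_
      change ‖groupOp R t u‖ + ‖u‖ ≤ 2 * ‖u‖
      rw [hR.norm_groupOp_apply, two_mul]
    · have h := (hR.hasDerivAt_groupOp_zero u).continuousAt.tendsto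
      rw [hR.groupOp_zero] at h
      have h2 := h.sub_const (R u)
      rwa [sub_self] at h2
  rw [continuous_iff_continuousAt]
  intro t
  rw [ContinuousAt, tendsto_iff_norm_sub_tendsto_zero]
  have h1 : Tendsto (fun s : ℝ => s - t) (𝓝 t) (𝓝 0) := by
    have : Continuous fun s : ℝ => s - t := by fun_prop
    simpa using this.tendsto t
  refine (h0.comp h1).norm.congr (fun s => ?_) |>.trans (by simp)
  rw [← hR.norm_groupOp_apply t]
  congr 1
  change groupOp R t (groupOp R (s - t) u - u) = _
  rw [map_sub, ← hR.groupOp_add, add_sub_cancel]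

/-- The resolvent `(lam + A)⁻¹`. -/
def _root_.resOp (R : H →L[ℂ] H) (lam : ℂ) : H →L[ℂ] H := cfc (resSymbol lam) R

theorem continuousOn_resSymbol (hR : IsSkewResolvent R) {lam : ℂ} (hlam : 0 < lam.re) :
    ContinuousOn (resSymbol lam) (spectrum ℂ R) :=
  _root_.continuousOn_resSymbol hR.spectrum_subset hlam

theorem resOp_comm (hR : IsSkewResolvent R) {lam : ℂ} (hlam : 0 < lam.re) (u : H) :
    resOp R lam (R u) = R (resOp R lam u) :=
  congrArg (fun T : H →L[ℂ] H => T u) (hR.cfc_mul_comm_self (hR.continuousOn_resSymbol hlam))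

theorem resOp_eq (hR : IsSkewResolvent R) {lam : ℂ} (hlam : 0 < lam.re) (u : H) :
    resOp R lam u = R (u + (1 - lam) • resOp R lam u) := by
  have hn := hR.isStarNormal
  have hc := hR.continuousOn_resSymbol hlam
  have e : resOp R lam = R + (1 - lam) • (resOp R lam * R) := by
    rw [resOp, ← hR.cfc_mul_self hc]
    conv_rhs => rw [← cfc_smul (1 - lam) (fun z => resSymbol lam z * z) R]
    nth_rw 2 [← cfc_id' ℂ R]
    rw [← cfc_add R (fun z => z) (fun z => (1 - lam) • (resSymbol lam z * z))]
    refine cfc_congr fun z hz => ?_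
    have h := div_mul_cancel₀ z (resSymbol_denom_ne_zero (hR.spectrum_subset hz) hlam)
    rw [← resSymbol] at h
    rw [smul_eq_mul]
    linear_combination h
  have h := congrArg (fun T : H →L[ℂ] H => T u) e
  change resOp R lam u = R u + (1 - lam) • resOp R lam (R u) at h
  rwa [hR.resOp_comm hlam, ← map_smul, ← map_add] at h

theorem norm_resOp_le (hR : IsSkewResolvent R) {lam : ℂ} (hlam : 0 < lam.re) :
    ‖resOp R lam‖ ≤ lam.re⁻¹ :=
  norm_cfc_le (by positivity) fun _ hz => norm_resSymbol_le (hR.spectrum_subset hz) hlam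

theorem resOp_sub (hR : IsSkewResolvent R) {lam μ : ℂ} (hlam : 0 < lam.re) (hμ : 0 < μ.re) :
    resOp R lam - resOp R μ = (μ - lam) • (resOp R lam * resOp R μ) := by
  have hn := hR.isStarNormal
  have h1 := hR.continuousOn_resSymbol hlam
  have h2 := hR.continuousOn_resSymbol hμ
  rw [resOp, resOp, ← cfc_sub (resSymbol lam) (resSymbol μ) R,
    ← cfc_mul (resSymbol lam) (resSymbol μ) R,
    ← cfc_smul (μ - lam) (fun z => resSymbol lam z * resSymbol μ z) R]
  refine cfc_congr fun z hz => ?_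
  have d1 := resSymbol_denom_ne_zero (hR.spectrum_subset hz) hlam
  have d2 := resSymbol_denom_ne_zero (hR.spectrum_subset hz) hμ
  rw [resSymbol, resSymbol, smul_eq_mul, div_sub_div _ _ d1 d2, div_mul_div_comm, ← mul_div_assoc]
  ring

theorem continuous_resOp_line (hR : IsSkewResolvent R) {r : ℝ} (hr : 0 < r) :
    Continuous fun s : ℝ => resOp R (r + s * Complex.I) := by
  have hre : ∀ s : ℝ, 0 < ((r : ℂ) + s * Complex.I).re := fun s => by simpa using hr
  have hb : ∀ s : ℝ, ‖resOp R (r + s * Complex.I)‖ ≤ r⁻¹ := fun s => by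
    simpa using hR.norm_resOp_le (hre s)
  refine (LipschitzWith.of_dist_le_mul (K := (r⁻¹ * r⁻¹).toNNReal) fun s s' => ?_).continuous
  rw [dist_eq_norm, hR.resOp_sub (hre s) (hre s'), norm_smul, mul_comm,
    Real.coe_toNNReal _ (by positivity)]
  have e : ‖(r : ℂ) + s' * Complex.I - (r + s * Complex.I)‖ = dist s s' := by
    rw [add_sub_add_left_eq_sub, ← sub_mul, norm_mul, Complex.norm_I, mul_one,
      ← Complex.ofReal_sub, Complex.norm_real, dist_comm, Real.dist_eq, Real.norm_eq_abs]
  rw [e]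
  refine mul_le_mul_of_nonneg_right ((norm_mul_le _ _).trans ?_) dist_nonneg
  exact mul_le_mul (hb s) (hb s') (norm_nonneg _) (by positivity)

/-- The truncated Bromwich integral of the resolvent. -/
def _root_.bromOp (R : H →L[ℂ] H) (t r N : ℝ) : H →L[ℂ] H := cfc (bromSymbol t r N) R

theorem continuousOn_bromIntegrand (hR : IsSkewResolvent R) {r : ℝ} (hr : 0 < r) (t : ℝ)
    (S : Set ℝ) : ContinuousOn (Function.uncurry fun (s : ℝ) (z : ℂ) =>
      Complex.exp (((r : ℂ) + s * Complex.I) * t) * resSymbol (r + s * Complex.I) z)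
      (S ×ˢ spectrum ℂ R) := by
  refine ContinuousOn.mul (by fun_prop) (ContinuousOn.div (by fun_prop) (by fun_prop) ?_)
  rintro ⟨s, z⟩ ⟨_, hz⟩
  exact resSymbol_denom_ne_zero (hR.spectrum_subset hz) (by simpa using hr)

theorem norm_bromIntegrand_le (hR : IsSkewResolvent R) {r : ℝ} (hr : 0 < r) (t s : ℝ) :
    ∀ z ∈ spectrum ℂ R, ‖Complex.exp (((r : ℂ) + s * Complex.I) * t)
      * resSymbol (r + s * Complex.I) z‖ ≤ Real.exp (r * t) * r⁻¹ := fun z hz => by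
  rw [norm_mul, norm_exp_line]
  refine mul_le_mul_of_nonneg_left ?_ (Real.exp_pos _).le
  simpa using norm_resSymbol_le (hR.spectrum_subset hz) (lam := r + s * Complex.I)
    (by simpa using hr)

theorem bromOp_eq (hR : IsSkewResolvent R) {r N : ℝ} (hr : 0 < r) (hN : 0 ≤ N) (t : ℝ) :
    bromOp R t r N = ∫ s in (-N)..N,
      Complex.exp (((r : ℂ) + s * Complex.I) * t) • resOp R (r + s * Complex.I) := by
  have hn := hR.isStarNormal
  have hle : -N ≤ N := by linarith
  rw [bromOp, funext fun z => show bromSymbol t r N z = _ from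
    intervalIntegral.integral_of_le hle, intervalIntegral.integral_of_le hle,
    cfc_setIntegral measurableSet_Ioc _ (fun _ => Real.exp (r * t) * r⁻¹) R
      (hR.continuousOn_bromIntegrand hr t _)
      (.of_forall fun s => hR.norm_bromIntegrand_le hr t s)
      (integrable_const _).hasFiniteIntegral]
  refine integral_congr_ae (.of_forall fun s => ?_)
  have hc := hR.continuousOn_resSymbol (lam := r + s * Complex.I) (by simpa using hr)
  exact cfc_smul (Complex.exp (((r : ℂ) + s * Complex.I) * t)) (resSymbol (r + s * Complex.I)) R

theorem continuousOn_bromSymbol (hR : IsSkewResolvent R) {r : ℝ} (hr : 0 < r) (t N : ℝ) :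
    ContinuousOn (bromSymbol t r N) (spectrum ℂ R) := by
  unfold bromSymbol
  refine fun z₀ hz₀ => intervalIntegral.continuousWithinAt_of_dominated_interval
    (bound := fun _ => Real.exp (r * t) * r⁻¹) ?_ ?_ intervalIntegrable_const ?_
  · filter_upwards [self_mem_nhdsWithin] with z hz
    refine ContinuousOn.aestronglyMeasurable ?_ measurableSet_uIoc
    exact (hR.continuousOn_bromIntegrand hr t (uIoc (-N) N)).comp (f := fun s : ℝ => (s, z))
      (by fun_prop) fun s hs => ⟨hs, hz⟩
  · filter_upwards [self_mem_nhdsWithin] with z hz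
    exact .of_forall fun s _ => hR.norm_bromIntegrand_le hr t s z hz
  · refine .of_forall fun s _ => ?_
    exact continuousWithinAt_const.mul
      (hR.continuousOn_resSymbol (lam := r + s * Complex.I) (by simpa using hr) z₀ hz₀)

/-- The Bromwich inversion formula in the strong operator topology. -/
theorem tendsto_bromOp (hR : IsSkewResolvent R) {t r : ℝ} (hr : 0 < r) (ht : 0 < t) (u : H) :
    Tendsto (fun N => (2 * Real.pi : ℂ)⁻¹ • bromOp R t r N u) atTop (𝓝 (groupOp R (-t) u)) := by
  have hn := hR.isStarNormal
  obtain ⟨C, hC, h1⟩ := exists_norm_bromSymbol_le hr ht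
  obtain ⟨C', h2⟩ := exists_norm_bromSymbol_sub_le hr ht
  have hW : ‖groupOp R (-t)‖ ≤ 1 := ContinuousLinearMap.opNorm_le_bound _ zero_le_one fun u => by
    rw [hR.norm_groupOp_apply, one_mul]
  have hpi : ‖(2 * Real.pi : ℂ)‖ = 2 * Real.pi := by
    rw [norm_mul, Complex.norm_real, Real.norm_of_nonneg Real.pi_pos.le]; simp
  have hpi0 : (2 * Real.pi : ℂ) ≠ 0 := by
    rw [← norm_pos_iff, hpi]; positivity
  have h := tendsto_apply_of_denseRange hR.denseRange (l := atTop)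
    (L := fun N => bromOp R t r N - (2 * Real.pi : ℂ) • groupOp R (-t)) (C := C + 2 * Real.pi * 1)
    (.of_forall fun N => by
      refine (norm_sub_le _ _).trans (add_le_add ?_ ?_)
      · exact norm_cfc_le hC.le fun z hz => h1 N z (hR.spectrum_subset hz)
      · rw [norm_smul, hpi]
        exact mul_le_mul_of_nonneg_left hW (by positivity))
    (fun u => by
      have hb : ∀ᶠ N : ℝ in atTop, ‖(bromOp R t r N - (2 * Real.pi : ℂ) • groupOp R (-t)) (R u)‖
          ≤ |C'| * N⁻¹ * ‖u‖ := by
        filter_upwards [eventually_gt_atTop 0] with N hN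
        have hcg := hR.continuousOn_groupSymbol (-t)
        have hcb := hR.continuousOn_bromSymbol hr t N
        have e : (bromOp R t r N - (2 * Real.pi : ℂ) • groupOp R (-t)) (R u) =
            cfc (fun z => bromSymbol t r N z * z - (2 * Real.pi : ℂ) • groupSymbol (-t) z) R u := by
          rw [cfc_sub (fun z => bromSymbol t r N z * z) (fun z => (2 * Real.pi : ℂ) •
            groupSymbol (-t) z) R, cfc_smul (2 * Real.pi : ℂ) (groupSymbol (-t)) R,
            hR.cfc_mul_self hcb]
          change _ - (2 * Real.pi : ℂ) • groupOp R (-t) (R u) = _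
          rw [hR.groupOp_apply]
          rfl
        rw [e]
        refine ContinuousLinearMap.le_of_opNorm_le _ (norm_cfc_le (by positivity) fun z hz => ?_) u
        exact (h2 N hN z (hR.spectrum_subset hz)).trans
          (mul_le_mul_of_nonneg_right (le_abs_self _) (by positivity))
      refine squeeze_zero_norm' hb ?_
      have := (tendsto_inv_atTop_zero (𝕜 := ℝ)).const_mul |C'| |>.mul_const ‖u‖
      simpa using this) u
  have h3 := (h.const_smul (2 * Real.pi : ℂ)⁻¹).add_const (groupOp R (-t) u)
  rw [smul_zero, zero_add] at h3
  refine h3.congr fun N => ?_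
  change (2 * Real.pi : ℂ)⁻¹ • (bromOp R t r N u - (2 * Real.pi : ℂ) • groupOp R (-t) u) + _ = _
  rw [smul_sub, inv_smul_smul₀ hpi0, sub_add_cancel]

theorem continuous_resOp_line_apply (hR : IsSkewResolvent R) {r : ℝ} (hr : 0 < r) (u : H) :
    Continuous fun s : ℝ => resOp R (r + s * Complex.I) u :=
  (hR.continuous_resOp_line hr).clm_apply continuous_const

theorem bromOp_apply (hR : IsSkewResolvent R) {r N : ℝ} (hr : 0 < r) (hN : 0 ≤ N) (t : ℝ) (u : H) :
    bromOp R t r N u = ∫ s in (-N)..N,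
      Complex.exp (((r : ℂ) + s * Complex.I) * t) • resOp R (r + s * Complex.I) u := by
  have hc := hR.continuous_resOp_line hr
  rw [hR.bromOp_eq hr hN, ContinuousLinearMap.intervalIntegral_apply]
  · rfl
  · exact ((by fun_prop : Continuous fun s : ℝ =>
      Complex.exp (((r : ℂ) + s * Complex.I) * t)).smul hc).intervalIntegrable _ _

theorem bromOp_comm (hR : IsSkewResolvent R) {r : ℝ} (hr : 0 < r) (t N : ℝ) (u : H) :
    bromOp R t r N (R u) = R (bromOp R t r N u) :=
  congrArg (fun T : H →L[ℂ] H => T u) (hR.cfc_mul_comm_self (hR.continuousOn_bromSymbol hr t N))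

end IsSkewResolvent


/-- A differentiable curve solves the abstract Airy equation `x' = A_Z x`. -/
def IsAirySolution (Z : ℝ) (x : ℝ → L2G) : Prop :=
  ∀ t, ∃ f, HasDerivAt x f t ∧ (x t, f) ∈ airyGraph Z

theorem IsAirySolution.eq {Z : ℝ} {x y : ℝ → L2G} (hx : IsAirySolution Z x)
    (hy : IsAirySolution Z y) (h0 : x 0 = y 0) (t : ℝ) : x t = y t := by
  have hd : ∀ t, HasDerivAt (fun s => inner ℂ (x s - y s) (x s - y s)) 0 t := fun t => by
    obtain ⟨f, hf, hfm⟩ := hx t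
    obtain ⟨g, hg, hgm⟩ := hy t
    have h := airyGraph_sub hfm hgm
    have hi := (hf.sub hg).inner ℂ (hf.sub hg)
    rwa [add_comm, show inner ℂ (f - g) ((x - y) t) + inner ℂ ((x - y) t) (f - g) = (0 : ℂ) from
      airyGraph_skew h h] at hi
  have hc := is_const_of_deriv_eq_zero (fun t => (hd t).differentiableAt)
    (fun t => (hd t).deriv) t 0
  rw [h0, sub_self, inner_zero_left, inner_self_eq_zero, sub_eq_zero] at hc
  exact hc

theorem IsUnitaryGroup.hasDerivAt {W : ℝ → (L2G ≃ₗᵢ[ℂ] L2G)} (hW : IsUnitaryGroup W) {u f : L2G}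
    (h : (u, f) ∈ generatorGraph W) (t : ℝ) : HasDerivAt (fun s => W s u) (W t f) t := by
  have h1 : HasDerivAt (fun s => W (s - t) u) f t :=
    HasDerivAt.comp_sub_const t t (by rw [sub_self]; exact h)
  have h2 := (((W t).toContinuousLinearEquiv : L2G →L[ℂ] L2G).restrictScalars ℝ).hasFDerivAt
    |>.comp_hasDerivAt t h1
  refine h2.congr_of_eventuallyEq (.of_forall fun s => ?_)
  change W s u = W t (W (s - t) u)
  rw [← hW.add, add_sub_cancel]

theorem IsUnitaryGroup.mem_generatorGraph {W : ℝ → (L2G ≃ₗᵢ[ℂ] L2G)} (hW : IsUnitaryGroup W)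
    {u f : L2G} (h : (u, f) ∈ generatorGraph W) (t : ℝ) : (W t u, W t f) ∈ generatorGraph W := by
  have h1 : HasDerivAt (fun s => W (s + t) u) (W t f) 0 :=
    HasDerivAt.comp_add_const 0 t (by rw [zero_add]; exact hW.hasDerivAt h t)
  exact h1.congr_of_eventuallyEq (.of_forall fun s => (hW.add s t u).symm)

theorem IsUnitaryGroup.isAirySolution {Z : ℝ} {W : ℝ → (L2G ≃ₗᵢ[ℂ] L2G)} (hW : IsUnitaryGroup W)
    (hg : generatorGraph W = airyGraph Z) {u f : L2G} (h : (u, f) ∈ airyGraph Z) :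
    IsAirySolution Z fun t => W t u := fun t => by
  rw [← hg] at h ⊢
  exact ⟨_, hW.hasDerivAt h t, hW.mem_generatorGraph h t⟩

theorem eq_of_eqOn_airyDomain {Z : ℝ} {f g : L2G → L2G} (hf : Continuous f) (hg : Continuous g)
    (h : ∀ u v, (u, v) ∈ airyGraph Z → f u = g u) (u : L2G) : f u = g u :=
  congrFun ((isSkewResolvent_airyRes Z).denseRange.equalizer hf hg
    (funext fun u => h _ _ (airyRes_mem Z u))) u

theorem IsUnitaryGroup.eq {Z : ℝ} {W W' : ℝ → (L2G ≃ₗᵢ[ℂ] L2G)} (hW : IsUnitaryGroup W)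
    (hW' : IsUnitaryGroup W') (hg : generatorGraph W = airyGraph Z)
    (hg' : generatorGraph W' = airyGraph Z) : W = W' := by
  funext t
  ext1 u
  refine eq_of_eqOn_airyDomain (Z := Z) (W t).continuous (W' t).continuous (fun u f h => ?_) u
  exact (hW.isAirySolution hg h).eq (hW'.isAirySolution hg' h) (by rw [hW.zero, hW'.zero]) t

/-- The unitary group generated by `A_Z`. -/
def airyGroup (Z : ℝ) : ℝ → (L2G ≃ₗᵢ[ℂ] L2G) := (isSkewResolvent_airyRes Z).unitary

theorem isUnitaryGroup_airyGroup (Z : ℝ) : IsUnitaryGroup (airyGroup Z) where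
  zero := (isSkewResolvent_airyRes Z).groupOp_zero
  add := (isSkewResolvent_airyRes Z).groupOp_add
  continuous := (isSkewResolvent_airyRes Z).continuous_groupOp

theorem generatorGraph_airyGroup (Z : ℝ) : generatorGraph (airyGroup Z) = airyGraph Z := by
  have hR := isSkewResolvent_airyRes Z
  ext ⟨u, f⟩
  rw [mem_airyGraph_iff]
  refine ⟨fun h => ?_, fun h => ?_⟩
  · have h1 : HasDerivAt (fun t => airyRes Z (groupOp (airyRes Z) t u)) (airyRes Z f) 0 :=
      ((airyRes Z).restrictScalars ℝ).hasFDerivAt.comp_hasDerivAt (0 : ℝ) h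
    simp only [← hR.groupOp_comm] at h1
    rw [map_add, h1.unique (hR.hasDerivAt_groupOp_zero u), add_sub_cancel]
  · have h1 := hR.hasDerivAt_groupOp_zero (u + f)
    rw [← h, add_sub_cancel_left] at h1
    exact h1

/-- The reflection intertwines the group with its time reversal. -/
theorem reflect_airyGroup_neg (Z t : ℝ) (u : L2G) :
    reflect (airyGroup Z (-t) (reflect u)) = airyGroup Z t u := by
  have hW := isUnitaryGroup_airyGroup Z
  have hg := generatorGraph_airyGroup Z
  refine eq_of_eqOn_airyDomain (Z := Z) (f := fun u => reflect (airyGroup Z (-t) (reflect u)))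
    (reflect.continuous.comp ((airyGroup Z (-t)).continuous.comp reflect.continuous))
    (airyGroup Z t).continuous (fun u f h => ?_) u
  refine IsAirySolution.eq (x := fun t => reflect (airyGroup Z (-t) (reflect u)))
    (fun t => ?_) (hW.isAirySolution hg h) (by simp only [neg_zero, hW.zero, reflect_reflect]) t
  obtain ⟨g, hd, hm⟩ := hW.isAirySolution hg (reflect_mem_airyGraph h) (-t)
  refine ⟨-reflect g, ?_, reflect_mem_airyGraph hm⟩
  have h2 : HasDerivAt (fun t => airyGroup Z (-t) (reflect u)) (-g) t := by
    have := HasDerivAt.scomp t hd (hasDerivAt_neg t)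
    rw [neg_one_smul] at this
    exact this
  have h3 := ((reflect.toContinuousLinearEquiv : L2G →L[ℂ] L2G).restrictScalars ℝ).hasFDerivAt
    |>.comp_hasDerivAt t h2
  rw [map_neg] at h3
  exact h3

/-- The continuous functional calculus yields the resolvents of `A_Z`. -/
theorem eq_resOp_of_mem_airyGraph {Z : ℝ} {lam : ℂ} (hlam : 0 < lam.re) {ω v : L2G}
    (hv : (v, ω - lam • v) ∈ airyGraph Z) : v = resOp (airyRes Z) lam ω := by
  refine eq_of_mem_airyGraph hlam hv (mem_airyGraph_iff.2 ?_)
  conv_lhs => rw [(isSkewResolvent_airyRes Z).resOp_eq hlam]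
  congr 1
  module


/-- Integration over an oriented interval, as a functional on `L²`. -/
def intervalFunctional (μ : Measure ℝ) [IsLocallyFiniteMeasure μ] (x y : ℝ) :
    Lp ℂ 2 μ →L[ℂ] ℂ :=
  innerSL ℂ (indicatorConstLp 2 (measurableSet_Ioc (a := x) (b := y)) measure_Ioc_lt_top.ne 1) -
    innerSL ℂ (indicatorConstLp 2 (measurableSet_Ioc (a := y) (b := x)) measure_Ioc_lt_top.ne 1)

theorem intervalFunctional_apply (μ : Measure ℝ) [IsLocallyFiniteMeasure μ] (x y : ℝ)
    (f : Lp ℂ 2 μ) : intervalFunctional μ x y f = ∫ t in x..y, f t ∂μ := by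
  rw [intervalFunctional, sub_apply, innerSL_apply_apply, innerSL_apply_apply,
    L2.inner_indicatorConstLp_one, L2.inner_indicatorConstLp_one, intervalIntegral]

/-- An interval of the line, closed and with nonempty interior, with a continuous retraction. -/
structure IsRetract (S : Set ℝ) (ρ : ℝ → ℝ) : Prop where
  ordConnected : S.OrdConnected
  nontrivial : S.Nontrivial
  continuous : Continuous ρ
  mem : ∀ x, ρ x ∈ S
  eq : ∀ x ∈ S, ρ x = x

theorem isRetract_Iic : IsRetract (Iic 0) fun x => min x 0 where
  ordConnected := ordConnected_Iic
  nontrivial := ⟨0, by simp, -1, by simp, by norm_num⟩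
  continuous := by fun_prop
  mem := by simp
  eq _ hx := min_eq_left hx

theorem isRetract_Ici : IsRetract (Ici 0) fun x => max x 0 where
  ordConnected := ordConnected_Ici
  nontrivial := ⟨0, by simp, 1, by simp, by norm_num⟩
  continuous := by fun_prop
  mem := by simp
  eq _ hx := max_eq_left hx

section

variable {S : Set ℝ} {ρ : ℝ → ℝ} {μ : Measure ℝ}

theorem tendsto_intervalFunctional (hS : IsRetract S ρ) [IsLocallyFiniteMeasure μ]
    (hμ : μ = volume.restrict S) {f : Lp ℂ 2 μ} {c : ℝ → ℂ} (hc : ContinuousOn c S)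
    (hf : f =ᵐ[μ] c) {x : ℝ} (hx : x ∈ S) :
    Tendsto (fun y : ℝ => ((y - x : ℝ) : ℂ)⁻¹ • intervalFunctional μ x y f) (𝓝[≠] x ⊓ 𝓟 S)
      (𝓝 (c x)) := by
  have hcρ : Continuous fun y => c (ρ y) := hc.comp_continuous hS.continuous hS.mem
  have hm : MeasurableSet S := hS.ordConnected.measurableSet
  have hd := intervalIntegral.integral_hasDerivAt_right (hcρ.intervalIntegrable x x)
    (hcρ.stronglyMeasurableAtFilter _ _) hcρ.continuousAt
  rw [hasDerivAt_iff_tendsto_slope, hS.eq x hx] at hd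
  refine (hd.mono_left inf_le_left).congr' ?_
  filter_upwards [mem_inf_of_right (mem_principal_self S)] with y hy
  have hsub : uIoc x y ⊆ S := uIoc_subset_uIcc.trans (hS.ordConnected.uIcc_subset hx hy)
  rw [slope_def_module, intervalIntegral.integral_same, sub_zero, intervalFunctional_apply,
    ← Complex.ofReal_inv, Complex.coe_smul]
  congr 1
  rw [intervalIntegral.intervalIntegral_eq_integral_uIoc,
    intervalIntegral.intervalIntegral_eq_integral_uIoc]
  congr 1
  rw [show μ.restrict (uIoc x y) = volume.restrict (uIoc x y) by
    rw [hμ, Measure.restrict_restrict measurableSet_uIoc, inter_eq_self_of_subset_left hsub]]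
  have hle : ae (volume.restrict S) ≤ ae μ := by rw [hμ]
  refine integral_congr_ae ?_
  filter_upwards [ae_restrict_of_ae_restrict_of_subset hsub (hle hf),
    ae_restrict_mem measurableSet_uIoc]
    with t ht hts
  rw [hS.eq t (hsub hts)]
  exact ht.symm

/-- Point evaluations of the continuous representatives of the elements of the range of a bounded
operator are bounded functionals. -/
theorem exists_evaluation (hS : IsRetract S ρ) (hμ : μ = volume.restrict S) {E : Type*}
    [NormedAddCommGroup E] [NormedSpace ℂ E] [CompleteSpace E] (T : E →L[ℂ] Lp ℂ 2 μ)
    (hT : ∀ ψ, ∃ c, ContinuousOn c S ∧ T ψ =ᵐ[μ] c) :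
    ∃ e : ℝ → E →L[ℂ] ℂ, ∀ ψ c, ContinuousOn c S → T ψ =ᵐ[μ] c → ∀ x ∈ S, e x ψ = c x := by
  have : IsLocallyFiniteMeasure μ := by rw [hμ]; infer_instance
  suffices ∀ x, ∃ e : E →L[ℂ] ℂ, x ∈ S → ∀ ψ c, ContinuousOn c S → T ψ =ᵐ[μ] c → e ψ = c x by
    choose e he using this
    exact ⟨e, fun ψ c hc h x hx => he x hx ψ c hc h⟩
  intro x
  by_cases hx : x ∈ S
  · choose c hc h using hT
    have : (𝓝[≠] x ⊓ 𝓟 S).NeBot :=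
      hS.ordConnected.isPreconnected.preperfect_of_nontrivial hS.nontrivial x hx
    have ht : Tendsto (fun (y : ℝ) (ψ : E) =>
        (((y - x : ℝ) : ℂ)⁻¹ • (intervalFunctional μ x y ∘L T)) ψ) (𝓝[≠] x ⊓ 𝓟 S)
        (𝓝 fun ψ => c ψ x) :=
      tendsto_pi_nhds.2 fun ψ => tendsto_intervalFunctional hS hμ (hc ψ) (h ψ) hx
    refine ⟨continuousLinearMapOfTendsto _ ht, fun _ ψ c' hc' h' => ?_⟩
    exact tendsto_nhds_unique (tendsto_intervalFunctional hS hμ (hc ψ) (h ψ) hx)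
      (tendsto_intervalFunctional hS hμ hc' h' hx)
  · exact ⟨0, fun h => absurd h hx⟩

end

section

variable {H : Type*} [NormedAddCommGroup H] [InnerProductSpace ℂ H] [CompleteSpace H]
  {R : H →L[ℂ] H} {S : Set ℝ} {ρ : ℝ → ℝ} {μ : Measure ℝ} {F : ℂ → ℝ → ℂ} {t r : ℝ} {ω : H}

/-- The truncated Bromwich integral of `(1 + A) (lam + A)⁻¹`. -/
def bromSum (R : H →L[ℂ] H) (t r : ℝ) (ω : H) (N : ℝ) : H :=
  (2 * Real.pi : ℂ)⁻¹ • ∫ s in (-N)..N, Complex.exp (((r : ℂ) + s * Complex.I) * t) •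
    (ω + (1 - ((r : ℂ) + s * Complex.I)) • resOp R (r + s * Complex.I) ω)

theorem IsSkewResolvent.continuous_bromSum_integrand (hR : IsSkewResolvent R) (hr : 0 < r) (t : ℝ)
    (ω : H) : Continuous fun s : ℝ => Complex.exp (((r : ℂ) + s * Complex.I) * t) •
      (ω + (1 - ((r : ℂ) + s * Complex.I)) • resOp R (r + s * Complex.I) ω) := by
  have := hR.continuous_resOp_line_apply hr ω
  fun_prop

theorem IsSkewResolvent.apply_bromSum (hR : IsSkewResolvent R) (hr : 0 < r) (t : ℝ) (ω : H) {N : ℝ}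
    (hN : 0 ≤ N) : R (bromSum R t r ω N) = (2 * Real.pi : ℂ)⁻¹ • bromOp R t r N ω := by
  rw [bromSum, map_smul, hR.bromOp_apply hr hN, ← ContinuousLinearMap.intervalIntegral_comp_comm _
    ((hR.continuous_bromSum_integrand hr t ω).intervalIntegrable _ _)]
  congr 2
  funext s
  rw [map_smul, ← hR.resOp_eq (by simpa using hr)]

theorem IsSkewResolvent.bromSum_apply (hR : IsSkewResolvent R) (hr : 0 < r) (t : ℝ) (ψ : H) {N : ℝ}
    (hN : 0 ≤ N) : bromSum R t r (R ψ) N = (2 * Real.pi : ℂ)⁻¹ • bromOp R t r N ψ :=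
  hR.injective (by rw [hR.apply_bromSum hr t _ hN, hR.bromOp_comm hr, map_smul])

theorem IsSkewResolvent.bromwich_eq (hR : IsSkewResolvent R) (hr : 0 < r) {e : H →L[ℂ] ℂ}
    {f : ℂ → ℂ}
    (hf : ∀ lam : ℂ, 0 < lam.re → f lam = e (ω + (1 - lam) • resOp R lam ω)) (N : ℝ) :
    bromwich f t r N = e (bromSum R t r ω N) := by
  rw [bromwich, intervalIntegral.integral_mul_const, bromSum, map_smul, smul_eq_mul,
    ← ContinuousLinearMap.intervalIntegral_comp_comm _
      ((hR.continuous_bromSum_integrand hr t ω).intervalIntegrable _ _)]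
  simp only [map_smul, smul_eq_mul]
  rw [mul_inv _ Complex.I, mul_comm _ Complex.I, mul_assoc, inv_mul_cancel_left₀ Complex.I_ne_zero]
  congr 2
  funext s
  rw [hf _ (by simpa using hr)]

/-- The Bromwich inversion formula for the component `P` of the group, the functions `F lam` being
the continuous representatives of the components of the resolvents. -/
theorem IsSkewResolvent.isBromwich (hR : IsSkewResolvent R) (hS : IsRetract S ρ)
    (hμ : μ = volume.restrict S) (P : H →L[ℂ] Lp ℂ 2 μ)
    (hP : ∀ ψ, ∃ c, ContinuousOn c S ∧ P (R ψ) =ᵐ[μ] c)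
    (hF : ∀ lam : ℂ, 0 < lam.re → ContinuousOn (F lam) S ∧ P (resOp R lam ω) =ᵐ[μ] F lam)
    (ht : 0 < t) (hr : 0 < r) :
    IsBromwichL2 t r S F (P (groupOp R (-t) ω)) ∧
      (ω ∈ range R → IsBromwichPointwise t r S F (P (groupOp R (-t) ω))) := by
  obtain ⟨e, he⟩ := exists_evaluation hS hμ (P ∘L R) hP
  have hrep : ∀ ψ, ContinuousOn (fun x => e x ψ) S ∧ P (R ψ) =ᵐ[μ] fun x => e x ψ := fun ψ => by
    obtain ⟨c, hc, h⟩ := hP ψ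
    have hec := he ψ c hc h
    refine ⟨hc.congr hec, h.trans ?_⟩
    rw [hμ]
    filter_upwards [ae_restrict_mem hS.ordConnected.measurableSet] with x hx
    exact (hec x hx).symm
  have hFe : ∀ x ∈ S, ∀ lam : ℂ, 0 < lam.re → F lam x = e x (ω + (1 - lam) • resOp R lam ω) :=
    fun x hx lam hlam => by
      refine (he _ _ (hF lam hlam).1 ?_ x hx).symm
      change P (R _) =ᵐ[μ] _
      rw [← hR.resOp_eq hlam]
      exact (hF lam hlam).2
  have hb : ∀ x ∈ S, ∀ N, bromwich (fun lam => F lam x) t r N = e x (bromSum R t r ω N) :=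
    fun x hx N => hR.bromwich_eq hr (hFe x hx) N
  refine ⟨⟨fun x hx N => ?_, ?_⟩, ?_⟩
  · refine ((e x).continuous.comp
      (hR.continuous_bromSum_integrand hr t ω)).intervalIntegrable _ _ |>.congr ?_
    refine fun s _ => ?_
    simp only [Function.comp_apply, map_smul, smul_eq_mul]
    rw [hFe x hx _ (by simpa using hr)]
  · have h0 := ((hR.tendsto_bromOp hr ht ω).sub_const (groupOp R (-t) ω))
    rw [sub_self] at h0
    have h1 := ((continuous_enorm.comp P.continuous).tendsto 0).comp h0
    rw [Function.comp_apply, map_zero, enorm_zero] at h1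
    refine h1.congr' ?_
    filter_upwards [eventually_ge_atTop 0] with N hN
    change ‖P ((2 * Real.pi : ℂ)⁻¹ • bromOp R t r N ω - groupOp R (-t) ω)‖ₑ = _
    rw [Lp.enorm_def, ← hμ, ← hR.apply_bromSum hr t ω hN, map_sub]
    refine eLpNorm_congr_ae ?_
    have hmem : ∀ᵐ x ∂μ, x ∈ S := by
      rw [hμ]; exact ae_restrict_mem hS.ordConnected.measurableSet
    filter_upwards [Lp.coeFn_sub (P (R (bromSum R t r ω N))) (P (groupOp R (-t) ω)),
      (hrep (bromSum R t r ω N)).2, hmem] with x h1 h2 hx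
    rw [h1, Pi.sub_apply, h2, hb x hx]
  · rintro ⟨ψ, rfl⟩
    refine ⟨fun x => e x (groupOp R (-t) ψ), (hrep _).1, ?_, fun x hx => ?_⟩
    · rw [← hμ, hR.groupOp_comm]
      exact (hrep _).2
    · refine (((e x).continuous.tendsto _).comp (hR.tendsto_bromOp hr ht ψ)).congr' ?_
      filter_upwards [eventually_ge_atTop 0] with N hN
      rw [hb x hx, hR.bromSum_apply hr t ψ hN]
      rfl

end


theorem mem_airyDomain_iff_mem_range {Z : ℝ} {v : L2G} :
    v ∈ airyDomain Z ↔ v ∈ range (airyRes Z) :=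
  mem_airyDomain_iff.trans (exists_congr fun _ => eq_comm)

theorem exists_continuousOn_rep {Z : ℝ} {u : L2G} (h : u ∈ airyDomain Z) :
    (∃ c, ContinuousOn c (Iic 0) ∧ u.fst =ᵐ[volume.restrict (Iio 0)] c) ∧
      ∃ c, ContinuousOn c (Ici 0) ∧ u.snd =ᵐ[volume.restrict (Ioi 0)] c := by
  obtain ⟨f, um, up, hA, h1, h2, -, -⟩ := h
  exact ⟨⟨_, hA.left.continuousOn 0, h1⟩, ⟨_, hA.right.continuousOn 0, h2⟩⟩

theorem InAiryDomain.continuousOn {Z : ℝ} {vm vp : ℝ → ℂ} (h : InAiryDomain Z vm vp) :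
    ContinuousOn vm (Iic 0) ∧ ContinuousOn vp (Ici 0) := by
  obtain ⟨um, up, hA, hm, hp⟩ := h
  exact ⟨(hA.left.continuousOn 0).congr hm, (hA.right.continuousOn 0).congr hp⟩

/-- The Bromwich inversion formula for the image of the group under a symmetry `Q` of `D(A_Z)`. -/
theorem isInverseLaplace_of_resOp {Z : ℝ} (Q : L2G →L[ℂ] L2G)
    (hQ : ∀ u ∈ airyDomain Z, Q u ∈ airyDomain Z) {ω η : L2G}
    (hη : η ∈ airyDomain Z → ω ∈ airyDomain Z) {Fm Fp : ℂ → ℝ → ℂ}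
    (hF : ∀ lam : ℂ, 0 < lam.re → InAiryDomain Z (Fm lam) (Fp lam) ∧
      IsRepresentedBy (Q (resOp (airyRes Z) lam ω)) (Fm lam) (Fp lam))
    {t r : ℝ} (ht : 0 < t) (hr : 0 < r) :
    IsInverseLaplace Z η (Q (airyGroup Z (-t) ω)) t r Fm Fp := by
  have hR := isSkewResolvent_airyRes Z
  have hm := hR.isBromwich isRetract_Iic restrict_Iio_eq_restrict_Iic (WithLp.fstL 2 ℂ _ _ ∘L Q)
    (fun ψ => (exists_continuousOn_rep (hQ _ (mem_airyDomain_iff_mem_range.2 ⟨ψ, rfl⟩))).1)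
    (fun lam hlam => ⟨(hF lam hlam).1.continuousOn.1, (hF lam hlam).2.1⟩) ht hr
  have hp := hR.isBromwich isRetract_Ici restrict_Ioi_eq_restrict_Ici (WithLp.sndL 2 ℂ _ _ ∘L Q)
    (fun ψ => (exists_continuousOn_rep (hQ _ (mem_airyDomain_iff_mem_range.2 ⟨ψ, rfl⟩))).2)
    (fun lam hlam => ⟨(hF lam hlam).1.continuousOn.2, (hF lam hlam).2.2⟩) ht hr
  exact ⟨hm.1, hp.1, fun h => have h' := mem_airyDomain_iff_mem_range.1 (hη h)
    ⟨hm.2 h', hp.2 h'⟩⟩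

end

theorem proposition7p6 (Z : ℝ) :
    ∃ W : ℝ → (L2G ≃ₗᵢ[ℂ] L2G),
      -- `W` is the unitary group generated by `A_Z`
      (IsUnitaryGroup W ∧ generatorGraph W = airyGraph Z ∧
        ∀ W' : ℝ → (L2G ≃ₗᵢ[ℂ] L2G),
          IsUnitaryGroup W' → generatorGraph W' = airyGraph Z → W' = W) ∧
      -- the roots, the Green's functions and the coefficients
      (∀ lam : ℂ, 0 < lam.re →
        (∃ γ : Fin 3 → ℂ, IsOrderedRoots lam γ) ∧
        ∀ γ : Fin 3 → ℂ, IsOrderedRoots lam γ →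
          IsGreenPlus lam (greenPlus γ) ∧ IsGreenMinus lam (greenMinus γ) ∧
          ∀ ω : L2G,
            (∃! a : Fin 3 → ℂ, InAiryDomain Z (resMinus γ a ω.fst) (resPlus γ a ω.snd)) ∧
            (∃! a : Fin 3 → ℂ, InAiryDomain Z (resReflMinus γ a ω.fst) (resReflPlus γ a ω.snd))) ∧
      -- the representation formulas
      ∀ γ : ℂ → Fin 3 → ℂ, (∀ lam : ℂ, 0 < lam.re → IsOrderedRoots lam (γ lam)) →
        ∀ (ω : L2G) (a : ℂ → Fin 3 → ℂ),
          ((∀ lam : ℂ, 0 < lam.re →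
              InAiryDomain Z (resMinus (γ lam) (a lam) ω.fst) (resPlus (γ lam) (a lam) ω.snd)) →
            (∀ lam : ℂ, 0 < lam.re → ∃ v : L2G, IsResolventAdd Z lam ω v ∧
              IsRepresentedBy v
                (resMinus (γ lam) (a lam) ω.fst) (resPlus (γ lam) (a lam) ω.snd)) ∧
            ∀ t > 0, ∀ r > 0, IsInverseLaplace Z ω (W (-t) ω) t r
              (fun lam => resMinus (γ lam) (a lam) ω.fst)
              (fun lam => resPlus (γ lam) (a lam) ω.snd)) ∧
          ((∀ lam : ℂ, 0 < lam.re →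
              InAiryDomain Z
                (resReflMinus (γ lam) (a lam) ω.fst) (resReflPlus (γ lam) (a lam) ω.snd)) →
            (∀ lam : ℂ, 0 < lam.re → ∃ v : L2G, IsResolventSub Z lam ω v ∧
              IsRepresentedBy v
                (resReflMinus (γ lam) (a lam) ω.fst) (resReflPlus (γ lam) (a lam) ω.snd)) ∧
            ∀ t > 0, ∀ r > 0, IsInverseLaplace Z ω (W t ω) t r
              (fun lam => resReflMinus (γ lam) (a lam) ω.fst)
              (fun lam => resReflPlus (γ lam) (a lam) ω.snd)) := by
  refine ⟨airyGroup Z, ⟨isUnitaryGroup_airyGroup Z, generatorGraph_airyGroup Z, fun W' hW' hg =>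
    hW'.eq (isUnitaryGroup_airyGroup Z) hg (generatorGraph_airyGroup Z)⟩, fun lam hlam =>
    ⟨exists_isOrderedRoots hlam, fun γ h => ⟨isGreenPlus_greenPlus h, isGreenMinus_greenMinus h,
      fun ω => ⟨existsUnique_inAiryDomain Z hlam h ω, ?_⟩⟩⟩, fun γ hγ ω a => ⟨fun ha => ?_,
    fun ha => ?_⟩⟩
  · simp only [inAiryDomain_resRefl_iff]
    exact existsUnique_inAiryDomain Z hlam h (reflect ω)
  · have hv := fun lam hlam => exists_isRepresentedBy_mem_airyGraph (hγ lam hlam) (ha lam hlam)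
    refine ⟨fun lam hlam => ?_, fun t ht r hr => ?_⟩
    · obtain ⟨v, hv1, hv2⟩ := hv lam hlam
      exact ⟨v, isResolventAdd_of_mem_airyGraph hlam hv2, hv1⟩
    · refine isInverseLaplace_of_resOp (ContinuousLinearMap.id ℂ L2G) (fun _ h => h) id
        (fun lam hlam => ⟨ha lam hlam, ?_⟩) ht hr
      obtain ⟨v, hv1, hv2⟩ := hv lam hlam
      rw [← eq_resOp_of_mem_airyGraph hlam hv2]
      exact hv1
  · have hv : ∀ lam : ℂ, 0 < lam.re → ∃ v, (v, reflect ω - lam • v) ∈ airyGraph Z ∧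
        IsRepresentedBy (reflect v) (resReflMinus (γ lam) (a lam) ω.fst)
          (resReflPlus (γ lam) (a lam) ω.snd) := fun lam hlam => by
      obtain ⟨v, hv1, hv2⟩ := exists_isRepresentedBy_mem_airyGraph (hγ lam hlam)
        ((inAiryDomain_resRefl_iff _ _ _).1 (ha lam hlam))
      refine ⟨v, hv2, ?_⟩
      rw [funext (resReflMinus_eq _ _ ω), funext (resReflPlus_eq _ _ ω)]
      exact hv1.reflect
    refine ⟨fun lam hlam => ?_, fun t ht r hr => ?_⟩
    · obtain ⟨v, hv1, hv2⟩ := hv lam hlam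
      refine ⟨reflect v, IsResolventAdd.reflect ?_, hv2⟩
      rw [reflect_reflect]
      exact isResolventAdd_of_mem_airyGraph hlam hv1
    · rw [← reflect_airyGroup_neg]
      refine isInverseLaplace_of_resOp (reflect.toContinuousLinearEquiv : L2G →L[ℂ] L2G)
        (fun _ h => reflect_mem_airyDomain h) reflect_mem_airyDomain
        (fun lam hlam => ⟨ha lam hlam, ?_⟩) ht hr
      obtain ⟨v, hv1, hv2⟩ := hv lam hlam
      rw [← eq_resOp_of_mem_airyGraph hlam hv1]
      exact hv2
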